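/- Let $\mathbb F$ be a field of characteristic different from $2$ with an involution $a\mapsto\bar a$ (possibly the identity), and let $\varepsilon\in\mathbb F$ satisfy $\varepsilon\bar\varepsilon=1$. For a matrix $M$ put $M^*:=\bar M^{T}$ and, if $M$ is nonsingular, $M^{-*}:=(M^{-1})^*$; put $M\oplus N:=\begin{bmatrix}M&0\\0&N\end{bmatrix}$ and $M\diagdown N:=\begin{bmatrix}0&N\\M&0\end{bmatrix}$. Direct sums of pairs are taken componentwise. For $f(x)=a_0x^n+\dots+a_n\in\mathbb F[x]$ with $a_n\ne0$ put $\bar f(x):=\bar a_0x^n+\dots+\bar a_n$ and $f^\vee(x):=\bar a_n^{-1}(\bar a_nx^n+\dots+\bar a_0)$. A nonempty square matrix is indecomposable for similarity if it is not similar to a direct sum of square matrices of smaller sizes. Let $\mathcal O_{\mathbb F}$ be any set of nonsingular indecomposable matrices over $\mathbb F$ such that each nonsingular indecomposable matrix over $\mathbb F$ is similar to exactly one matrix from $\mathcal O_{\mathbb F}$. For $\Phi\in\mathcal O_{\mathbb F}$ let $\chi_\Phi$ be its characteristic polynomial and let $p_\Phi$ be the monic irreducible divisor of $\chi_\Phi$.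 If there is a nonsingular matrix $M$ with $M=\varepsilon M^*=\Phi^*M\Phi$, fix any such $M$ and denote it by $\Phi_{(\varepsilon)}$; otherwise we say that $\Phi_{(\varepsilon)}$ does not exist. If $\Phi_{(\varepsilon)}$ exists, then $p_\Phi=p_\Phi^\vee$, and we consider the field $\mathbb F(\kappa)=\mathbb F[x]/p_\Phi(x)\mathbb F[x]$, $\kappa:=x+p_\Phi(x)\mathbb F[x]$, with the involution $f(\kappa)^\circ:=\bar f(\kappa^{-1})$. We say that a Laurent polynomial $q(x)$ over $\mathbb F$ is $\Phi$-symmetric if $$q(x)=a_rx^r+\dots+a_1x+a_0+\bar a_1x^{-1}+\dots+\bar a_rx^{-r},\qquad a_0=\bar a_0,$$ where $r$ is the integer part of $(\deg p_\Phi)/2$ and, if $\deg p_\Phi=2r$, then $a_r=0$ when the involution on $\mathbb F$ is the identity, $a_r=\bar a_r$ when it is not the identity and $p_\Phi(0)\ne1$, and $a_r=-\bar a_r$ when it is not the identity and $p_\Phi(0)=1$. **Theorem.** Let $B$ be a nondegenerate $\varepsilon$-Hermitian form on a finite-dimensional vector space $V$ over $\mathbb F$ (that is, $B$ is semilinear in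 the first and linear in the second argument, and $B(u,v)=\varepsilon\overline{B(v,u)}$), and let $A$ be a linear operator on $V$ with $B(Au,Av)=B(u,v)$ for all $u,v\in V$. Then in some basis of $V$ the pair $(A,B)$ is given by a direct sum of matrix pairs of the following types: (i) $(\Phi\oplus\Phi^{-*},\ I\diagdown\varepsilon I)$, where $\Phi\in\mathcal O_{\mathbb F}$ is such that $\Phi_{(\varepsilon)}$ does not exist; (ii) $\mathcal A_\Phi^{q(x)}:=(\Phi,\ \Phi_{(\varepsilon)}q(\Phi))$, where $\Phi\in\mathcal O_{\mathbb F}$ is such that $\Phi_{(\varepsilon)}$ exists and $q(x)\ne0$ is $\Phi$-symmetric. Moreover, if $(A,B)$ is given in some basis by a direct sum of pairs of types (i) and (ii), then another direct sum of pairs of types (i) and (ii) also gives $(A,B)$ in some basis if and only if it is obtained from the first one by permuting summands and by the following replacements: * in summands of type (i), replacing $\Phi$ by the $\Psi\in\mathcal O_{\mathbb F}$ that is similar to $\Phi^{-*}$; * replacing the whole group of summands $\mathcal A_\Phi^{q_1(x)}\oplus\dots\oplus\mathcal A_\Phi^{q_s(x)}$ of type (ii) with the same $\Phi$ by $\mathcal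 A_\Phi^{q_1'(x)}\oplus\dots\oplus\mathcal A_\Phi^{q_s'(x)}$, where all $q_i'(x)\ne0$ are $\Phi$-symmetric and the Hermitian forms $\sum_i q_i(\kappa)x_i^\circ x_i$ and $\sum_i q_i'(\kappa)x_i^\circ x_i$ over the field $\mathbb F(\kappa)$ with involution $\circ$ are equivalent. Finally, for $\Phi,\Psi\in\mathcal O_{\mathbb F}$, the matrix $\Psi$ is similar to $\Phi^{-*}$ if and only if $\chi_\Psi(x)=\chi_\Phi^\vee(x)$. -/

import Mathlib

namespace IsometricPairs

open Polynomial LaurentPolynomial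

universe u v

section Matrices

variable {F : Type u} [Field F]

/-- Similarity `S⁻¹ M S = N` of square matrices (whose index types may be different: then `S` is an
invertible rectangular array, which forces the sizes to agree). -/
def Similar {m n : Type*} [Fintype m] [Fintype n] [DecidableEq m] [DecidableEq n]
    (M : Matrix m m F) (N : Matrix n n F) : Prop :=
  ∃ (S : Matrix m n F) (T : Matrix n m F), S * T = 1 ∧ T * S = 1 ∧ T * M * S = N

/-- The direct sum of two square matrices. -/
def dsum {m n : Type*} (M : Matrix m m F) (N : Matrix n n F) : Matrix (m ⊕ n) (m ⊕ n) F :=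
  Matrix.fromBlocks M 0 0 N

/-- The skew sum of two square matrices: the block matrix with rows `(0, N)` and `(M, 0)`. -/
def skewSum {m n : Type*} (M : Matrix m m F) (N : Matrix n n F) :
    Matrix (n ⊕ m) (m ⊕ n) F :=
  Matrix.fromBlocks 0 N M 0

variable (F) in
/-- Square matrices over `F` of arbitrary finite size. -/
abbrev SqMat : Type u := Σ n : ℕ, Matrix (Fin n) (Fin n) F

/-- A (nonempty) square matrix is indecomposable for similarity if it is not similar to a direct
sum of square matrices of smaller sizes. -/
def Indecomposable (Φ : SqMat F) : Prop :=
  0 < Φ.1 ∧ ∀ (a b : ℕ) (P : Matrix (Fin a) (Fin a) F) (Q : Matrix (Fin b) (Fin b) F),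
    a < Φ.1 → b < Φ.1 → ¬ Similar Φ.2 (dsum P Q)

/-- `O` is a maximal set of nonsingular indecomposable canonical matrices for similarity: it
consists of nonsingular indecomposable matrices, and each nonsingular indecomposable matrix is
similar to exactly one matrix from `O`. -/
def IsCanonicalSet (O : Set (SqMat F)) : Prop :=
  (∀ Φ ∈ O, IsUnit Φ.2.det ∧ Indecomposable Φ) ∧
  ∀ M : SqMat F, IsUnit M.2.det → Indecomposable M → ∃! Φ : SqMat F, Φ ∈ O ∧ Similar M.2 Φ.2

theorem exists_irreducibleDivisor (Φ : SqMat F) (h : 0 < Φ.1) :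
    ∃ p : F[X], p.Monic ∧ Irreducible p ∧ p ∣ Φ.2.charpoly := by
  have hd : Φ.2.charpoly.natDegree = Φ.1 := by
    rw [Matrix.charpoly_natDegree_eq_dim, Fintype.card_fin]
  obtain ⟨p, hm, hi, hp⟩ := Polynomial.exists_monic_irreducible_factor Φ.2.charpoly
    (Polynomial.not_isUnit_of_natDegree_pos _ (by omega))
  exact ⟨p, hm, hi, hp⟩

open Classical in
/-- The monic irreducible divisor `p_Φ` of the characteristic polynomial of `Φ` (it is unique if
`Φ` is indecomposable for similarity; for the empty matrix it is set to be `1`). -/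
noncomputable def irreducibleDivisor (Φ : SqMat F) : F[X] :=
  if h : 0 < Φ.1 then (exists_irreducibleDivisor Φ h).choose else 1

theorem irreducibleDivisor_spec (Φ : SqMat F) (h : 0 < Φ.1) :
    (irreducibleDivisor Φ).Monic ∧ Irreducible (irreducibleDivisor Φ) ∧
      irreducibleDivisor Φ ∣ Φ.2.charpoly := by
  rw [irreducibleDivisor, dif_pos h]
  exact (exists_irreducibleDivisor Φ h).choose_spec

open Classical in
/-- The value `q(x) = ∑ aₙ xⁿ` of a Laurent polynomial `q` at an invertible element `x` of an
`F`-algebra (the value is `0` if `x` is not invertible). -/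
noncomputable def laurentValue {R : Type*} [Ring R] [Algebra F R] (q : F[T;T⁻¹]) (x : R) : R :=
  if h : IsUnit x then q.smeval h.unit else 0

end Matrices

section Involution

variable {F : Type u} [Field F] [StarRing F]

/-- For `f = a₀xⁿ + ⋯ + aₙ`, the polynomial `f^∨ = āₙ⁻¹(āₙxⁿ + ⋯ + ā₀)` (used if `aₙ ≠ 0`). -/
noncomputable def vee (f : F[X]) : F[X] :=
  Polynomial.C (star (f.coeff 0))⁻¹ * (f.map (starRingEnd F)).reverse

/-- The involution `f(κ)° = f̄(κ⁻¹)` on `F(κ) = F[x]/(p)`, where `κ` is the class of `x`. It is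
independent of the choice of `f` if `p` is irreducible and `p = p^∨`, see `circ_mk`. -/
noncomputable def circ (p : F[X]) (z : AdjoinRoot p) : AdjoinRoot p :=
  aeval (Ring.inverse (AdjoinRoot.root p))
    ((AdjoinRoot.mk_surjective (g := p) z).choose.map (starRingEnd F))

theorem circ_mk (p : F[X]) (hp : Irreducible p) (hv : vee p = p) (f : F[X]) :
    circ p (AdjoinRoot.mk p f) =
      aeval (Ring.inverse (AdjoinRoot.root p)) (f.map (starRingEnd F)) := by
  have : Fact (Irreducible p) := ⟨hp⟩
  have h0 : p.coeff 0 ≠ 0 := by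
    intro h
    apply hp.ne_zero
    rw [← hv, vee, h]
    simp
  have hpκ : aeval (AdjoinRoot.root p) p = 0 := by
    rw [AdjoinRoot.aeval_eq, AdjoinRoot.mk_self]
  have hκ : AdjoinRoot.root p ≠ 0 := by
    intro h
    rw [h, aeval_def, eval₂_at_zero] at hpκ
    exact h0 ((map_eq_zero _).1 hpκ)
  have hr : aeval (AdjoinRoot.root p) (p.map (starRingEnd F)).reverse = 0 := by
    have h1 : aeval (AdjoinRoot.root p) (vee p) = 0 := by rw [hv, hpκ]
    rw [vee, map_mul, aeval_C] at h1
    refine (mul_eq_zero.1 h1).resolve_left ?_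
    simpa using h0
  have hi : aeval (Ring.inverse (AdjoinRoot.root p)) (p.map (starRingEnd F)) = 0 := by
    let _ : Invertible (Ring.inverse (AdjoinRoot.root p)) :=
      ⟨AdjoinRoot.root p, by simp [Ring.inverse_eq_inv', hκ],
        by simp [Ring.inverse_eq_inv', hκ]⟩
    rw [aeval_def, ← eval₂_reverse_eq_zero_iff]
    exact hr
  have hc := (AdjoinRoot.mk_surjective (g := p) (AdjoinRoot.mk p f)).choose_spec
  rw [AdjoinRoot.mk_eq_mk] at hc
  obtain ⟨c, hc⟩ := hc
  rw [circ, ← sub_eq_zero, ← map_sub (aeval (R := F) (Ring.inverse (AdjoinRoot.root p))), ← Polynomial.map_sub, hc, Polynomial.map_mul, map_mul, hi,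
    zero_mul]

/-- `q(x)` has the form `a_r x^r + ⋯ + a₁ x + a₀ + ā₁ x⁻¹ + ⋯ + ā_r x⁻ʳ` with `a₀ = ā₀`, where `r`
is the integer part of `deg p / 2`, and if `deg p = 2r` then `a_r = 0` if the involution on `F` is
the identity, `a_r = ā_r` if it is not the identity and `p(0) ≠ 1`, and `a_r = -ā_r` if it is not
the identity and `p(0) = 1`. -/
def IsSymmetricForm (p : F[X]) (q : F[T;T⁻¹]) : Prop :=
  (∀ n : ℤ, q.coeff (-n) = star (q.coeff n)) ∧
  (∀ n : ℤ, p.natDegree / 2 < n.natAbs → q.coeff n = 0) ∧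
  (p.natDegree = 2 * (p.natDegree / 2) →
    ((∀ a : F, star a = a) → q.coeff (p.natDegree / 2 : ℕ) = 0) ∧
    ((¬ ∀ a : F, star a = a) → p.eval 0 ≠ 1 →
      q.coeff (p.natDegree / 2 : ℕ) = star (q.coeff (p.natDegree / 2 : ℕ))) ∧
    ((¬ ∀ a : F, star a = a) → p.eval 0 = 1 →
      q.coeff (p.natDegree / 2 : ℕ) = -star (q.coeff (p.natDegree / 2 : ℕ))))

/-- The value at `(x, y)` of the Hermitian form `∑ qᵢ(κ) xᵢ° yᵢ` over `F(κ) = F[x]/(p)`. -/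
noncomputable def diagForm (p : F[X]) {I : Type*} [Fintype I] (q : I → F[T;T⁻¹])
    (x y : I → AdjoinRoot p) : AdjoinRoot p :=
  ∑ i, laurentValue (q i) (AdjoinRoot.root p) * circ p (x i) * y i

/-- The Hermitian forms `∑ qᵢ(κ) xᵢ° xᵢ` and `∑ q'ⱼ(κ) xⱼ° xⱼ` are equivalent over `F(κ)`. -/
def FormsEquivalent (p : F[X]) {I J : Type*} [Fintype I] [Fintype J]
    (q : I → F[T;T⁻¹]) (q' : J → F[T;T⁻¹]) : Prop :=
  ∃ g : (I → AdjoinRoot p) ≃ₗ[AdjoinRoot p] (J → AdjoinRoot p),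
    ∀ x y, diagForm p q' (g x) (g y) = diagForm p q x y

/-- `M` may serve as `Φ_(ε)`: it is nonsingular and `M = ε M* = Φ* M Φ`. -/
def IsEpsMatrix (ε : F) (Φ : SqMat F) (M : Matrix (Fin Φ.1) (Fin Φ.1) F) : Prop :=
  IsUnit M.det ∧ M = ε • M.conjTranspose ∧ M = Φ.2.conjTranspose * M * Φ.2

/-- `Φ_(ε)` exists. -/
def HasEpsMatrix (ε : F) (Φ : SqMat F) : Prop := ∃ M, IsEpsMatrix ε Φ M

/-- The matrix `Φ^{-*}`. -/
noncomputable def invStar (Φ : SqMat F) : Matrix (Fin Φ.1) (Fin Φ.1) F :=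
  (Φ.2⁻¹).conjTranspose

/-- The list of summands of a direct sum: `Φ₁, …, Φ_k` for the summands
`(Φᵢ ⊕ Φᵢ^{-*}, I \ εI)` of type (i), and `(Ψ₁, q₁), …, (Ψ_l, q_l)` for the summands
`(Ψⱼ, (Ψⱼ)_(ε) qⱼ(Ψⱼ))` of type (ii). -/
structure SummandList (F : Type u) [Field F] where
  k : ℕ
  Φ : Fin k → SqMat F
  l : ℕ
  Ψ : Fin l → SqMat F
  q : Fin l → F[T;T⁻¹]

namespace SummandList

/-- The conditions on the parameters of the summands of types (i) and (ii). -/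
def Admissible (ε : F) (O : Set (SqMat F)) (D : SummandList F) : Prop :=
  (∀ i, D.Φ i ∈ O ∧ ¬ HasEpsMatrix ε (D.Φ i)) ∧
  (∀ j, D.Ψ j ∈ O ∧ HasEpsMatrix ε (D.Ψ j) ∧ D.q j ≠ 0 ∧
    IsSymmetricForm (irreducibleDivisor (D.Ψ j)) (D.q j))

/-- The set that enumerates the rows and columns of the matrices of the direct sum. -/
abbrev Index (D : SummandList F) : Type :=
  (Σ i : Fin D.k, Fin (D.Φ i).1 ⊕ Fin (D.Φ i).1) ⊕ (Σ j : Fin D.l, Fin (D.Ψ j).1)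

/-- The first matrix of the direct sum of the pairs. -/
noncomputable def opMatrix (D : SummandList F) : Matrix D.Index D.Index F :=
  dsum (Matrix.blockDiagonal' fun i => dsum (D.Φ i).2 (invStar (D.Φ i)))
    (Matrix.blockDiagonal' fun j => (D.Ψ j).2)

/-- The second matrix of the direct sum of the pairs, where `E Φ` is the chosen `Φ_(ε)`. -/
noncomputable def formMatrix (ε : F) (E : ∀ Φ : SqMat F, Matrix (Fin Φ.1) (Fin Φ.1) F)
    (D : SummandList F) : Matrix D.Index D.Index F :=
  dsum
    (Matrix.blockDiagonal' fun i =>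
      skewSum (1 : Matrix (Fin (D.Φ i).1) (Fin (D.Φ i).1) F)
        (ε • (1 : Matrix (Fin (D.Φ i).1) (Fin (D.Φ i).1) F)))
    (Matrix.blockDiagonal' fun j => E (D.Ψ j) * laurentValue (D.q j) (D.Ψ j).2)

/-- The pair `(A, B)` is given in some basis by the direct sum of the pairs in the list. -/
def Represents (ε : F) (E : ∀ Φ : SqMat F, Matrix (Fin Φ.1) (Fin Φ.1) F) (D : SummandList F)
    {V : Type v} [AddCommGroup V] [Module F V] (A : V →ₗ[F] V) (B : V →ₗ⋆[F] V →ₗ[F] F) : Prop :=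
  ∃ e : Module.Basis D.Index F V,
    LinearMap.toMatrix e e A = D.opMatrix ∧
    ∀ i j, B (e i) (e j) = D.formMatrix ε E i j

open Classical in
/-- Up to permutations of summands, `D'` is obtained from `D` by replacing in some summands of type
(i) the matrix `Φ` by a matrix similar to `Φ^{-*}`, and by replacing, for each `Φ`, the group of
all summands of type (ii) with this `Φ` by a group of equally many summands with the same `Φ` such
that the corresponding Hermitian forms over `F[x]/(p_Φ)` are equivalent. -/
def Equivalent (D D' : SummandList F) : Prop :=
  (∃ σ : Fin D.k ≃ Fin D'.k, ∀ i,
    D'.Φ (σ i) = D.Φ i ∨ Similar (D'.Φ (σ i)).2 (invStar (D.Φ i))) ∧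
  ∀ Φ : SqMat F,
    Fintype.card {j : Fin D.l // D.Ψ j = Φ} = Fintype.card {j : Fin D'.l // D'.Ψ j = Φ} ∧
    FormsEquivalent (irreducibleDivisor Φ)
      (fun j : {j : Fin D.l // D.Ψ j = Φ} => D.q j)
      (fun j : {j : Fin D'.l // D'.Ψ j = Φ} => D'.q j)

end SummandList

end Involution

end IsometricPairs

namespace IsometricPairs

open Polynomial LaurentPolynomial

universe u v

/-! ### Laurent polynomials: evaluation at units, residue fields, the involution. -/

section LaurentRing

variable {F : Type u} [Field F]

/-! Nondegeneracy makes A invertible, so V becomes a finite-dimensional module over the principal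
ideal domain L = F[T, T⁻¹], with T acting as A. That A is an isometry means that the adjoint of
multiplication by g is multiplication by `star g`, where the involution of L conjugates the
coefficients and sends T to T⁻¹ (`IsoForm.adjoint`). A nonsingular indecomposable matrix Φ is a
cyclic module L/(p^(k+1)) with p = p_Φ, and Φ^{-*} is the one for `star p`. The form is studied
through the functionals f ↦ B(u, f v) on L. On a cyclic module every functional is a multiple of any
nondegenerate one (`exists_functional_eq_mul`), and Φ_(ε) exists exactly when L/(p^(k+1)) carries a
nondegenerate ε-Hermitian functional φ (`IsCyclicVector.isEpsFunctional`,
`IsEpsFunctional.hasEpsMatrix`).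

Existence (`IsoForm.exists_block`). There are x and y, killed by p^(k+1) and by its conjugate, with
B(y, p^k x) ≠ 0. If p and `star p` are not associated, both generate isotropic submodules and
together give a summand of type (i). Suppose they are associated. If some u killed by p^(k+1) has
B(u, p^k f u) ≠ 0 for some f, then f ↦ B(u, f u) is itself ε-Hermitian, so Φ_(ε) exists and B(u, f
u) = φ(h f) with h symmetric and prime to p. Modulo p, h is congruent to some q of the prescribed
shape (`exists_isSymmetricForm`); since 2 is invertible, this lifts to a congruence of g* h g with q
modulo p^(k+1) (`exists_congruence_lift`), and g u generates a summand of type (ii). If there is no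
such u, then x and y can be made isotropic (`IsoForm.exists_hyperbolic`) and Φ_(ε) cannot exist. The
block is nondegenerate in each case, so its orthogonal complement is treated by induction on the
dimension.

Uniqueness. Two direct sums for (A, B) decompose V into cyclic modules in two ways. The transition
coefficients between the generators with annihilator p^(k+1) become mutually inverse matrices modulo
p, because all other summands contribute multiples of p (`IsCyclicSystem.sum_transition`). Hence the
multiplicities agree, and computing B on p^k-multiples in both systems shows that these matrices
identify the Hermitian forms over F(κ) (`IsCyclicFrame.congruence_snd`). Conversely, an equivalence
over F(κ) is a congruence modulo p; lifted modulo p^(k+1), it yields new generators of type (ii),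
while passing from Φ to Φ^{-*} in type (i) interchanges the two halves of the summand
(`IsCyclicFrame.exists_of_equivalent`). -/

instance : IsPrincipalIdealRing F[T;T⁻¹] := ⟨fun J => by
  obtain ⟨⟨g, hg⟩⟩ := IsPrincipalIdealRing.principal (J.comap (algebraMap F[X] F[T;T⁻¹]))
  refine ⟨⟨algebraMap F[X] F[T;T⁻¹] g, ?_⟩⟩
  -- An ideal of a localization is the extension of its contraction, here a principal ideal of
  -- `F[X]`.
  rw [← IsLocalization.map_under (Submonoid.powers (X : F[X])) F[T;T⁻¹] J, Ideal.under_def, hg]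
  simp only [Ideal.submodule_span_eq, Ideal.map_span, Set.image_singleton]⟩

/-- Evaluation of Laurent polynomials at a unit, as an algebra homomorphism. -/
noncomputable def evalUnit {R : Type*} [Ring R] [Algebra F R] (x : Rˣ) : F[T;T⁻¹] →ₐ[F] R :=
  AddMonoidAlgebra.lift F R ℤ ((Units.coeHom R).comp (zpowersHom Rˣ x))

@[simp]
theorem evalUnit_T {R : Type*} [Ring R] [Algebra F R] (x : Rˣ) (n : ℤ) :
    evalUnit x (T n : F[T;T⁻¹]) = ((x ^ n : Rˣ) : R) := by
  rw [evalUnit, T, AddMonoidAlgebra.lift_single]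
  simp [zpowersHom]

theorem laurentValue_unit {R : Type*} [Ring R] [Algebra F R] (x : Rˣ) (q : F[T;T⁻¹]) :
    laurentValue q (x : R) = evalUnit x q := by
  have hx : IsUnit (x : R) := x.isUnit
  rw [laurentValue, dif_pos hx]
  have : hx.unit = x := Units.ext rfl
  rw [this, evalUnit, AddMonoidAlgebra.lift_apply]
  simp [LaurentPolynomial.smeval, zpowersHom]

theorem evalUnit_toLaurent {R : Type*} [Ring R] [Algebra F R] (x : Rˣ) (f : F[X]) :
    evalUnit x (toLaurent f) = aeval (x : R) f := by
  have : (evalUnit x).comp (toLaurentAlg (R := F)) = aeval (x : R) := by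
    ext
    simp
  rw [← this]
  simp

/-- Every Laurent polynomial is, up to a unit, a polynomial. -/
theorem exists_associated_toLaurent (q : F[T;T⁻¹]) : ∃ f : F[X], Associated (toLaurent f) q := by
  obtain ⟨n, f, hf⟩ := q.exists_T_pow
  refine ⟨f, Associated.symm ⟨(isUnit_T (n : ℤ)).unit, ?_⟩⟩
  rw [hf]; rfl

theorem half_mul_two (h2 : (2 : F) ≠ 0) : algebraMap F F[T;T⁻¹] 2⁻¹ * 2 = 1 := by
  have : (2 : F[T;T⁻¹]) = algebraMap F F[T;T⁻¹] 2 := (map_ofNat _ 2).symm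
  rw [this, ← map_mul, inv_mul_cancel₀ h2, map_one]

open Classical in
/-- Evaluation of Laurent polynomials at an invertible element (and at `1` if the element is not
invertible), as an algebra homomorphism. -/
noncomputable def unitEval {R : Type*} [Ring R] [Algebra F R] (x : R) : F[T;T⁻¹] →ₐ[F] R :=
  if h : IsUnit x then evalUnit h.unit else evalUnit 1

theorem laurentValue_eq {R : Type*} [Ring R] [Algebra F R] {x : R} (hx : IsUnit x)
    (q : F[T;T⁻¹]) : laurentValue q x = unitEval x q := by
  obtain ⟨y, rfl⟩ := hx
  have h : y.isUnit.unit = y := Units.ext rfl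
  rw [laurentValue_unit, unitEval, dif_pos y.isUnit, h]

theorem unitEval_toLaurent {R : Type*} [Ring R] [Algebra F R] {x : R} (hx : IsUnit x) (f : F[X]) :
    unitEval x (toLaurent f) = aeval x f := by
  rw [unitEval, dif_pos hx, evalUnit_toLaurent, IsUnit.unit_spec]

theorem unitEval_T_one {R : Type*} [Ring R] [Algebra F R] {x : R} (hx : IsUnit x) :
    unitEval x (T 1 : F[T;T⁻¹]) = x := by
  rw [← toLaurent_X, unitEval_toLaurent hx, aeval_X]

theorem unitEval_T_neg_one {R : Type*} [Ring R] [Algebra F R] {x : R} (hx : IsUnit x) :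
    unitEval x (T (-1) : F[T;T⁻¹]) = Ring.inverse x := by
  rw [unitEval, dif_pos hx, evalUnit_T, zpow_neg_one]
  obtain ⟨y, rfl⟩ := hx
  rw [Ring.inverse_unit]
  congr 2
  exact Units.ext rfl

section Residue

variable {p : F[X]}

theorem isUnit_root_of_coeff_zero_ne_zero (hp : Irreducible p) (h0 : p.coeff 0 ≠ 0) :
    IsUnit (AdjoinRoot.root p) := by
  have : Fact (Irreducible p) := ⟨hp⟩
  rw [isUnit_iff_ne_zero]
  intro h
  have hpκ : aeval (AdjoinRoot.root p) p = 0 := by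
    rw [AdjoinRoot.aeval_eq, AdjoinRoot.mk_self]
  rw [h, aeval_def, eval₂_at_zero] at hpκ
  exact h0 ((map_eq_zero _).1 hpκ)

/-- Multiplication by a power of T, a unit, reduces this to ordinary polynomials. With surjectivity
it identifies the Laurent ring modulo p with the field F(κ). -/
theorem unitEval_root_eq_zero_iff (hp : Irreducible p) (h0 : p.coeff 0 ≠ 0) (q : F[T;T⁻¹]) :
    unitEval (AdjoinRoot.root p) q = 0 ↔ toLaurent p ∣ q := by
  have hu := isUnit_root_of_coeff_zero_ne_zero hp h0
  have hf : ∀ f : F[X], unitEval (AdjoinRoot.root p) (toLaurent f) = AdjoinRoot.mk p f :=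
    fun f => by rw [unitEval_toLaurent hu, AdjoinRoot.aeval_eq]
  constructor
  · intro h
    obtain ⟨n, f, hn⟩ := q.exists_T_pow
    have h1 : AdjoinRoot.mk p f = 0 := by rw [← hf, hn, map_mul, h, zero_mul]
    rw [AdjoinRoot.mk_eq_zero] at h1
    have h2 := map_dvd (toLaurent (R := F)) h1
    rw [hn] at h2
    exact ((isUnit_T (n : ℤ)).dvd_mul_right).1 h2
  · rintro ⟨r, rfl⟩
    rw [map_mul, hf, AdjoinRoot.mk_self, zero_mul]

theorem unitEval_root_surjective (hp : Irreducible p) (h0 : p.coeff 0 ≠ 0) :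
    Function.Surjective (unitEval (F := F) (AdjoinRoot.root p)) := by
  intro z
  obtain ⟨f, rfl⟩ := AdjoinRoot.mk_surjective z
  exact ⟨toLaurent f, by
    rw [unitEval_toLaurent (isUnit_root_of_coeff_zero_ne_zero hp h0), AdjoinRoot.aeval_eq]⟩

/-- The element generates the kernel of a homomorphism to the field F(κ). -/
theorem prime_toLaurent (hp : Irreducible p) (h0 : p.coeff 0 ≠ 0) :
    Prime (toLaurent p) := by
  have : Fact (Irreducible p) := ⟨hp⟩
  refine ⟨toLaurent_ne_zero.2 hp.ne_zero, fun hu => ?_, fun a b hab => ?_⟩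
  · rw [isUnit_iff_dvd_one, ← unitEval_root_eq_zero_iff hp h0, map_one] at hu
    exact one_ne_zero hu
  · rw [← unitEval_root_eq_zero_iff hp h0, map_mul, mul_eq_zero] at hab
    simpa only [unitEval_root_eq_zero_iff hp h0] using hab

end Residue

variable [StarRing F]

/-- The involution on Laurent polynomials: the involution of the field on the coefficients,
and `T ↦ T⁻¹`. -/
noncomputable def conjHom : F[T;T⁻¹] →+* F[T;T⁻¹] :=
  (invert (R := F)).toRingEquiv.toRingHom.comp
    (AddMonoidAlgebra.mapRingHom ℤ (starRingEnd F))

theorem coeff_conjHom (q : F[T;T⁻¹]) (n : ℤ) :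
    (conjHom q).coeff n = star (q.coeff (-n)) := by
  change (invert (AddMonoidAlgebra.mapRingHom ℤ (starRingEnd F) q)).coeff n = _
  rw [invert_apply, AddMonoidAlgebra.coeff_mapRingHom]
  rfl

noncomputable instance : StarRing F[T;T⁻¹] where
  star := conjHom
  star_involutive q := by ext n; simp [coeff_conjHom]
  star_mul p q := by
    rw [map_mul, mul_comm]
  star_add p q := map_add conjHom p q

theorem coeff_star (q : F[T;T⁻¹]) (n : ℤ) : (star q).coeff n = star (q.coeff (-n)) :=
  coeff_conjHom q n

theorem star_mul_comm (p q : F[T;T⁻¹]) : star (p * q) = star p * star q := by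
  rw [star_mul, mul_comm]

@[simp]
theorem star_T (n : ℤ) : star (T n : F[T;T⁻¹]) = T (-n) := by
  ext m
  rw [coeff_star, T_apply, T_apply]
  by_cases h : n = -m
  · rw [if_pos h, if_pos (by omega), star_one]
  · rw [if_neg h, if_neg (by omega), star_zero]

@[simp]
theorem star_C (a : F) :
    star (LaurentPolynomial.C a) = LaurentPolynomial.C (star a) := by
  ext m
  rw [coeff_star, C_apply, C_apply]
  by_cases h : m = 0
  · simp [h]
  · simp [h]

theorem star_smul_laurent (a : F) (q : F[T;T⁻¹]) : star (a • q) = star a • star q := by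
  rw [LaurentPolynomial.smul_eq_C_mul, LaurentPolynomial.smul_eq_C_mul, star_mul_comm, star_C]

theorem star_dvd_star {p q : F[T;T⁻¹]} (h : p ∣ q) : star p ∣ star q := by
  obtain ⟨r, rfl⟩ := h
  exact ⟨star r, star_mul_comm p r⟩

theorem star_half : star (algebraMap F F[T;T⁻¹] 2⁻¹) = algebraMap F F[T;T⁻¹] 2⁻¹ := by
  rw [← LaurentPolynomial.C_eq_algebraMap, star_C, star_inv₀]
  congr 3
  exact star_ofNat 2

end LaurentRing

/-! ### Primary vectors and functionals on cyclic modules. -/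

section PrimaryModules

variable {F : Type u} [Field F]
variable {V : Type v} [AddCommGroup V] [Module F[T;T⁻¹] V]

/-- Cayley–Hamilton for the action of T. -/
theorem exists_annihilating (V : Type v) [AddCommGroup V] [Module F V] [Module F[T;T⁻¹] V]
    [IsScalarTower F F[T;T⁻¹] V] [FiniteDimensional F V] :
    ∃ c : F[T;T⁻¹], c ≠ 0 ∧ ∀ v : V, c • v = 0 := by
  set A : Module.End F V := Module.toModuleEnd F V (T 1 : F[T;T⁻¹])
  refine ⟨toLaurent A.charpoly, toLaurent_ne_zero.2 A.charpoly_monic.ne_zero, fun v => ?_⟩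
  have h : ∀ f : F[X], toLaurent f • v = aeval A f v := by
    intro f
    have : (Algebra.lsmul F F V : F[T;T⁻¹] →ₐ[F] Module.End F V).comp (toLaurentAlg (R := F))
      = aeval A := by
      ext
      simp [A]
    rw [← this]
    simp
  rw [h, LinearMap.aeval_self_charpoly, LinearMap.zero_apply]

/-- The annihilator of x is principal and its generator divides p^(k+1), so it is a power of p; an
exponent of at most k is excluded by p^k x ≠ 0. -/
theorem smul_eq_zero_iff_dvd {p : F[T;T⁻¹]} (hp : Prime p) {k : ℕ} {x : V}
    (h1 : p ^ (k + 1) • x = 0) (h2 : p ^ k • x ≠ 0) (f : F[T;T⁻¹]) :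
    f • x = 0 ↔ p ^ (k + 1) ∣ f := by
  constructor
  · intro hf
    obtain ⟨⟨d, hd⟩⟩ := IsPrincipalIdealRing.principal
      (LinearMap.ker (LinearMap.toSpanSingleton F[T;T⁻¹] V x))
    have key : ∀ g : F[T;T⁻¹], g • x = 0 ↔ d ∣ g := by
      intro g
      have : g ∈ LinearMap.ker (LinearMap.toSpanSingleton F[T;T⁻¹] V x) ↔ g • x = 0 := by simp
      rw [← this, hd, Ideal.submodule_span_eq, Ideal.mem_span_singleton]
    obtain ⟨i, hi, ha⟩ := (dvd_prime_pow hp (k + 1)).1 ((key _).1 h1)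
    have hik : i = k + 1 := by
      by_contra hne
      exact h2 ((key _).2 (ha.dvd.trans (pow_dvd_pow p (by omega))))
    subst hik
    exact ha.symm.dvd.trans ((key f).1 hf)
  · rintro ⟨g, rfl⟩
    rw [mul_comm, mul_smul, h1, smul_zero]

theorem isCoprime_pow_of_not_dvd {p s : F[T;T⁻¹]} (hp : Prime p) (h : ¬ p ∣ s) (k : ℕ) :
    IsCoprime (p ^ k) s :=
  IsCoprime.pow_left ((hp.irreducible.coprime_iff_not_dvd).2 h)

/-- Here p^(k+1) s generates the annihilator of V and p does not divide s; thus x has maximal order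
among the p-primary vectors, which makes it split off later. -/
theorem exists_primary_vector (V : Type v) [AddCommGroup V] [Module F V] [Module F[T;T⁻¹] V]
    [IsScalarTower F F[T;T⁻¹] V] [FiniteDimensional F V] [Nontrivial V] :
    ∃ (p s : F[T;T⁻¹]) (k : ℕ) (x : V), Prime p ∧ (∀ v : V, (p ^ (k + 1) * s) • v = 0) ∧
      IsCoprime (p ^ (k + 1)) s ∧ p ^ (k + 1) • x = 0 ∧ p ^ k • x ≠ 0 := by
  obtain ⟨⟨μ, hμ⟩⟩ := IsPrincipalIdealRing.principal (Module.annihilator F[T;T⁻¹] V)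
  have key : ∀ g : F[T;T⁻¹], (∀ v : V, g • v = 0) ↔ μ ∣ g := by
    intro g
    rw [← Module.mem_annihilator, hμ, Ideal.submodule_span_eq, Ideal.mem_span_singleton]
  have hμ0 : μ ≠ 0 := by
    obtain ⟨c, hc, hcV⟩ := exists_annihilating (F := F) V
    rintro rfl
    exact hc (zero_dvd_iff.1 ((key c).1 hcV))
  have hμu : ¬ IsUnit μ := by
    intro hu
    obtain ⟨v, hv⟩ := exists_ne (0 : V)
    apply hv
    have := (key 1).2 (isUnit_iff_dvd_one.1 hu) v
    rwa [one_smul] at this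
  obtain ⟨p, hp, hpμ⟩ := WfDvdMonoid.exists_irreducible_factor hμu hμ0
  have hpp : Prime p := hp.prime
  obtain ⟨s, hs, hns⟩ := (FiniteMultiplicity.of_not_isUnit hp.not_isUnit hμ0
    ).exists_eq_pow_mul_and_not_dvd
  obtain ⟨k, hk⟩ : ∃ k, multiplicity p μ = k + 1 := by
    refine Nat.exists_eq_succ_of_ne_zero fun h0 => hns ?_
    rw [h0, pow_zero, one_mul] at hs
    rwa [← hs]
  rw [hk] at hs
  -- This is a proper divisor of μ, so it cannot annihilate V.
  have : ¬ ∀ v : V, (p ^ k * s) • v = 0 := by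
    rw [key, hs, pow_succ, mul_assoc, mul_comm p s, ← mul_assoc]
    intro hd
    have h0 : p ^ k * s ≠ 0 := mul_ne_zero (pow_ne_zero _ hp.ne_zero) (by
      rintro rfl; exact hns (dvd_zero _))
    have : (p ^ k * s) * p ∣ (p ^ k * s) * 1 := by rwa [mul_one]
    exact hp.not_isUnit (isUnit_iff_dvd_one.2 ((mul_dvd_mul_iff_left h0).1 this))
  push Not at this
  obtain ⟨v, hv⟩ := this
  refine ⟨p, s, k, s • v, hpp, ?_, isCoprime_pow_of_not_dvd hpp hns _, ?_, ?_⟩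
  · rw [key, hs]
  · rw [← mul_smul, ← hs]; exact (key μ).2 dvd_rfl v
  · rwa [← mul_smul]

/-- Functionals on a cyclic module `F[T;T⁻¹] / (c)`: each is a multiple of a nondegenerate one. -/
theorem exists_functional_eq_mul [Module F V] [IsScalarTower F F[T;T⁻¹] V]
    [FiniteDimensional F V] {x : V} {c : F[T;T⁻¹]}
    (hx : ∀ f : F[T;T⁻¹], f • x = 0 ↔ c ∣ f) (φ ψ : F[T;T⁻¹] →ₗ[F] F)
    (hφ : ∀ h, c ∣ h ↔ ∀ f, φ (h * f) = 0) (hψ : ∀ f, ψ (c * f) = 0) :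
    ∃ h, ∀ f, ψ f = φ (h * f) := by
  set e : F[T;T⁻¹] →ₗ[F] V := (LinearMap.toSpanSingleton F[T;T⁻¹] V x).restrictScalars F
  have he : ∀ f, e f = f • x := fun f => rfl
  -- An F-linear choice s of representatives for the elements of the cyclic module generated by x.
  obtain ⟨s, hs⟩ := e.rangeRestrict.exists_rightInverse_of_surjective e.range_rangeRestrict
  have hs' : ∀ f, c ∣ s (e.rangeRestrict f) - f := by
    intro f
    rw [← hx, sub_smul, sub_eq_zero]
    exact congrArg Subtype.val (LinearMap.congr_fun hs (e.rangeRestrict f))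
  have hinj : Function.Injective s := by
    intro a b hab
    rw [← LinearMap.id_apply (R := F) a, ← LinearMap.id_apply (R := F) b, ← hs,
      LinearMap.comp_apply, LinearMap.comp_apply, hab]
  have hs0 : ∀ y, c ∣ s y → y = 0 := by
    intro y hy
    have h1 := LinearMap.congr_fun hs y
    rw [← hx] at hy
    rw [LinearMap.id_apply] at h1
    rw [← h1]
    exact Subtype.ext hy
  have hψ' : ∀ a b, c ∣ a - b → ψ a = ψ b := by
    rintro a b ⟨r, hr⟩
    rw [← sub_eq_zero, ← map_sub, hr, hψ]
  have hφ' : ∀ a b, c ∣ a - b → φ a = φ b := by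
    intro a b hr
    rw [← sub_eq_zero, ← map_sub, ← mul_one (a - b)]
    exact (hφ _).1 hr 1
  -- The bilinear form φ(ab) on the finite-dimensional cyclic module is nondegenerate, so it
  -- represents every functional, in particular ψ.
  set Θ : LinearMap.range e →ₗ[F] Module.Dual F (LinearMap.range e) :=
    ((LinearMap.mul F F[T;T⁻¹]).compr₂ φ).compl₁₂ s s
  have hΘ : ∀ a b, Θ a b = φ (s a * s b) := fun a b => rfl
  have hΘi : Function.Injective Θ := by
    rw [injective_iff_map_eq_zero]
    intro a ha
    refine hs0 a ((hφ _).2 fun f => ?_)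
    have := LinearMap.congr_fun ha (e.rangeRestrict f)
    rw [hΘ, LinearMap.zero_apply] at this
    rw [← this]
    apply hφ'
    rw [← mul_sub]
    exact Dvd.dvd.mul_left ((dvd_neg.2 (hs' f)).trans (by rw [neg_sub])) _
  have hΘs := (LinearMap.injective_iff_surjective_of_finrank_eq_finrank
    (Subspace.dual_finrank_eq (K := F) (V := LinearMap.range e)).symm).1 hΘi
  obtain ⟨a, ha⟩ := hΘs (ψ.comp s)
  refine ⟨s a, fun f => ?_⟩
  have := LinearMap.congr_fun ha (e.rangeRestrict f)
  rw [hΘ, LinearMap.comp_apply, hψ' _ _ (hs' f)] at this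
  rw [← this]
  apply hφ'
  rw [← mul_sub]
  exact Dvd.dvd.mul_left (hs' f) _

end PrimaryModules

end IsometricPairs
namespace IsometricPairs

open Polynomial LaurentPolynomial

universe u v

/-! ### Families of vectors on which T acts by a matrix, and similarity. -/

section OpFamilies

variable {F : Type u} [Field F]
variable {V : Type v} [AddCommGroup V] [Module F V] [Module F[T;T⁻¹] V]
  [IsScalarTower F F[T;T⁻¹] V]
variable {n m : Type*} [Fintype n] [DecidableEq n] [Fintype m] [DecidableEq m]

omit [DecidableEq n] [IsScalarTower F F[T;T⁻¹] V] in
/-- The action of `T` on the vectors `e` is given by the matrix `P`. -/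
def IsOpFamily (P : Matrix n n F) (e : n → V) : Prop :=
  ∀ y, (T 1 : F[T;T⁻¹]) • e y = ∑ x, P x y • e x

theorem laurent_smul_smul (g : F[T;T⁻¹]) (a : F) (v : V) : g • a • v = a • g • v := by
  rw [← IsScalarTower.algebraMap_smul F[T;T⁻¹] a v, ← mul_smul, mul_comm, mul_smul,
    IsScalarTower.algebraMap_smul]

/-- It suffices to treat T and T⁻¹; the action of T⁻¹ follows from that of T because P is
invertible. Linear independence of e is not needed. -/
theorem laurent_smul_linearCombination {P : Matrix n n F} (hP : IsUnit P.det) {e : n → V}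
    (he : IsOpFamily P e) (g : F[T;T⁻¹]) (v : n → F) :
    g • Fintype.linearCombination F e v
      = Fintype.linearCombination F e ((unitEval P g).mulVec v) := by
  have hP' : IsUnit P := (Matrix.isUnit_iff_isUnit_det P).2 hP
  have h1 : ∀ v : n → F, (T 1 : F[T;T⁻¹]) • Fintype.linearCombination F e v
      = Fintype.linearCombination F e ((unitEval P (T 1 : F[T;T⁻¹])).mulVec v) := by
    intro v
    rw [unitEval_T_one hP']
    simp only [Fintype.linearCombination_apply, Finset.smul_sum, laurent_smul_smul, Matrix.mulVec,
      dotProduct, Finset.sum_smul]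
    rw [Finset.sum_comm]
    refine Finset.sum_congr rfl fun y _ => ?_
    rw [he y, Finset.smul_sum]
    refine Finset.sum_congr rfl fun x _ => ?_
    rw [smul_smul, mul_comm]
  have h2 : ∀ v : n → F, (T (-1) : F[T;T⁻¹]) • Fintype.linearCombination F e v
      = Fintype.linearCombination F e ((unitEval P (T (-1) : F[T;T⁻¹])).mulVec v) := by
    intro v
    have e1 : (T 1 : F[T;T⁻¹]) * T (-1) = 1 := by rw [← T_add]; simp
    have e2 : (T (-1) : F[T;T⁻¹]) * T 1 = 1 := by rw [← T_add]; simp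
    have : v = (unitEval P (T 1 : F[T;T⁻¹])).mulVec ((unitEval P (T (-1) : F[T;T⁻¹])).mulVec v) := by
      rw [Matrix.mulVec_mulVec, ← map_mul, e1, map_one, Matrix.one_mulVec]
    conv_lhs => rw [this, ← h1, ← mul_smul, e2, one_smul]
  induction g using LaurentPolynomial.induction_on generalizing v with
  | h_C a =>
    rw [LaurentPolynomial.C_eq_algebraMap, IsScalarTower.algebraMap_smul, AlgHom.commutes,
      ← map_smul, Algebra.algebraMap_eq_smul_one, Matrix.smul_mulVec, Matrix.one_mulVec]
  | h_add hp hq => rw [map_add, add_smul, hp, hq, Matrix.add_mulVec, map_add]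
  | h_C_mul_T k a ih =>
    rw [T_add, ← mul_assoc, map_mul _ _ (T 1), ← Matrix.mulVec_mulVec, ← ih, mul_smul, h1]
  | h_C_mul_T_Z k a ih =>
    rw [sub_eq_add_neg, T_add, ← mul_assoc, map_mul _ _ (T (-1)), ← Matrix.mulVec_mulVec, ← ih,
      mul_smul, h2]

theorem laurent_smul_opFamily {P : Matrix n n F} (hP : IsUnit P.det) {e : n → V}
    (he : IsOpFamily P e) (g : F[T;T⁻¹]) (y : n) :
    g • e y = ∑ x, unitEval P g x y • e x := by
  have := laurent_smul_linearCombination hP he g (Pi.single y 1)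
  simpa [Fintype.linearCombination_apply] using this

theorem repr_laurent_smul {P : Matrix n n F} (hP : IsUnit P.det) {b : Module.Basis n F V}
    (hb : IsOpFamily P b) (g : F[T;T⁻¹]) (v : V) :
    ⇑(b.repr (g • v)) = (unitEval P g).mulVec (b.repr v) := by
  have h : ∀ w : V, Fintype.linearCombination F b (b.repr w) = w := fun w => by
    rw [Fintype.linearCombination_apply, b.sum_repr]
  have h1 : g • v = Fintype.linearCombination F b ((unitEval P g).mulVec (b.repr v)) := by
    rw [← laurent_smul_linearCombination hP hb, h]
  rw [h1, Fintype.linearCombination_apply]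
  exact b.repr_sum_self _

/-- The operator of multiplication by `T`. -/
noncomputable def opT (F : Type u) [Field F] (V : Type v) [AddCommGroup V] [Module F V]
    [Module F[T;T⁻¹] V] [IsScalarTower F F[T;T⁻¹] V] : V →ₗ[F] V :=
  Module.toModuleEnd F V (T 1 : F[T;T⁻¹])

@[simp]
theorem opT_apply (v : V) : opT F V v = (T 1 : F[T;T⁻¹]) • v := rfl

theorem isOpFamily_basis_iff (b : Module.Basis n F V) (P : Matrix n n F) :
    IsOpFamily P b ↔ LinearMap.toMatrix b b (opT F V) = P := by
  constructor
  · intro h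
    ext x y
    rw [LinearMap.toMatrix_apply, opT_apply, h y, b.repr_sum_self]
  · rintro rfl y
    rw [← opT_apply (F := F), ← b.sum_repr (opT F V (b y))]
    simp only [LinearMap.toMatrix_apply]

theorem isUnit_det_of_isOpFamily {b : Module.Basis n F V} {P : Matrix n n F}
    (h : IsOpFamily P b) : IsUnit P.det := by
  rw [← (isOpFamily_basis_iff b P).1 h]
  have hu : IsUnit (opT F V) := by
    have e1 : (T 1 : F[T;T⁻¹]) * T (-1) = 1 := by rw [← T_add]; simp
    have e2 : (T (-1) : F[T;T⁻¹]) * T 1 = 1 := by rw [← T_add]; simp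
    refine ⟨⟨opT F V, Module.toModuleEnd F V (T (-1) : F[T;T⁻¹]), ?_, ?_⟩, rfl⟩
    · rw [opT, ← map_mul, e1, map_one]
    · rw [opT, ← map_mul, e2, map_one]
  rw [LinearMap.det_toMatrix]
  exact hu.map LinearMap.det

theorem similar_of_isOpFamily {b : Module.Basis n F V} {P : Matrix n n F} (h : IsOpFamily P b)
    {b' : Module.Basis m F V} {Q : Matrix m m F} (h' : IsOpFamily Q b') : Similar P Q := by
  refine ⟨b.toMatrix b', b'.toMatrix b, b.toMatrix_mul_toMatrix_flip b',
    b'.toMatrix_mul_toMatrix_flip b, ?_⟩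
  rw [← (isOpFamily_basis_iff b P).1 h, ← (isOpFamily_basis_iff b' Q).1 h',
    basis_toMatrix_mul_linearMap_toMatrix_mul_basis_toMatrix]

theorem exists_basis_of_similar {b : Module.Basis n F V} {P : Matrix n n F} (h : IsOpFamily P b)
    {Q : Matrix m m F} (hs : Similar P Q) : ∃ b' : Module.Basis m F V, IsOpFamily Q b' := by
  obtain ⟨S, R, hSR, hRS, rfl⟩ := hs
  refine ⟨Module.Basis.ofEquivFun (b.equivFun.trans (Matrix.toLin'OfInv hSR hRS)), ?_⟩
  have hb : ∀ j, Module.Basis.ofEquivFun (b.equivFun.trans (Matrix.toLin'OfInv hSR hRS)) j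
      = Fintype.linearCombination F b (S.mulVec (Pi.single j 1)) := by
    intro j
    rw [Module.Basis.coe_ofEquivFun, Fintype.linearCombination_apply,
      ← Module.Basis.equivFun_symm_apply]
    rfl
  have hP := isUnit_det_of_isOpFamily h
  have hP' : IsUnit P := (Matrix.isUnit_iff_isUnit_det P).2 hP
  intro y
  simp only [hb, laurent_smul_linearCombination hP h, unitEval_T_one hP']
  simp only [← map_smul, ← map_sum]
  congr 1
  simp only [← Matrix.mulVec_smul, ← Matrix.mulVec_sum]
  have : ∑ x, (R * P * S) x y • (Pi.single x 1 : m → F) = (R * P * S).mulVec (Pi.single y 1) := by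
    ext x
    simp [Finset.sum_apply, Pi.single_apply]
  rw [this, Matrix.mulVec_mulVec, Matrix.mulVec_mulVec, ← Matrix.mul_assoc, ← Matrix.mul_assoc, hSR,
    Matrix.one_mul]

omit [Fintype n] [DecidableEq n] in
theorem Similar.refl' [Fintype n] [DecidableEq n] (P : Matrix n n F) : Similar P P :=
  ⟨1, 1, by simp, by simp, by simp⟩

/-- `F[T;T⁻¹]`-module structure on columns, where `T` acts by the matrix `P`. -/
@[reducible]
noncomputable def columnModule (P : Matrix n n F) : Module F[T;T⁻¹] (n → F) :=
  Module.compHom (n → F)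
    (((Matrix.toLinAlgEquiv' : Matrix n n F ≃ₐ[F] _).toAlgHom.comp (unitEval P)).toRingHom :
      F[T;T⁻¹] →+* Module.End F (n → F))

theorem columnModule_isScalarTower (P : Matrix n n F) :
    @IsScalarTower F F[T;T⁻¹] (n → F) _ (columnModule P).toSMul _ := by
  let _ := columnModule P
  refine ⟨fun a g v => ?_⟩
  change (unitEval P (a • g)).mulVec v = a • (unitEval P g).mulVec v
  rw [map_smul, Matrix.smul_mulVec]

theorem columnModule_isOpFamily {P : Matrix n n F} (hP : IsUnit P.det) :
    let _ := columnModule P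
    IsOpFamily P (Pi.basisFun F n) := by
  intro _ y
  change (unitEval P (T 1)).mulVec _ = _
  rw [unitEval_T_one ((Matrix.isUnit_iff_isUnit_det P).2 hP)]
  ext x
  simp [Finset.sum_apply, Pi.single_apply]

end OpFamilies

/-! ### Indecomposable matrices as cyclic primary modules. -/

section CyclicVectors

variable {F : Type u} [Field F]
variable {n m : Type*} [Fintype n] [DecidableEq n] [Fintype m] [DecidableEq m]

/-- The vector `z` generates the space of columns as an `F[P, P⁻¹]`-module, and its annihilator is
generated by `c`. -/
structure IsCyclicVector (P : Matrix n n F) (c : F[T;T⁻¹]) (z : n → F) : Prop where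
  surj : ∀ v, ∃ g : F[T;T⁻¹], (unitEval P g).mulVec z = v
  ann : ∀ g : F[T;T⁻¹], (unitEval P g).mulVec z = 0 ↔ c ∣ g

variable {V : Type v} [AddCommGroup V] [Module F V] [Module F[T;T⁻¹] V]
  [IsScalarTower F F[T;T⁻¹] V]

omit [Module F V] [IsScalarTower F F[T;T⁻¹] V] in
-- The gcd of g and p^(k+1) is some p^i with i ≤ k, so a Bézout identity for p^k gives f. In other
-- words, every nonzero submodule of the cyclic module contains p^k x.
theorem exists_smul_eq_socle {p : F[T;T⁻¹]} (hp : Prime p) {k : ℕ} {x : V}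
    (h1 : p ^ (k + 1) • x = 0) {g : F[T;T⁻¹]} (hg : g • x ≠ 0) : ∃ f, (f * g) • x = p ^ k • x := by
  obtain ⟨⟨d, hd⟩⟩ := IsPrincipalIdealRing.principal (Ideal.span {g, p ^ (k + 1)})
  rw [Ideal.submodule_span_eq] at hd
  have hdg : d ∣ g := Ideal.mem_span_singleton.1 (hd ▸ Ideal.subset_span (by simp))
  have hdp : d ∣ p ^ (k + 1) := Ideal.mem_span_singleton.1 (hd ▸ Ideal.subset_span (by simp))
  obtain ⟨i, hi, ha⟩ := (dvd_prime_pow hp (k + 1)).1 hdp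
  have hik : i ≤ k := by
    by_contra hne
    obtain rfl : i = k + 1 := by omega
    obtain ⟨r, rfl⟩ := ha.symm.dvd.trans hdg
    exact hg (by rw [mul_comm, mul_smul, h1, smul_zero])
  have : p ^ k ∈ Ideal.span {g, p ^ (k + 1)} := by
    rw [hd, Ideal.mem_span_singleton]
    exact ha.dvd.trans (pow_dvd_pow p hik)
  obtain ⟨α, β, h⟩ := Ideal.mem_span_pair.1 this
  refine ⟨α, ?_⟩
  rw [← h, add_smul, mul_smul β, h1, smul_zero, add_zero]

/-- A nontrivial module splits off a cyclic primary summand. -/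
theorem exists_cyclic_summand (V : Type v) [AddCommGroup V] [Module F V] [Module F[T;T⁻¹] V]
    [IsScalarTower F F[T;T⁻¹] V] [FiniteDimensional F V] [Nontrivial V] :
    ∃ (p : F[T;T⁻¹]) (k : ℕ) (x : V) (N : Submodule F[T;T⁻¹] V), Prime p ∧
      p ^ (k + 1) • x = 0 ∧ p ^ k • x ≠ 0 ∧ IsCompl (Submodule.span F[T;T⁻¹] {x}) N := by
  obtain ⟨p, s, k, x, hp, hps, ⟨a, b, hab⟩, h1, h2⟩ := exists_primary_vector (F := F) V
  have hx := smul_eq_zero_iff_dvd hp h1 h2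
  obtain ⟨l, hl⟩ : ∃ l : Module.Dual F V, l (p ^ k • x) ≠ 0 := by
    by_contra hne
    push Not at hne
    exact h2 ((Module.forall_dual_apply_eq_zero_iff F _).1 hne)
  have hbs : (b * s) • x = x := by
    conv_rhs => rw [← one_smul F[T;T⁻¹] x, ← hab, add_smul, mul_smul a, h1, smul_zero, zero_add]
  -- On V the element b s is the projection onto the p-primary part, and the functional l does not
  -- vanish on p^k x. Then f ↦ l(f x) is nondegenerate on the cyclic module; hence no nonzero
  -- multiple of x lies in N, and every v becomes an element of N after subtraction of a suitable
  -- multiple of x.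
  let N : Submodule F[T;T⁻¹] V :=
    { carrier := {v | ∀ f : F[T;T⁻¹], l ((f * (b * s)) • v) = 0}
      add_mem' := fun {v w} hv hw f => by rw [smul_add, map_add, hv f, hw f, add_zero]
      zero_mem' := fun f => by rw [smul_zero, map_zero]
      smul_mem' := fun g v hv f => by
        rw [smul_smul, mul_right_comm]
        exact hv (f * g) }
  let φ : F[T;T⁻¹] →ₗ[F] F :=
    l.comp ((LinearMap.toSpanSingleton F[T;T⁻¹] V x).restrictScalars F)
  have hφ : ∀ f, φ f = l (f • x) := fun f => rfl
  have hφn : ∀ h, p ^ (k + 1) ∣ h ↔ ∀ f, φ (h * f) = 0 := by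
    intro h
    constructor
    · intro hd f
      rw [hφ, mul_comm, mul_smul, (hx h).2 hd, smul_zero, map_zero]
    · intro hf
      by_contra hd
      rw [← hx] at hd
      obtain ⟨f, hf'⟩ := exists_smul_eq_socle hp h1 hd
      apply hl
      rw [← hf', mul_comm]
      exact hf f
  refine ⟨p, k, x, N, hp, h1, h2, ?_, ?_⟩
  · rw [Submodule.disjoint_def]
    intro w hw hwN
    obtain ⟨h, rfl⟩ := Submodule.mem_span_singleton.1 hw
    rw [hx, hφn]
    intro f
    have := hwN f
    rwa [smul_smul, mul_right_comm, mul_smul, hbs, mul_comm f] at this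
  · rw [codisjoint_iff, eq_top_iff]
    intro v _
    let ψ : F[T;T⁻¹] →ₗ[F] F :=
      l.comp ((LinearMap.toSpanSingleton F[T;T⁻¹] V ((b * s) • v)).restrictScalars F)
    have hψ : ∀ f, ψ f = l (f • (b * s) • v) := fun f => rfl
    obtain ⟨h, hh⟩ := exists_functional_eq_mul hx φ ψ hφn (fun f => by
      rw [hψ, smul_smul, show p ^ (k + 1) * f * (b * s) = f * b * (p ^ (k + 1) * s) by ring,
        mul_smul, hps, smul_zero, map_zero])
    have hvN : v - h • x ∈ N := by
      intro f
      rw [smul_sub, map_sub, mul_smul, ← hψ, hh, hφ, smul_smul, mul_right_comm, mul_smul _ (b * s),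
        hbs, mul_comm f, sub_self]
    have := Submodule.add_mem_sup (Submodule.smul_mem _ h (Submodule.mem_span_singleton_self x)) hvN
    rwa [add_sub_cancel] at this

theorem similar_dsum_of_isCompl [FiniteDimensional F V] {P : Matrix n n F}
    {b : Module.Basis n F V} (hb : IsOpFamily P b) {U N : Submodule F[T;T⁻¹] V}
    (h : IsCompl U N) :
    ∃ (P' : Matrix (Fin (Module.finrank F U)) (Fin (Module.finrank F U)) F)
      (Q : Matrix (Fin (Module.finrank F N)) (Fin (Module.finrank F N)) F),
      Similar P (dsum P' Q) := by
  have hU : FiniteDimensional F U := FiniteDimensional.of_injective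
    (U.subtype.restrictScalars F) U.injective_subtype
  have hN : FiniteDimensional F N := FiniteDimensional.of_injective
    (N.subtype.restrictScalars F) N.injective_subtype
  set bU := Module.finBasis F U
  set bN := Module.finBasis F N
  set b' := (bU.prod bN).map ((Submodule.prodEquivOfIsCompl U N h).restrictScalars F)
  refine ⟨LinearMap.toMatrix bU bU (opT F U), LinearMap.toMatrix bN bN (opT F N),
    similar_of_isOpFamily hb (b' := b') ?_⟩
  have h1 := (isOpFamily_basis_iff bU _).2 rfl
  have h2 := (isOpFamily_basis_iff bN _).2 rfl
  have e1 : ∀ x, b' (Sum.inl x) = bU x := fun x => by simp [b']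
  have e2 : ∀ x, b' (Sum.inr x) = bN x := fun x => by simp [b']
  rintro (y | y)
  · simp only [Fintype.sum_sum_type, e1, e2, dsum, Matrix.fromBlocks_apply₁₁,
      Matrix.fromBlocks_apply₂₁, Matrix.zero_apply, zero_smul, Finset.sum_const_zero, add_zero]
    have := congrArg (U.subtype.restrictScalars F) (h1 y)
    simpa using this
  · simp only [Fintype.sum_sum_type, e1, e2, dsum, Matrix.fromBlocks_apply₁₂,
      Matrix.fromBlocks_apply₂₂, Matrix.zero_apply, zero_smul, Finset.sum_const_zero, zero_add]
    have := congrArg (N.subtype.restrictScalars F) (h2 y)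
    simpa using this

theorem isCyclicVector_repr {P : Matrix n n F} {b : Module.Basis n F V} (hb : IsOpFamily P b)
    {x : V} (hx : Submodule.span F[T;T⁻¹] {x} = ⊤) {c : F[T;T⁻¹]}
    (hc : ∀ f : F[T;T⁻¹], f • x = 0 ↔ c ∣ f) : IsCyclicVector P c (b.repr x) := by
  have hP := isUnit_det_of_isOpFamily hb
  constructor
  · intro v
    obtain ⟨g, hg⟩ := Submodule.mem_span_singleton.1
      (show Fintype.linearCombination F b v ∈ Submodule.span F[T;T⁻¹] {x} by
        rw [hx]; exact Submodule.mem_top)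
    refine ⟨g, ?_⟩
    rw [← repr_laurent_smul hP hb, hg, Fintype.linearCombination_apply]
    exact b.repr_sum_self _
  · intro g
    rw [← repr_laurent_smul hP hb, ← hc, ← Finsupp.coe_zero, DFunLike.coe_injective.eq_iff,
      LinearEquiv.map_eq_zero_iff]

/-- An indecomposable nonsingular matrix is cyclic and primary. -/
theorem Indecomposable.exists_isCyclicVector {Φ : SqMat F} (h : Indecomposable Φ)
    (hΦ : IsUnit Φ.2.det) : ∃ (p : F[T;T⁻¹]) (k : ℕ) (z : Fin Φ.1 → F), Prime p ∧
      IsCyclicVector Φ.2 (p ^ (k + 1)) z := by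
  let _ := columnModule Φ.2
  have _ := columnModule_isScalarTower Φ.2
  have : Nonempty (Fin Φ.1) := ⟨⟨0, h.1⟩⟩
  have hb := columnModule_isOpFamily hΦ
  obtain ⟨p, k, x, N, hp, h1, h2, hN⟩ := exists_cyclic_summand (F := F) (Fin Φ.1 → F)
  have hx := smul_eq_zero_iff_dvd hp h1 h2
  obtain ⟨P', Q, hPQ⟩ := similar_dsum_of_isCompl hb hN
  have hU' : FiniteDimensional F (Submodule.span F[T;T⁻¹] {x}) := FiniteDimensional.of_injective
    ((Submodule.span F[T;T⁻¹] {x}).subtype.restrictScalars F) (Submodule.injective_subtype _)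
  have hN' : FiniteDimensional F N := FiniteDimensional.of_injective
    (N.subtype.restrictScalars F) N.injective_subtype
  have hdim : Module.finrank F (Submodule.span F[T;T⁻¹] {x}) + Module.finrank F N = Φ.1 := by
    rw [← Module.finrank_prod, ((Submodule.prodEquivOfIsCompl _ N hN).restrictScalars F).finrank_eq]
    simp
  have hU0 : 0 < Module.finrank F (Submodule.span F[T;T⁻¹] {x}) := by
    have hx0 : x ≠ 0 := fun h0 => h2 (by rw [h0, smul_zero])
    have : Nontrivial (Submodule.span F[T;T⁻¹] {x}) :=
      Submodule.nontrivial_iff_ne_bot.2 (by rwa [Ne, Submodule.span_singleton_eq_bot])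
    exact Module.finrank_pos
  have hN0 : N = ⊥ := by
    by_contra hne
    refine h.2 _ _ P' Q ?_ ?_ hPQ
    · have : Nontrivial N := Submodule.nontrivial_iff_ne_bot.2 hne
      have : 0 < Module.finrank F N := Module.finrank_pos
      omega
    · omega
  refine ⟨p, k, _, hp, isCyclicVector_repr hb (x := x) ?_ hx⟩
  rw [hN0] at hN
  exact eq_top_of_isCompl_bot hN

theorem isUnit_det_of_similar {P : Matrix n n F} {Q : Matrix m m F} (h : Similar P Q)
    (hP : IsUnit P.det) : IsUnit Q.det := by
  let _ := columnModule P
  have _ := columnModule_isScalarTower P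
  obtain ⟨b, hb⟩ := exists_basis_of_similar (columnModule_isOpFamily hP) h
  exact isUnit_det_of_isOpFamily hb

/-- Cyclic primary modules are indecomposable. -/
theorem indecomposable_of_cyclic {P : SqMat F} {b : Module.Basis (Fin P.1) F V}
    (hb : IsOpFamily P.2 b) {p : F[T;T⁻¹]} (hp : Prime p) {k : ℕ} {x : V}
    (h1 : p ^ (k + 1) • x = 0) (h2 : p ^ k • x ≠ 0) (hx : Submodule.span F[T;T⁻¹] {x} = ⊤) :
    Indecomposable P := by
  have hx0 : x ≠ 0 := fun h0 => h2 (by rw [h0, smul_zero])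
  have hcard : Module.finrank F V = P.1 := by rw [Module.finrank_eq_card_basis b, Fintype.card_fin]
  constructor
  · have : Nontrivial V := ⟨x, 0, hx0⟩
    have := Module.Finite.of_basis b
    rw [← hcard]
    exact Module.finrank_pos
  · intro r s Q R hr hs hsim
    obtain ⟨b', hb'⟩ := exists_basis_of_similar hb hsim
    have hrs : P.1 = r + s := by
      rw [← hcard, Module.finrank_eq_card_basis b', Fintype.card_sum, Fintype.card_fin,
        Fintype.card_fin]
    have hdet := isUnit_det_of_isOpFamily hb'
    rw [dsum, Matrix.det_fromBlocks_zero₂₁, IsUnit.mul_iff] at hdet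
    have hl : IsOpFamily Q (fun i => b' (Sum.inl i)) := by
      intro y
      have := hb' (Sum.inl y)
      simpa [Fintype.sum_sum_type, dsum] using this
    have hr' : IsOpFamily R (fun i => b' (Sum.inr i)) := by
      intro y
      have := hb' (Sum.inr y)
      simpa [Fintype.sum_sum_type, dsum] using this
    have hsoc : ∀ y, y ≠ 0 → ∃ f : F[T;T⁻¹], f • y = p ^ k • x := by
      intro y hy
      obtain ⟨g, rfl⟩ := Submodule.mem_span_singleton.1
        (show y ∈ Submodule.span F[T;T⁻¹] {x} by rw [hx]; exact Submodule.mem_top)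
      obtain ⟨f, hf⟩ := exists_smul_eq_socle hp h1 hy
      exact ⟨f, by rw [smul_smul, hf]⟩
    -- Both parts are nonempty, being smaller than their total size r + s. So p^k x would lie in the
    -- span of each part, and these spans meet in 0.
    obtain ⟨f, hf⟩ := hsoc _ (b'.ne_zero (Sum.inl ⟨0, by omega⟩))
    obtain ⟨g, hg⟩ := hsoc _ (b'.ne_zero (Sum.inr ⟨0, by omega⟩))
    have e1 := laurent_smul_opFamily hdet.1 hl f ⟨0, by omega⟩
    have e2 := laurent_smul_opFamily hdet.2 hr' g ⟨0, by omega⟩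
    refine h2 (b'.repr.map_eq_zero_iff.1 (Finsupp.ext ?_))
    rintro (i | i)
    · rw [← hg, e2]
      simp [map_sum]
    · rw [← hf, e1]
      simp [map_sum]

/-- Each cyclic primary module is represented in the canonical set. -/
theorem IsCanonicalSet.exists_isCyclicVector {O : Set (SqMat F)} (hO : IsCanonicalSet O)
    [FiniteDimensional F V] {p : F[T;T⁻¹]} (hp : Prime p) {k : ℕ} {x : V}
    (h1 : p ^ (k + 1) • x = 0) (h2 : p ^ k • x ≠ 0) :
    ∃ Φ ∈ O, ∃ z, IsCyclicVector Φ.2 (p ^ (k + 1)) z := by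
  set U := Submodule.span F[T;T⁻¹] {x}
  have hU : FiniteDimensional F U := FiniteDimensional.of_injective
    (U.subtype.restrictScalars F) (Submodule.injective_subtype _)
  set y : U := ⟨x, Submodule.mem_span_singleton_self x⟩
  have hy : ∀ g : F[T;T⁻¹], g • y = 0 ↔ g • x = 0 := fun g => by
    rw [← Submodule.coe_eq_zero]; rfl
  have hyt : Submodule.span F[T;T⁻¹] {y} = ⊤ := by
    rw [eq_top_iff]
    rintro ⟨v, hv⟩ -
    obtain ⟨g, rfl⟩ := Submodule.mem_span_singleton.1 hv
    exact Submodule.mem_span_singleton.2 ⟨g, rfl⟩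
  set b := Module.finBasis F U
  have hb := (isOpFamily_basis_iff b _).2 rfl
  set P : SqMat F := ⟨_, LinearMap.toMatrix b b (opT F U)⟩
  have hb : IsOpFamily P.2 b := hb
  have hy1 : p ^ (k + 1) • y = 0 := (hy _).2 h1
  have hy2 : p ^ k • y ≠ 0 := fun h => h2 ((hy _).1 h)
  obtain ⟨Φ, ⟨hΦ, hs⟩, -⟩ := hO.2 P (isUnit_det_of_isOpFamily hb)
    (indecomposable_of_cyclic hb hp hy1 hy2 hyt)
  obtain ⟨b', hb'⟩ := exists_basis_of_similar hb hs
  exact ⟨Φ, hΦ, _, isCyclicVector_repr hb' hyt (smul_eq_zero_iff_dvd hp hy1 hy2)⟩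

theorem IsCyclicVector.of_associated {P : Matrix n n F} {c c' : F[T;T⁻¹]} {z : n → F}
    (h : IsCyclicVector P c z) (hc : Associated c c') : IsCyclicVector P c' z :=
  ⟨h.surj, fun g => by rw [h.ann, hc.dvd_iff_dvd_left]⟩

/-- Laurent polynomials that take the cyclic vector to the standard basis. -/
noncomputable def IsCyclicVector.coord {P : Matrix n n F} {c : F[T;T⁻¹]} {z : n → F}
    (h : IsCyclicVector P c z) (i : n) : F[T;T⁻¹] :=
  (h.surj (Pi.single i 1)).choose

theorem IsCyclicVector.coord_spec {P : Matrix n n F} {c : F[T;T⁻¹]} {z : n → F}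
    (h : IsCyclicVector P c z) (i : n) :
    (unitEval P (h.coord i)).mulVec z = Pi.single i 1 :=
  (h.surj (Pi.single i 1)).choose_spec

/-- A vector x killed by c is the image of z under a module homomorphism from the columns to V;
`h.coord i • x` is the image of the i-th standard basis vector. -/
theorem IsCyclicVector.smul_eq {P : Matrix n n F} {c : F[T;T⁻¹]} {z : n → F}
    (h : IsCyclicVector P c z) {x : V} (hx : c • x = 0) (g : F[T;T⁻¹]) :
    g • x = ∑ i, (unitEval P g).mulVec z i • h.coord i • x := by
  have : c ∣ g - ∑ i, (unitEval P g).mulVec z i • h.coord i := by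
    rw [← h.ann, map_sub, map_sum, Matrix.sub_mulVec, sub_eq_zero, Matrix.sum_mulVec]
    simp only [map_smul, Matrix.smul_mulVec, h.coord_spec]
    ext i
    simp [Finset.sum_apply, Pi.single_apply]
  obtain ⟨r, hr⟩ := this
  rw [← sub_eq_zero]
  calc _ = (g - ∑ i, (unitEval P g).mulVec z i • h.coord i) • x := by
        rw [sub_smul, Finset.sum_smul]
        simp only [smul_assoc]
    _ = 0 := by rw [hr, mul_comm, mul_smul, hx, smul_zero]

theorem IsCyclicVector.isOpFamily {P : Matrix n n F} (hP : IsUnit P.det) {c : F[T;T⁻¹]} {z : n → F}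
    (h : IsCyclicVector P c z) {x : V} (hx : c • x = 0) :
    IsOpFamily P (fun i => h.coord i • x) := by
  intro y
  rw [smul_smul, h.smul_eq hx, map_mul, ← Matrix.mulVec_mulVec, h.coord_spec,
    unitEval_T_one ((Matrix.isUnit_iff_isUnit_det P).2 hP)]
  refine Finset.sum_congr rfl fun i _ => ?_
  rw [Matrix.mulVec_single_one, Matrix.col_apply]

theorem IsCyclicVector.linearIndependent {P : Matrix n n F} {c : F[T;T⁻¹]} {z : n → F}
    (h : IsCyclicVector P c z) {x : V} (hx : ∀ f : F[T;T⁻¹], f • x = 0 ↔ c ∣ f) :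
    LinearIndependent F (fun i => h.coord i • x) := by
  rw [Fintype.linearIndependent_iff]
  intro a ha i
  have h1 : (∑ i, a i • h.coord i) • x = 0 := by
    rw [Finset.sum_smul, ← ha]
    simp only [smul_assoc]
  rw [hx, ← h.ann, map_sum, Matrix.sum_mulVec] at h1
  simp only [map_smul, Matrix.smul_mulVec, h.coord_spec] at h1
  have := congrFun h1 i
  simpa [Finset.sum_apply, Pi.single_apply] using this

/-- Both column modules are isomorphic to the Laurent ring modulo c. -/
theorem IsCyclicVector.similar {P : Matrix n n F} (hP : IsUnit P.det) {c : F[T;T⁻¹]} {z : n → F}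
    (h : IsCyclicVector P c z) {Q : Matrix m m F} (hQ : IsUnit Q.det) {y : m → F}
    (h' : IsCyclicVector Q c y) : Similar P Q := by
  let _ := columnModule Q
  have _ := columnModule_isScalarTower Q
  have hy : ∀ f : F[T;T⁻¹], f • y = 0 ↔ c ∣ f := h'.ann
  have hcy : c • y = 0 := (hy c).2 dvd_rfl
  have hop := h.isOpFamily hP hcy
  refine similar_of_isOpFamily (b := Module.Basis.mk (h.linearIndependent hy) ?_) (P := P) ?_
    (columnModule_isOpFamily hQ)
  · intro v _
    obtain ⟨g, rfl⟩ := h'.surj v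
    change g • y ∈ _
    rw [h.smul_eq hcy]
    exact Submodule.sum_mem _ fun i _ => Submodule.smul_mem _ _ (Submodule.subset_span ⟨i, rfl⟩)
  · rwa [Module.Basis.coe_mk]

theorem IsCanonicalSet.eq_of_similar {O : Set (SqMat F)} (hO : IsCanonicalSet O) {Φ Ψ : SqMat F}
    (hΦ : Φ ∈ O) (hΨ : Ψ ∈ O) (h : Similar Φ.2 Ψ.2) : Φ = Ψ := by
  obtain ⟨hd, hi⟩ := hO.1 Φ hΦ
  exact (hO.2 Φ hd hi).unique ⟨hΦ, Similar.refl' _⟩ ⟨hΨ, h⟩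

theorem IsCanonicalSet.eq_of_isCyclicVector {O : Set (SqMat F)} (hO : IsCanonicalSet O)
    {Φ Ψ : SqMat F} (hΦ : Φ ∈ O) (hΨ : Ψ ∈ O) {c c' : F[T;T⁻¹]} {z y}
    (h : IsCyclicVector Φ.2 c z) (h' : IsCyclicVector Ψ.2 c' y) (hc : Associated c c') : Φ = Ψ :=
  hO.eq_of_similar hΦ hΨ ((h.of_associated hc).similar (hO.1 Φ hΦ).1 (hO.1 Ψ hΨ).1 h')

end CyclicVectors

end IsometricPairs
namespace IsometricPairs

open Polynomial LaurentPolynomial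

universe u v

/-! ### Characteristic polynomials and the matrix Φ^{-*}. -/

section CharacteristicPolynomial

variable {F : Type u} [Field F]
variable {n m : Type*} [Fintype n] [DecidableEq n] [Fintype m] [DecidableEq m]

theorem charpoly_coeff_zero_ne_zero {P : Matrix n n F} (hP : IsUnit P.det) :
    P.charpoly.coeff 0 ≠ 0 := by
  intro h
  rw [Matrix.det_eq_sign_charpoly_coeff, h, mul_zero] at hP
  exact not_isUnit_zero hP

/-- The variable is invertible modulo the characteristic polynomial, so P⁻¹ is itself a polynomial
in P. -/
theorem exists_unitEval_eq_aeval {P : Matrix n n F} (hP : IsUnit P.det) (g : F[T;T⁻¹]) :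
    ∃ f : F[X], unitEval P g = aeval P f := by
  have hP' : IsUnit P := (Matrix.isUnit_iff_isUnit_det P).2 hP
  have hco : IsCoprime (X : F[X]) P.charpoly := by
    rw [irreducible_X.coprime_iff_not_dvd, X_dvd_iff]
    exact charpoly_coeff_zero_ne_zero hP
  obtain ⟨a, b, hab⟩ := hco
  have ha : aeval P a * P = 1 := by
    have := congrArg (aeval P) hab
    rwa [map_add, map_mul, map_mul, Matrix.aeval_self_charpoly, mul_zero, add_zero, aeval_X,
      map_one] at this
  obtain ⟨k, f, hf⟩ := g.exists_T_pow
  refine ⟨f * a ^ k, ?_⟩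
  have h1 := congrArg (unitEval P) hf
  have h2 : unitEval P (T (k : ℤ) : F[T;T⁻¹]) = P ^ k := by
    rw [← toLaurent_X_pow, unitEval_toLaurent hP', map_pow, aeval_X]
  rw [unitEval_toLaurent hP', map_mul, h2] at h1
  have hc : Commute P (aeval P a) := by
    have := (Commute.all (X : F[X]) a).map (aeval P)
    rwa [aeval_X] at this
  rw [map_mul, h1, map_pow, mul_assoc, ← hc.mul_pow, hc.eq, ha, one_pow, mul_one]

/-- Polynomials reduced modulo the minimal polynomial already carry z onto all columns, so the
degree of the minimal polynomial is at least the size of P. -/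
theorem IsCyclicVector.minpoly_eq {P : Matrix n n F} (hP : IsUnit P.det) {c : F[T;T⁻¹]}
    {z : n → F} (h : IsCyclicVector P c z) : minpoly F P = P.charpoly := by
  have hm : (minpoly F P).Monic := minpoly.monic (Matrix.isIntegral P)
  refine (Polynomial.eq_of_monic_of_dvd_of_natDegree_le hm P.charpoly_monic
    (Matrix.minpoly_dvd_charpoly P) ?_).symm
  set ψ : degreeLT F (minpoly F P).natDegree →ₗ[F] (n → F) :=
    ((Matrix.mulVecBilin F F).flip z).comp ((aeval P).toLinearMap.comp (Submodule.subtype _))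
  have hψ : Function.Surjective ψ := by
    intro v
    obtain ⟨g, rfl⟩ := h.surj v
    obtain ⟨f, hf⟩ := exists_unitEval_eq_aeval hP g
    refine ⟨⟨f %ₘ minpoly F P, ?_⟩, ?_⟩
    · rw [mem_degreeLT, ← degree_eq_natDegree hm.ne_zero]
      exact degree_modByMonic_lt f hm
    · rw [hf]
      change (aeval P (f %ₘ minpoly F P)).mulVec z = _
      rw [aeval_modByMonic_eq_self_of_root (minpoly.aeval F P)]
  have := LinearMap.finrank_le_finrank_of_surjective hψ
  rw [(degreeLTEquiv F _).finrank_eq] at this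
  rw [Matrix.charpoly_natDegree_eq_dim]
  simpa using this

/-- What kills a generator kills the whole module, so the minimal polynomial divides c; the converse
is Cayley–Hamilton. Cyclic matrices are thereby classified by their characteristic polynomials. -/
theorem IsCyclicVector.charpoly_associated {P : Matrix n n F} (hP : IsUnit P.det) {c : F[T;T⁻¹]}
    {z : n → F} (h : IsCyclicVector P c z) : Associated (toLaurent P.charpoly) c := by
  have hP' : IsUnit P := (Matrix.isUnit_iff_isUnit_det P).2 hP
  refine associated_of_dvd_dvd ?_ ?_
  · obtain ⟨f, hf⟩ := exists_associated_toLaurent c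
    refine Dvd.dvd.trans ?_ hf.dvd
    refine map_dvd _ ?_
    rw [← h.minpoly_eq hP]
    refine minpoly.dvd F P ?_
    rw [← unitEval_toLaurent hP']
    have h0 : (unitEval P (toLaurent f)).mulVec z = 0 := (h.ann _).2 hf.symm.dvd
    refine Matrix.mulVec_injective ?_
    ext1 v
    obtain ⟨g, rfl⟩ := h.surj v
    rw [Matrix.mulVec_mulVec, ← map_mul, mul_comm, map_mul, ← Matrix.mulVec_mulVec, h0,
      Matrix.mulVec_zero, Matrix.zero_mulVec]
  · rw [← h.ann, unitEval_toLaurent hP', Matrix.aeval_self_charpoly, Matrix.zero_mulVec]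

theorem irreducibleDivisor_coeff_zero_ne_zero {Φ : SqMat F} (h : Indecomposable Φ)
    (hΦ : IsUnit Φ.2.det) : (irreducibleDivisor Φ).coeff 0 ≠ 0 := by
  intro h0
  have := (irreducibleDivisor_spec Φ h.1).2.2
  exact charpoly_coeff_zero_ne_zero hΦ (X_dvd_iff.1 ((X_dvd_iff.2 h0).trans this))

/-- An indecomposable nonsingular matrix is cyclic, and its annihilator is a power of the
irreducible divisor of the characteristic polynomial. -/
theorem Indecomposable.exists_isCyclicVector_irreducibleDivisor {Φ : SqMat F}
    (h : Indecomposable Φ) (hΦ : IsUnit Φ.2.det) :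
    ∃ (k : ℕ) (z : Fin Φ.1 → F),
      IsCyclicVector Φ.2 (toLaurent (irreducibleDivisor Φ) ^ (k + 1)) z := by
  obtain ⟨p, k, z, hp, hz⟩ := h.exists_isCyclicVector hΦ
  obtain ⟨-, h2, h3⟩ := irreducibleDivisor_spec Φ h.1
  have hq := prime_toLaurent h2 (irreducibleDivisor_coeff_zero_ne_zero h hΦ)
  have hd : toLaurent (irreducibleDivisor Φ) ∣ p ^ (k + 1) :=
    (map_dvd toLaurent h3).trans (hz.charpoly_associated hΦ).dvd
  have ha : Associated p (toLaurent (irreducibleDivisor Φ)) :=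
    (hq.associated_of_dvd hp (hq.dvd_of_dvd_pow hd)).symm
  exact ⟨k, z, hz.of_associated ha.pow_pow⟩

variable [StarRing F]

theorem star_toLaurent (f : F[X]) :
    star (toLaurent f) = invert (toLaurent (f.map (starRingEnd F))) := by
  induction f using Polynomial.induction_on' with
  | add p q hp hq => rw [map_add, star_add, hp, hq, Polynomial.map_add, map_add, map_add]
  | monomial k a =>
    rw [Polynomial.map_monomial, toLaurent_C_mul_T, toLaurent_C_mul_T, star_mul_comm, star_C,
      star_T, map_mul, invert_C, invert_T]
    rfl

/-- Reversal of a polynomial is T ↦ T⁻¹ followed by multiplication by a power of T. -/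
theorem toLaurent_vee_associated {f : F[X]} (hf : f.coeff 0 ≠ 0) :
    Associated (toLaurent (vee f)) (star (toLaurent f)) := by
  rw [vee, map_mul, toLaurent_reverse, star_toLaurent, toLaurent_C]
  refine Associated.symm ?_
  have hu : IsUnit (LaurentPolynomial.C (star (f.coeff 0))⁻¹) :=
    (isUnit_iff_ne_zero.2 (inv_ne_zero (star_ne_zero.2 hf))).map _
  have hv := isUnit_T (R := F) ((f.map (starRingEnd F)).natDegree : ℤ)
  refine ⟨(hu.mul hv).unit, ?_⟩
  rw [IsUnit.unit_spec]
  ring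

theorem isUnit_det_invStar {Φ : SqMat F} (hΦ : IsUnit Φ.2.det) : IsUnit (invStar Φ).det := by
  rw [invStar, Matrix.det_conjTranspose]
  exact ((Matrix.isUnit_nonsing_inv_det_iff).2 hΦ).star

theorem invStar_invStar {Φ : SqMat F} (hΦ : IsUnit Φ.2.det) :
    invStar ⟨Φ.1, invStar Φ⟩ = Φ.2 := by
  rw [invStar, invStar]
  simp only
  rw [Matrix.conjTranspose_nonsing_inv, Matrix.conjTranspose_conjTranspose,
    Matrix.nonsing_inv_nonsing_inv _ hΦ]

/-- The operation M ↦ M^{-*} is involutive and respects similarity and direct sums, so it would turn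
a decomposition of Φ^{-*} into one of Φ. -/
theorem Indecomposable.invStar {Φ : SqMat F} (h : Indecomposable Φ) (hΦ : IsUnit Φ.2.det) :
    Indecomposable ⟨Φ.1, invStar Φ⟩ := by
  refine ⟨h.1, fun a b P Q ha hb hs => ?_⟩
  have hdet := isUnit_det_of_similar hs (isUnit_det_invStar hΦ)
  rw [dsum, Matrix.det_fromBlocks_zero₂₁, IsUnit.mul_iff] at hdet
  obtain ⟨S, R, h1, h2, h3⟩ := hs
  refine h.2 a b P⁻¹.conjTranspose Q⁻¹.conjTranspose ha hb
    ⟨R.conjTranspose, S.conjTranspose, ?_, ?_, ?_⟩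
  · rw [← Matrix.conjTranspose_mul, h1, Matrix.conjTranspose_one]
  · rw [← Matrix.conjTranspose_mul, h2, Matrix.conjTranspose_one]
  · have e1 : dsum P⁻¹.conjTranspose Q⁻¹.conjTranspose = (dsum P Q)⁻¹.conjTranspose := by
      have : (dsum P Q)⁻¹ = dsum P⁻¹ Q⁻¹ := by
        apply Matrix.inv_eq_right_inv
        rw [dsum, dsum, Matrix.fromBlocks_multiply]
        simp [Matrix.mul_nonsing_inv _ hdet.1, Matrix.mul_nonsing_inv _ hdet.2]
      rw [this, dsum, dsum, Matrix.fromBlocks_conjTranspose]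
      simp
    have e2 : Φ.2 = ((IsometricPairs.invStar Φ)⁻¹).conjTranspose := (invStar_invStar hΦ).symm
    rw [e1, ← h3]
    conv_lhs => rw [e2]
    rw [← Matrix.conjTranspose_mul, ← Matrix.conjTranspose_mul]
    congr 1
    symm
    apply Matrix.inv_eq_right_inv
    have hu := isUnit_det_invStar hΦ
    calc R * IsometricPairs.invStar Φ * S * (R * ((IsometricPairs.invStar Φ)⁻¹ * S))
        = R * IsometricPairs.invStar Φ * (S * R) * (IsometricPairs.invStar Φ)⁻¹ * S := by
          simp only [Matrix.mul_assoc]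
      _ = 1 := by
          rw [h1, Matrix.mul_one, Matrix.mul_assoc R, Matrix.mul_nonsing_inv _ hu, Matrix.mul_one,
            h2]

theorem charpoly_invStar {Φ : SqMat F} (hΦ : IsUnit Φ.2.det) :
    (invStar Φ).charpoly = vee Φ.2.charpoly := by
  have hinj : Function.Injective (starRingEnd F) := (starRingEnd F).injective
  have hrev : (Φ.2.charpoly.map (starRingEnd F)).reverse
      = Φ.2.charpoly.reverse.map (starRingEnd F) := by
    rw [reverse, reverse, natDegree_map, reflect_map]
  have h1 : (invStar Φ).charpoly = (Φ.2⁻¹).charpoly.map (starRingEnd F) := by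
    rw [invStar, ← Matrix.charpoly_map, ← Matrix.charpoly_transpose (Matrix.map _ _)]
    rfl
  rw [h1, Matrix.charpoly_inv _ ((Matrix.isUnit_iff_isUnit_det _).2 hΦ), vee, hrev,
    Matrix.reverse_charpoly, Polynomial.map_mul, Polynomial.map_mul, Polynomial.map_C]
  congr 1
  rw [Matrix.det_eq_sign_charpoly_coeff Φ.2, Ring.inverse_eq_inv']
  -- The sign in the characteristic polynomial of the inverse cancels the sign relating the
  -- determinant to the constant coefficient.
  rw [starRingEnd_apply, mul_inv, star_mul', star_inv₀, star_inv₀, star_pow, star_neg, star_one,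
    Polynomial.map_pow, Polynomial.map_neg, Polynomial.map_one, Polynomial.C_mul, ← mul_assoc,
    ← inv_pow, inv_neg_one, Polynomial.C_pow, Polynomial.C_neg, Polynomial.C_1, ← mul_pow]
  simp

/-- The annihilator of `Φ^{-*}` is the conjugate of the annihilator of `Φ`. -/
theorem IsCyclicVector.exists_invStar {Φ : SqMat F} (h : Indecomposable Φ) (hΦ : IsUnit Φ.2.det)
    {c : F[T;T⁻¹]} {z : Fin Φ.1 → F} (hz : IsCyclicVector Φ.2 c z) :
    ∃ y, IsCyclicVector (invStar Φ) (star c) y := by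
  obtain ⟨p, k, y, -, hy⟩ := (h.invStar hΦ).exists_isCyclicVector (isUnit_det_invStar hΦ)
  have h1 := hy.charpoly_associated (isUnit_det_invStar hΦ)
  change Associated (toLaurent (IsometricPairs.invStar Φ).charpoly) _ at h1
  rw [charpoly_invStar hΦ] at h1
  have h2 := toLaurent_vee_associated (charpoly_coeff_zero_ne_zero hΦ)
  have h3 := hz.charpoly_associated hΦ
  have h4 : Associated (star (toLaurent Φ.2.charpoly)) (star c) :=
    associated_of_dvd_dvd (star_dvd_star h3.dvd) (star_dvd_star h3.symm.dvd)
  exact ⟨y, hy.of_associated (h1.symm.trans (h2.trans h4))⟩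

/-- Both Ψ and Φ^{-*} are cyclic, so equal characteristic polynomials make their annihilators
associated. -/
theorem similar_invStar_iff_charpoly {O : Set (SqMat F)} (hO : IsCanonicalSet O) {Φ Ψ : SqMat F}
    (hΦ : Φ ∈ O) (hΨ : Ψ ∈ O) :
    Similar Ψ.2 (invStar Φ) ↔ Ψ.2.charpoly = vee Φ.2.charpoly := by
  obtain ⟨hd, hi⟩ := hO.1 Φ hΦ
  obtain ⟨hd', hi'⟩ := hO.1 Ψ hΨ
  obtain ⟨p, k, y, -, hy⟩ := (hi.invStar hd).exists_isCyclicVector (isUnit_det_invStar hd)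
  obtain ⟨p', k', y', -, hy'⟩ := hi'.exists_isCyclicVector hd'
  have h1 := hy.charpoly_associated (isUnit_det_invStar hd)
  have h2 := hy'.charpoly_associated hd'
  constructor
  · intro hs
    let _ := columnModule Ψ.2
    have _ := columnModule_isScalarTower Ψ.2
    obtain ⟨b, hb⟩ := exists_basis_of_similar (columnModule_isOpFamily hd') hs
    rw [← charpoly_invStar hd, ← (isOpFamily_basis_iff b _).1 hb,
      ← (isOpFamily_basis_iff _ _).1 (columnModule_isOpFamily hd'), LinearMap.charpoly_toMatrix,
      LinearMap.charpoly_toMatrix]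
  · intro hc
    change Associated (toLaurent (invStar Φ).charpoly) _ at h1
    rw [charpoly_invStar hd, ← hc] at h1
    exact (hy'.of_associated (h2.symm.trans h1)).similar hd' (isUnit_det_invStar hd) hy

end CharacteristicPolynomial

end IsometricPairs
namespace IsometricPairs

open Polynomial LaurentPolynomial

universe u v

/-! ### Isometric ε-Hermitian forms on modules over Laurent polynomials. -/

section IsoForms

variable {F : Type u} [Field F] [StarRing F]

/-- `B` is a nondegenerate `ε`-Hermitian form for which multiplication by `T` is isometric. -/
structure IsoForm (ε : F) {V : Type v} [AddCommGroup V] [Module F V] [Module F[T;T⁻¹] V]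
    (B : V → V → F) : Prop where
  add_right : ∀ u v w, B u (v + w) = B u v + B u w
  smul_right : ∀ (a : F) u v, B u (a • v) = a * B u v
  herm : ∀ u v, B u v = ε * star (B v u)
  isom : ∀ u v, B ((T 1 : F[T;T⁻¹]) • u) ((T 1 : F[T;T⁻¹]) • v) = B u v
  nondeg : ∀ u, (∀ v, B u v = 0) → u = 0

namespace IsoForm

variable {ε : F} {V : Type v} [AddCommGroup V] [Module F V] [Module F[T;T⁻¹] V]
  {B : V → V → F}

theorem zero_right (h : IsoForm ε B) (u : V) : B u 0 = 0 := by
  have := h.smul_right 0 u 0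
  rwa [smul_zero, zero_mul] at this

theorem zero_left (h : IsoForm ε B) (u : V) : B 0 u = 0 := by
  rw [h.herm, h.zero_right, star_zero, mul_zero]

theorem add_left (h : IsoForm ε B) (u v w : V) : B (u + v) w = B u w + B v w := by
  rw [h.herm, h.add_right, star_add, mul_add, ← h.herm, ← h.herm]

theorem smul_left (h : IsoForm ε B) (a : F) (u v : V) : B (a • u) v = star a * B u v := by
  rw [h.herm, h.smul_right, star_mul', mul_left_comm, ← h.herm]

theorem neg_right (h : IsoForm ε B) (u v : V) : B u (-v) = -B u v := by
  rw [← neg_one_smul F v, h.smul_right, neg_one_mul]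

theorem neg_left (h : IsoForm ε B) (u v : V) : B (-u) v = -B u v := by
  rw [h.herm, h.neg_right, star_neg, mul_neg, ← h.herm]

theorem sub_right (h : IsoForm ε B) (u v w : V) : B u (v - w) = B u v - B u w := by
  rw [sub_eq_add_neg, h.add_right, h.neg_right, sub_eq_add_neg]

theorem sub_left (h : IsoForm ε B) (u v w : V) : B (u - v) w = B u w - B v w := by
  rw [sub_eq_add_neg, h.add_left, h.neg_left, sub_eq_add_neg]

theorem sum_right (h : IsoForm ε B) {ι : Type*} (s : Finset ι) (u : V) (f : ι → V) :
    B u (∑ i ∈ s, f i) = ∑ i ∈ s, B u (f i) := by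
  classical
  induction s using Finset.induction_on with
  | empty => simp [h.zero_right]
  | insert i s hi ih => rw [Finset.sum_insert hi, Finset.sum_insert hi, h.add_right, ih]

theorem sum_left (h : IsoForm ε B) {ι : Type*} (s : Finset ι) (u : V) (f : ι → V) :
    B (∑ i ∈ s, f i) u = ∑ i ∈ s, B (f i) u := by
  classical
  induction s using Finset.induction_on with
  | empty => simp [h.zero_left]
  | insert i s hi ih => rw [Finset.sum_insert hi, Finset.sum_insert hi, h.add_left, ih]

variable [IsScalarTower F F[T;T⁻¹] V]

/-- The isometry T has adjoint T⁻¹ and scalars are conjugated when they change sides; this is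
exactly the involution of the Laurent ring. -/
theorem adjoint (h : IsoForm ε B) (g : F[T;T⁻¹]) (u v : V) : B (g • u) v = B u (star g • v) := by
  have e1 : (T 1 : F[T;T⁻¹]) * T (-1) = 1 := by rw [← T_add]; simp
  have e2 : (T (-1) : F[T;T⁻¹]) * T 1 = 1 := by rw [← T_add]; simp
  have h1 : ∀ u v, B ((T 1 : F[T;T⁻¹]) • u) v = B u ((T (-1) : F[T;T⁻¹]) • v) := by
    intro u v
    rw [← h.isom u, smul_smul, e1, one_smul]
  have h2 : ∀ u v, B ((T (-1) : F[T;T⁻¹]) • u) v = B u ((T 1 : F[T;T⁻¹]) • v) := by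
    intro u v
    rw [← h.isom _ v, smul_smul, e1, one_smul]
  induction g using LaurentPolynomial.induction_on generalizing u v with
  | h_C a =>
    rw [star_C, LaurentPolynomial.C_eq_algebraMap, LaurentPolynomial.C_eq_algebraMap,
      IsScalarTower.algebraMap_smul, IsScalarTower.algebraMap_smul, h.smul_left, h.smul_right]
  | h_add hp hq => rw [add_smul, h.add_left, hp, hq, star_add, add_smul, h.add_right]
  | h_C_mul_T k a ih =>
    rw [T_add, ← mul_assoc, mul_smul, ih, h1, smul_smul, star_mul_comm _ (T 1), star_T, mul_comm]
  | h_C_mul_T_Z k a ih =>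
    rw [sub_eq_add_neg, T_add, ← mul_assoc, mul_smul, ih, h2, smul_smul,
      star_mul_comm _ (T (-1)), star_T, neg_neg, mul_comm]

theorem adjoint' (h : IsoForm ε B) (g : F[T;T⁻¹]) (u v : V) : B u (g • v) = B (star g • u) v := by
  rw [h.adjoint, star_star]

/-- The functional `f ↦ B(u, f v)`. -/
noncomputable def functional (h : IsoForm ε B) (u v : V) : F[T;T⁻¹] →ₗ[F] F where
  toFun f := B u (f • v)
  map_add' f g := by rw [add_smul, h.add_right]
  map_smul' a f := by rw [smul_assoc, h.smul_right]; rfl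

@[simp]
theorem functional_apply (h : IsoForm ε B) (u v : V) (f : F[T;T⁻¹]) :
    h.functional u v f = B u (f • v) := rfl

omit [IsScalarTower F F[T;T⁻¹] V] in
/-- Each linear functional is of the form `B(u, ·)`. -/
theorem exists_repr [FiniteDimensional F V] (h : IsoForm ε B) (hε : ε * star ε = 1)
    (l : V →ₗ[F] F) : ∃ u, ∀ v, B u v = l v := by
  set b := Module.finBasis F V
  let Θ : V →ₗ[F] (Fin (Module.finrank F V) → F) :=
    { toFun := fun w i => B (b i) w
      map_add' := fun w w' => by ext i; exact h.add_right _ _ _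
      map_smul' := fun a w => by ext i; exact h.smul_right _ _ _ }
  have hΘ : ∀ w i, Θ w i = B (b i) w := fun w i => rfl
  have hi : Function.Injective Θ := by
    rw [injective_iff_map_eq_zero]
    intro w hw
    refine h.nondeg w fun v => ?_
    rw [h.herm, ← b.sum_repr v, h.sum_left, Finset.sum_eq_zero, star_zero, mul_zero]
    intro i _
    rw [h.smul_left, ← hΘ, hw, Pi.zero_apply, mul_zero]
  have hs := (LinearMap.injective_iff_surjective_of_finrank_eq_finrank
    (by rw [Module.finrank_fin_fun])).1 hi
  obtain ⟨u, hu⟩ := hs fun i => ε * star (l (b i))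
  refine ⟨u, fun v => ?_⟩
  conv_lhs => rw [← b.sum_repr v]
  conv_rhs => rw [← b.sum_repr v]
  rw [h.sum_right, map_sum]
  refine Finset.sum_congr rfl fun i _ => ?_
  rw [h.smul_right, map_smul, h.herm, ← hΘ, hu, star_mul', star_star, ← mul_assoc ε, hε, one_mul,
    smul_eq_mul]

omit [IsScalarTower F F[T;T⁻¹] V] in
theorem exists_ne_zero [FiniteDimensional F V] (h : IsoForm ε B) (hε : ε * star ε = 1)
    {v : V} (hv : v ≠ 0) : ∃ u, B u v ≠ 0 := by
  by_contra hne
  push Not at hne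
  apply hv
  rw [← Module.forall_dual_apply_eq_zero_iff F]
  intro l
  obtain ⟨u, hu⟩ := h.exists_repr hε l
  rw [← hu, hne]

end IsoForm

end IsoForms

/-! ### The matrix Φ_(ε) as an ε-Hermitian functional. -/

section EpsFunctionals

variable {F : Type u} [Field F] [StarRing F]
variable {n : Type*} [Fintype n] [DecidableEq n]

/-- `φ` is a nondegenerate functional on `F[T;T⁻¹]/(c)` for which `(f, g) ↦ φ (star f * g)` is
`ε`-Hermitian. -/
structure IsEpsFunctional (ε : F) (c : F[T;T⁻¹]) (φ : F[T;T⁻¹] →ₗ[F] F) : Prop where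
  herm : ∀ f, φ f = ε * star (φ (star f))
  nondeg : ∀ h, c ∣ h ↔ ∀ f, φ (h * f) = 0

theorem IsEpsFunctional.apply_eq_of_dvd {ε : F} {c : F[T;T⁻¹]} {φ : F[T;T⁻¹] →ₗ[F] F}
    (h : IsEpsFunctional ε c φ) {f g : F[T;T⁻¹]} (hfg : c ∣ f - g) : φ f = φ g := by
  rw [← sub_eq_zero, ← map_sub, ← mul_one (f - g)]
  exact (h.nondeg _).1 hfg 1

/-- The largest ideal in the kernel of an ε-Hermitian functional is stable under the involution. -/
theorem IsEpsFunctional.dvd_star {ε : F} {c : F[T;T⁻¹]} {φ : F[T;T⁻¹] →ₗ[F] F}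
    (h : IsEpsFunctional ε c φ) : c ∣ star c := by
  rw [h.nondeg]
  intro f
  rw [h.herm, star_mul_comm, star_star, (h.nondeg c).1 dvd_rfl, star_zero, mul_zero]

theorem IsEpsFunctional.associated_star {ε : F} {c : F[T;T⁻¹]} {φ : F[T;T⁻¹] →ₗ[F] F}
    (h : IsEpsFunctional ε c φ) : Associated c (star c) :=
  associated_of_dvd_dvd h.dvd_star (by simpa using star_dvd_star h.dvd_star)

/-- The functional `f ↦ z^* M f(P) z`. -/
noncomputable def gramFunctional (M P : Matrix n n F) (z : n → F) : F[T;T⁻¹] →ₗ[F] F where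
  toFun f := star z ⬝ᵥ M.mulVec ((unitEval P f).mulVec z)
  map_add' f g := by rw [map_add, Matrix.add_mulVec, Matrix.mulVec_add, dotProduct_add]
  map_smul' a f := by
    rw [map_smul, Matrix.smul_mulVec, Matrix.mulVec_smul, dotProduct_smul]; rfl

theorem gramFunctional_apply (M P : Matrix n n F) (z : n → F) (f : F[T;T⁻¹]) :
    gramFunctional M P z f = star z ⬝ᵥ M.mulVec ((unitEval P f).mulVec z) := rfl

/-- The matrix form of `IsoForm.adjoint`. -/
theorem mul_unitEval_star {P M : Matrix n n F} (hP : IsUnit P.det)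
    (h : M = P.conjTranspose * M * P) (g : F[T;T⁻¹]) :
    M * unitEval P (star g) = (unitEval P g).conjTranspose * M := by
  have hP' : IsUnit P := (Matrix.isUnit_iff_isUnit_det P).2 hP
  have h1 : M * unitEval P (T (-1) : F[T;T⁻¹]) = (unitEval P (T 1 : F[T;T⁻¹])).conjTranspose * M := by
    rw [unitEval_T_one hP', unitEval_T_neg_one hP', ← Matrix.nonsing_inv_eq_ringInverse]
    conv_lhs => rw [h]
    rw [Matrix.mul_assoc, Matrix.mul_nonsing_inv _ hP, Matrix.mul_one]
  have h2 : M * unitEval P (T 1 : F[T;T⁻¹]) = (unitEval P (T (-1) : F[T;T⁻¹])).conjTranspose * M := by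
    rw [unitEval_T_one hP', unitEval_T_neg_one hP', ← Matrix.nonsing_inv_eq_ringInverse]
    conv_rhs => rw [h]
    rw [← Matrix.mul_assoc, ← Matrix.mul_assoc, ← Matrix.conjTranspose_mul,
      Matrix.mul_nonsing_inv _ hP, Matrix.conjTranspose_one, Matrix.one_mul]
  induction g using LaurentPolynomial.induction_on with
  | h_C a =>
    rw [star_C, LaurentPolynomial.C_eq_algebraMap, LaurentPolynomial.C_eq_algebraMap,
      AlgHom.commutes, AlgHom.commutes, Algebra.algebraMap_eq_smul_one,
      Algebra.algebraMap_eq_smul_one, Matrix.conjTranspose_smul, Matrix.conjTranspose_one]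
    simp
  | h_add hp hq =>
    rw [star_add, map_add, map_add, mul_add, hp, hq, Matrix.conjTranspose_add, add_mul]
  | h_C_mul_T k a ih =>
    rw [T_add, ← mul_assoc, star_mul_comm _ (T 1), map_mul _ (star _), ← Matrix.mul_assoc, ih,
      Matrix.mul_assoc, star_T, h1, ← Matrix.mul_assoc, ← Matrix.conjTranspose_mul, ← map_mul,
      mul_comm]
  | h_C_mul_T_Z k a ih =>
    rw [sub_eq_add_neg, T_add, ← mul_assoc, star_mul_comm _ (T (-1)), map_mul _ (star _),
      ← Matrix.mul_assoc, ih, Matrix.mul_assoc, star_T, neg_neg, h2, ← Matrix.mul_assoc,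
      ← Matrix.conjTranspose_mul, ← map_mul, mul_comm]

theorem gramFunctional_star_mul {P M : Matrix n n F} (hP : IsUnit P.det)
    (h : M = P.conjTranspose * M * P) (z : n → F) (f g : F[T;T⁻¹]) :
    gramFunctional M P z (star f * g)
      = star ((unitEval P f).mulVec z) ⬝ᵥ M.mulVec ((unitEval P g).mulVec z) := by
  rw [gramFunctional_apply, map_mul, ← Matrix.mulVec_mulVec, Matrix.mulVec_mulVec,
    mul_unitEval_star hP h, Matrix.star_mulVec, ← Matrix.mulVec_mulVec, Matrix.dotProduct_mulVec]

theorem IsCyclicVector.isEpsFunctional {ε : F} {Φ : SqMat F} (hΦ : IsUnit Φ.2.det)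
    {c : F[T;T⁻¹]} {z : Fin Φ.1 → F} (hz : IsCyclicVector Φ.2 c z)
    {M : Matrix (Fin Φ.1) (Fin Φ.1) F} (hM : IsEpsMatrix ε Φ M) :
    IsEpsFunctional ε c (gramFunctional M Φ.2 z) := by
  obtain ⟨h1, h2, h3⟩ := hM
  constructor
  · intro f
    have e1 := gramFunctional_star_mul hΦ h3 z 1 f
    have e2 := gramFunctional_star_mul hΦ h3 z f 1
    rw [star_one, one_mul] at e1
    rw [mul_one] at e2
    have key : ∀ a b : Fin Φ.1 → F, ε * star (star b ⬝ᵥ M.mulVec a) = star a ⬝ᵥ M.mulVec b := by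
      intro a b
      rw [← Matrix.star_dotProduct, Matrix.star_mulVec, ← Matrix.dotProduct_mulVec,
        ← smul_eq_mul, ← dotProduct_smul, ← Matrix.smul_mulVec, ← h2]
    rw [e1, e2, key]
  · intro h
    constructor
    · rintro ⟨r, rfl⟩ f
      rw [gramFunctional_apply, (hz.ann _).2 ⟨r * f, by ring⟩, Matrix.mulVec_zero, dotProduct_zero]
    · intro hf
      rw [← hz.ann]
      refine Matrix.mulVec_injective_of_isUnit ((Matrix.isUnit_iff_isUnit_det M).2 h1) ?_
      ext i
      -- Testing with this f reads off the i-th entry of M h(Φ) z.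
      have := hf (star (hz.coord i))
      rw [mul_comm, gramFunctional_star_mul hΦ h3, hz.coord_spec] at this
      simpa [Pi.single_apply, dotProduct, apply_ite] using this

/-- The required matrix is the Gram matrix of (f, g) ↦ φ(f* g) in the basis of the Laurent ring
modulo c that corresponds to the standard basis of columns. -/
theorem IsEpsFunctional.hasEpsMatrix {ε : F} {Φ : SqMat F} (hΦ : IsUnit Φ.2.det)
    {c : F[T;T⁻¹]} {z : Fin Φ.1 → F} (hz : IsCyclicVector Φ.2 c z) {φ : F[T;T⁻¹] →ₗ[F] F}
    (h : IsEpsFunctional ε c φ) : HasEpsMatrix ε Φ := by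
  have hexp : ∀ f : F[T;T⁻¹], c ∣ f - ∑ i, (unitEval Φ.2 f).mulVec z i • hz.coord i := by
    intro f
    rw [← hz.ann, map_sub, map_sum, Matrix.sub_mulVec, sub_eq_zero, Matrix.sum_mulVec]
    simp only [map_smul, Matrix.smul_mulVec, hz.coord_spec]
    ext i
    simp [Finset.sum_apply, Pi.single_apply]
  have hstar : ∀ f g : F[T;T⁻¹], c ∣ f - g → ∀ r, φ (star f * r) = φ (star g * r) := by
    intro f g hfg r
    refine h.apply_eq_of_dvd ?_
    rw [← sub_mul, ← star_sub]
    exact Dvd.dvd.mul_right (h.dvd_star.trans (star_dvd_star hfg)) _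
  have hT : ∀ y, c ∣ T 1 * hz.coord y - ∑ x, Φ.2 x y • hz.coord x := by
    intro y
    refine (hexp (T 1 * hz.coord y)).trans (dvd_of_eq ?_)
    rw [map_mul, ← Matrix.mulVec_mulVec, hz.coord_spec,
      unitEval_T_one ((Matrix.isUnit_iff_isUnit_det _).2 hΦ), Matrix.mulVec_single_one]
    rfl
  refine ⟨Matrix.of fun a b => φ (star (hz.coord a) * hz.coord b), ?_, ?_, ?_⟩
  · rw [← Matrix.isUnit_iff_isUnit_det, ← Matrix.mulVec_injective_iff_isUnit]
    have hadd : ∀ v, (Matrix.of fun a b => φ (star (hz.coord a) * hz.coord b)).mulVec v = 0 →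
        v = 0 := by
      intro v hv
      have hg : c ∣ ∑ b, v b • hz.coord b := by
        rw [h.nondeg]
        intro f
        have h1 := hstar _ _ (hexp (star f)) (∑ b, v b • hz.coord b)
        rw [star_star] at h1
        rw [mul_comm, h1, star_sum, Finset.sum_mul, map_sum, Finset.sum_eq_zero]
        intro a _
        rw [star_smul_laurent, smul_mul_assoc, map_smul, Finset.mul_sum, map_sum]
        have := congrFun hv a
        simp only [Matrix.mulVec, dotProduct, Matrix.of_apply, Pi.zero_apply] at this
        rw [← smul_zero (star ((unitEval Φ.2 (star f)).mulVec z a)), ← this]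
        congr 1
        refine Finset.sum_congr rfl fun b _ => ?_
        rw [mul_smul_comm, map_smul, smul_eq_mul, mul_comm]
      rw [← hz.ann, map_sum, Matrix.sum_mulVec] at hg
      simp only [map_smul, Matrix.smul_mulVec, hz.coord_spec] at hg
      ext i
      have := congrFun hg i
      simpa [Finset.sum_apply, Pi.single_apply] using this
    intro v w hvw
    rw [← sub_eq_zero]
    refine hadd _ ?_
    rw [Matrix.mulVec_sub, sub_eq_zero]
    exact hvw
  · ext a b
    rw [Matrix.smul_apply, Matrix.conjTranspose_apply, Matrix.of_apply, Matrix.of_apply, h.herm,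
      star_mul_comm, star_star, smul_eq_mul, mul_comm (hz.coord a)]
  · ext a b
    have e1 : φ (star (hz.coord a) * hz.coord b)
        = φ (star (T 1 * hz.coord a) * (T 1 * hz.coord b)) := by
      congr 1
      have e2 : (T (-1) : F[T;T⁻¹]) * T 1 = 1 := by rw [← T_add]; simp
      rw [star_mul_comm, star_T]
      linear_combination (-star (hz.coord a) * hz.coord b) * e2
    have e3 : ∀ f, φ (f * (T 1 * hz.coord b)) = φ (f * ∑ x, Φ.2 x b • hz.coord x) := fun f => by
      refine h.apply_eq_of_dvd ?_
      rw [← mul_sub]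
      exact Dvd.dvd.mul_left (hT b) _
    rw [Matrix.of_apply, e1, hstar _ _ (hT a), e3, star_sum]
    simp only [star_smul_laurent, Finset.sum_mul, Finset.mul_sum, map_sum, smul_mul_smul_comm,
      map_smul, Matrix.mul_apply, Matrix.conjTranspose_apply, Matrix.of_apply]
    refine Finset.sum_congr rfl fun y _ => ?_
    refine Finset.sum_congr rfl fun x _ => ?_
    rw [smul_eq_mul]
    ring

end EpsFunctionals

end IsometricPairs
namespace IsometricPairs

open Polynomial LaurentPolynomial

universe u v

/-! ### Frames: vectors realizing a direct sum of pairs. -/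

section Frames

variable {F : Type u} [Field F] [StarRing F] {ε : F}
variable {V : Type v} [AddCommGroup V] [Module F V] [Module F[T;T⁻¹] V] {B : V → V → F}

/-- The orthogonal complement W is a submodule because adjoints of Laurent polynomials preserve the
span of e. As G is invertible, V is the orthogonal sum of this span and W. -/
theorem IsoForm.exists_orthogonal [IsScalarTower F F[T;T⁻¹] V] [FiniteDimensional F V]
    (h : IsoForm ε B) {n : Type*} [Fintype n] [DecidableEq n] {P G : Matrix n n F}
    (hP : IsUnit P.det) (hG : IsUnit G.det) {e : n → V} (he : IsOpFamily P e)
    (hg : ∀ x y, B (e x) (e y) = G x y) :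
    ∃ W : Submodule F[T;T⁻¹] V, (∀ w ∈ W, ∀ x, B (e x) w = 0) ∧
      IsoForm ε (fun u v : W => B u v) ∧
      Module.finrank F V = Fintype.card n + Module.finrank F W := by
  let W : Submodule F[T;T⁻¹] V :=
    { carrier := {v | ∀ x, B (e x) v = 0}
      add_mem' := fun {v w} hv hw x => by rw [h.add_right, hv, hw, add_zero]
      zero_mem' := fun x => h.zero_right _
      smul_mem' := fun g v hv x => by
        rw [h.adjoint', laurent_smul_opFamily hP he, h.sum_left]
        refine Finset.sum_eq_zero fun y _ => ?_
        rw [h.smul_left, hv, mul_zero] }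
  have hW : ∀ v, v ∈ W ↔ ∀ x, B (e x) v = 0 := fun v => Iff.rfl
  let Θ : V →ₗ[F] (n → F) :=
    { toFun := fun w i => B (e i) w
      map_add' := fun w w' => by ext i; exact h.add_right _ _ _
      map_smul' := fun a w => by ext i; exact h.smul_right _ _ _ }
  have hΘ : ∀ a : n → F, Θ (∑ x, (G⁻¹.mulVec a) x • e x) = a := by
    intro a
    ext y
    change B (e y) _ = _
    rw [h.sum_right]
    simp only [h.smul_right, hg]
    have : (G.mulVec (G⁻¹.mulVec a)) y = a y := by
      rw [Matrix.mulVec_mulVec, Matrix.mul_nonsing_inv _ hG, Matrix.one_mulVec]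
    rw [← this]
    simp only [Matrix.mulVec, dotProduct]
    exact Finset.sum_congr rfl fun x _ => mul_comm _ _
  refine ⟨W, fun w hw => hw, ?_, ?_⟩
  · constructor
    · exact fun u v w => h.add_right _ _ _
    · exact fun a u v => h.smul_right _ _ _
    · exact fun u v => h.herm _ _
    · exact fun u v => h.isom _ _
    · intro u hu
      rw [← Submodule.coe_eq_zero]
      refine h.nondeg _ fun v => ?_
      -- The orthogonal projection of v to the span of e.
      set v' := ∑ x, (G⁻¹.mulVec (Θ v)) x • e x with hv'
      have hmem : v - v' ∈ W := by
        rw [hW]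
        intro x
        rw [h.sub_right, sub_eq_zero]
        exact (congrFun (hΘ (Θ v)) x).symm
      rw [← sub_add_cancel v v', h.add_right, hu ⟨_, hmem⟩, zero_add, hv', h.sum_right]
      refine Finset.sum_eq_zero fun x _ => ?_
      rw [h.smul_right, h.herm, (hW _).1 u.2 x, star_zero, mul_zero, mul_zero]
  · have hs : LinearMap.range Θ = ⊤ := LinearMap.range_eq_top.2 fun a => ⟨_, hΘ a⟩
    have h1 := Θ.finrank_range_add_finrank_ker
    rw [hs, finrank_top, Module.finrank_fintype_fun_eq_card] at h1
    rw [← h1]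
    congr 1
    have : LinearMap.ker Θ = W.restrictScalars F := by
      ext v
      rw [LinearMap.mem_ker, Submodule.restrictScalars_mem, hW]
      exact funext_iff
    rw [this]
    rfl

/-- Vectors whose Gram matrix and operator matrix are those of the direct sum `D`. -/
structure IsFrame (ε : F) (E : ∀ Φ : SqMat F, Matrix (Fin Φ.1) (Fin Φ.1) F) (B : V → V → F)
    (D : SummandList F) (e₁ : ∀ i, Fin (D.Φ i).1 ⊕ Fin (D.Φ i).1 → V)
    (e₂ : ∀ j, Fin (D.Ψ j).1 → V) : Prop where
  op₁ : ∀ i, IsOpFamily (dsum (D.Φ i).2 (invStar (D.Φ i))) (e₁ i)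
  op₂ : ∀ j, IsOpFamily (D.Ψ j).2 (e₂ j)
  gram₁ : ∀ i x y, B (e₁ i x) (e₁ i y) = skewSum 1 (ε • 1) x y
  gram₂ : ∀ j x y, B (e₂ j x) (e₂ j y)
    = (E (D.Ψ j) * laurentValue (D.q j) (D.Ψ j).2 : Matrix _ _ F) x y
  orth₁ : ∀ i i', i ≠ i' → ∀ x y, B (e₁ i x) (e₁ i' y) = 0
  orth₂ : ∀ j j', j ≠ j' → ∀ x y, B (e₂ j x) (e₂ j' y) = 0
  orth : ∀ i j x y, B (e₁ i x) (e₂ j y) = 0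

/-- The number of vectors in a frame. -/
def SummandList.dim (D : SummandList F) : ℕ :=
  ∑ i, ((D.Φ i).1 + (D.Φ i).1) + ∑ j, (D.Ψ j).1

omit [StarRing F] in
theorem card_index (D : SummandList F) : Fintype.card D.Index = D.dim := by
  simp [SummandList.dim, SummandList.Index]

theorem isUnit_det_skewSum (hε : ε * star ε = 1) (n : ℕ) :
    IsUnit (skewSum (1 : Matrix (Fin n) (Fin n) F) (ε • (1 : Matrix (Fin n) (Fin n) F))).det := by
  refine Matrix.isUnit_det_of_right_inverse (B := skewSum (star ε • 1) 1) ?_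
  simp only [skewSum, Matrix.fromBlocks_multiply]
  simp [mul_comm, hε, smul_smul]

section

variable {E : ∀ Φ : SqMat F, Matrix (Fin Φ.1) (Fin Φ.1) F} {D : SummandList F}
  {e₁ : ∀ i, Fin (D.Φ i).1 ⊕ Fin (D.Φ i).1 → V} {e₂ : ∀ j, Fin (D.Ψ j).1 → V}

/-- All vectors of a frame. -/
def frameVectors (D : SummandList F) (e₁ : ∀ i, Fin (D.Φ i).1 ⊕ Fin (D.Φ i).1 → V)
    (e₂ : ∀ j, Fin (D.Ψ j).1 → V) : D.Index → V :=
  Sum.elim (fun x => e₁ x.1 x.2) (fun x => e₂ x.1 x.2)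

/-- Pairing a linear relation with the vectors of one block leaves the invertible Gram matrix of
that block applied to its coefficients. -/
theorem IsFrame.linearIndependent (h : IsFrame ε E B D e₁ e₂) (hB : IsoForm ε B)
    (hε : ε * star ε = 1)
    (hu : ∀ j, IsUnit (E (D.Ψ j) * laurentValue (D.q j) (D.Ψ j).2 : Matrix _ _ F).det) :
    LinearIndependent F (frameVectors D e₁ e₂) := by
  rw [Fintype.linearIndependent_iff]
  intro a ha
  rw [Fintype.sum_sum_type, Fintype.sum_sigma, Fintype.sum_sigma] at ha
  simp only [frameVectors, Sum.elim_inl, Sum.elim_inr] at ha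
  have h1 : ∀ i x, a (Sum.inl ⟨i, x⟩) = 0 := by
    intro i
    have : (fun x => a (Sum.inl ⟨i, x⟩)) = 0 := by
      refine Matrix.mulVec_injective_of_isUnit
        ((Matrix.isUnit_iff_isUnit_det _).2 (isUnit_det_skewSum hε (D.Φ i).1)) ?_
      ext x
      have h2 := congrArg (B (e₁ i x)) ha
      simp only [hB.add_right, hB.sum_right, hB.smul_right, hB.zero_right, h.orth, mul_zero,
        Finset.sum_const_zero, add_zero] at h2
      rw [Finset.sum_eq_single i] at h2
      · simp only [h.gram₁] at h2
        rw [Matrix.mulVec_zero, Pi.zero_apply, ← h2]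
        simp only [Matrix.mulVec, dotProduct]
        exact Finset.sum_congr rfl fun y _ => mul_comm _ _
      · intro i' _ hi'
        refine Finset.sum_eq_zero fun y _ => ?_
        rw [h.orth₁ i i' hi'.symm, mul_zero]
      · intro hi; exact absurd (Finset.mem_univ i) hi
    exact fun x => congrFun this x
  have h2 : ∀ j x, a (Sum.inr ⟨j, x⟩) = 0 := by
    intro j
    have : (fun x => a (Sum.inr ⟨j, x⟩)) = 0 := by
      refine Matrix.mulVec_injective_of_isUnit
        ((Matrix.isUnit_iff_isUnit_det _).2 (hu j)) ?_
      ext x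
      have h2 := congrArg (B (e₂ j x)) ha
      simp only [h1, zero_smul, Finset.sum_const_zero, zero_add, hB.sum_right, hB.smul_right,
        hB.zero_right] at h2
      rw [Finset.sum_eq_single j] at h2
      · simp only [h.gram₂] at h2
        rw [Matrix.mulVec_zero, Pi.zero_apply, ← h2]
        simp only [Matrix.mulVec, dotProduct]
        exact Finset.sum_congr rfl fun y _ => mul_comm _ _
      · intro i' _ hi'
        refine Finset.sum_eq_zero fun y _ => ?_
        rw [h.orth₂ j i' hi'.symm, mul_zero]
      · intro hi; exact absurd (Finset.mem_univ j) hi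
    exact fun x => congrFun this x
  rintro (⟨i, x⟩ | ⟨j, x⟩)
  · exact h1 i x
  · exact h2 j x

theorem IsFrame.isOpFamily (h : IsFrame ε E B D e₁ e₂) :
    IsOpFamily D.opMatrix (frameVectors D e₁ e₂) := by
  rintro (⟨i, x⟩ | ⟨j, x⟩)
  · simp only [frameVectors, Fintype.sum_sum_type, Sum.elim_inl, Sum.elim_inr, Fintype.sum_sigma,
      SummandList.opMatrix, dsum, Matrix.fromBlocks_apply₁₁, Matrix.fromBlocks_apply₂₁,
      Matrix.zero_apply, zero_smul, Finset.sum_const_zero, add_zero]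
    rw [h.op₁ i x, Finset.sum_eq_single i]
    · rw [Fintype.sum_sum_type]
      simp [Matrix.blockDiagonal'_apply_eq, dsum]
    · intro i' _ hi'
      simp [Matrix.blockDiagonal'_apply_ne _ _ _ hi']
    · intro hi; exact absurd (Finset.mem_univ i) hi
  · simp only [frameVectors, Fintype.sum_sum_type, Sum.elim_inl, Sum.elim_inr, Fintype.sum_sigma,
      SummandList.opMatrix, dsum, Matrix.fromBlocks_apply₁₂, Matrix.fromBlocks_apply₂₂,
      Matrix.zero_apply, zero_smul, Finset.sum_const_zero, zero_add]
    rw [h.op₂ j x, Finset.sum_eq_single j]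
    · simp [Matrix.blockDiagonal'_apply_eq]
    · intro i' _ hi'
      simp [Matrix.blockDiagonal'_apply_ne _ _ _ hi']
    · intro hi; exact absurd (Finset.mem_univ j) hi

theorem IsFrame.gram (h : IsFrame ε E B D e₁ e₂) (hB : IsoForm ε B) (x y : D.Index) :
    B (frameVectors D e₁ e₂ x) (frameVectors D e₁ e₂ y) = D.formMatrix ε E x y := by
  obtain (⟨i, x⟩ | ⟨j, x⟩) := x <;> obtain (⟨i', y⟩ | ⟨j', y⟩) := y
  · simp only [frameVectors, Sum.elim_inl, SummandList.formMatrix, dsum,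
      Matrix.fromBlocks_apply₁₁]
    by_cases hi : i = i'
    · subst hi
      rw [Matrix.blockDiagonal'_apply_eq, h.gram₁]
    · rw [Matrix.blockDiagonal'_apply_ne _ _ _ hi, h.orth₁ _ _ hi]
  · simp only [frameVectors, Sum.elim_inl, Sum.elim_inr, SummandList.formMatrix, dsum,
      Matrix.fromBlocks_apply₁₂]
    rw [h.orth, Matrix.zero_apply]
  · simp only [frameVectors, Sum.elim_inl, Sum.elim_inr, SummandList.formMatrix, dsum,
      Matrix.fromBlocks_apply₂₁]
    rw [hB.herm, h.orth, Matrix.zero_apply, star_zero, mul_zero]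
  · simp only [frameVectors, Sum.elim_inr, SummandList.formMatrix, dsum,
      Matrix.fromBlocks_apply₂₂]
    by_cases hi : j = j'
    · subst hi
      rw [Matrix.blockDiagonal'_apply_eq, h.gram₂]
    · rw [Matrix.blockDiagonal'_apply_ne _ _ _ hi, h.orth₂ _ _ hi]

theorem isFrame_of_index (e : D.Index → V) (hop : IsOpFamily D.opMatrix e)
    (hg : ∀ x y, B (e x) (e y) = D.formMatrix ε E x y) :
    IsFrame ε E B D (fun i x => e (Sum.inl ⟨i, x⟩)) (fun j x => e (Sum.inr ⟨j, x⟩)) := by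
  constructor
  · intro i x
    have := hop (Sum.inl ⟨i, x⟩)
    simp only [Fintype.sum_sum_type, Fintype.sum_sigma,
      SummandList.opMatrix, dsum, Matrix.fromBlocks_apply₁₁, Matrix.fromBlocks_apply₂₁,
      Matrix.zero_apply, zero_smul, Finset.sum_const_zero, add_zero] at this
    rw [this, Finset.sum_eq_single i]
    · rw [Fintype.sum_sum_type]
      simp [Matrix.blockDiagonal'_apply_eq, dsum]
    · intro i' _ hi'
      simp [Matrix.blockDiagonal'_apply_ne _ _ _ hi']
    · intro hi; exact absurd (Finset.mem_univ i) hi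
  · intro j x
    have := hop (Sum.inr ⟨j, x⟩)
    simp only [Fintype.sum_sum_type, Fintype.sum_sigma,
      SummandList.opMatrix, dsum, Matrix.fromBlocks_apply₁₂, Matrix.fromBlocks_apply₂₂,
      Matrix.zero_apply, zero_smul, Finset.sum_const_zero, zero_add] at this
    rw [this, Finset.sum_eq_single j]
    · simp [Matrix.blockDiagonal'_apply_eq]
    · intro i' _ hi'
      simp [Matrix.blockDiagonal'_apply_ne _ _ _ hi']
    · intro hi; exact absurd (Finset.mem_univ j) hi
  · intro i x y
    rw [hg, SummandList.formMatrix, dsum, Matrix.fromBlocks_apply₁₁,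
      Matrix.blockDiagonal'_apply_eq]
  · intro j x y
    rw [hg, SummandList.formMatrix, dsum, Matrix.fromBlocks_apply₂₂,
      Matrix.blockDiagonal'_apply_eq]
  · intro i i' hi x y
    rw [hg, SummandList.formMatrix, dsum, Matrix.fromBlocks_apply₁₁,
      Matrix.blockDiagonal'_apply_ne _ _ _ hi]
  · intro i i' hi x y
    rw [hg, SummandList.formMatrix, dsum, Matrix.fromBlocks_apply₂₂,
      Matrix.blockDiagonal'_apply_ne _ _ _ hi]
  · intro i j x y
    rw [hg, SummandList.formMatrix, dsum, Matrix.fromBlocks_apply₁₂, Matrix.zero_apply]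

/-- Adding a summand of type (i) to a list. -/
def SummandList.consFst (D : SummandList F) (Φ : SqMat F) : SummandList F where
  k := D.k + 1
  Φ := Fin.cons Φ D.Φ
  l := D.l
  Ψ := D.Ψ
  q := D.q

/-- Adding a summand of type (ii) to a list. -/
def SummandList.consSnd (D : SummandList F) (Ψ : SqMat F) (q : F[T;T⁻¹]) : SummandList F where
  k := D.k
  Φ := D.Φ
  l := D.l + 1
  Ψ := Fin.cons Ψ D.Ψ
  q := Fin.cons q D.q

theorem IsFrame.consFst (h : IsFrame ε E B D e₁ e₂) (hB : IsoForm ε B) {Φ : SqMat F}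
    {f : Fin Φ.1 ⊕ Fin Φ.1 → V} (hf : IsOpFamily (dsum Φ.2 (invStar Φ)) f)
    (hg : ∀ x y, B (f x) (f y) = skewSum 1 (ε • 1) x y)
    (ho₁ : ∀ x i y, B (f x) (e₁ i y) = 0) (ho₂ : ∀ x j y, B (f x) (e₂ j y) = 0) :
    IsFrame ε E B (D.consFst Φ)
      (Fin.cases (motive := fun i => Fin ((D.consFst Φ).Φ i).1 ⊕ Fin ((D.consFst Φ).Φ i).1 → V)
        f e₁) e₂ := by
  constructor
  · intro i
    induction i using Fin.cases with
    | zero => exact hf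
    | succ i => exact h.op₁ i
  · exact h.op₂
  · intro i
    induction i using Fin.cases with
    | zero => exact hg
    | succ i => exact h.gram₁ i
  · exact h.gram₂
  · intro i i' hi
    induction i using Fin.cases with
    | zero =>
      induction i' using Fin.cases with
      | zero => exact absurd rfl hi
      | succ i' => exact fun x y => ho₁ x i' y
    | succ i =>
      induction i' using Fin.cases with
      | zero =>
        intro x y
        exact (hB.herm _ _).trans ((congrArg (fun t => ε * star t) (ho₁ y i x)).trans
          (by rw [star_zero, mul_zero]))
      | succ i' => exact h.orth₁ i i' fun h' => hi (by rw [h'])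
  · exact h.orth₂
  · intro i
    induction i using Fin.cases with
    | zero => exact fun j x y => ho₂ x j y
    | succ i => exact h.orth i

theorem IsFrame.consSnd (h : IsFrame ε E B D e₁ e₂) (hB : IsoForm ε B) {Ψ : SqMat F}
    {q : F[T;T⁻¹]} {f : Fin Ψ.1 → V} (hf : IsOpFamily Ψ.2 f)
    (hg : ∀ x y, B (f x) (f y) = (E Ψ * laurentValue q Ψ.2 : Matrix _ _ F) x y)
    (ho₁ : ∀ x i y, B (f x) (e₁ i y) = 0) (ho₂ : ∀ x j y, B (f x) (e₂ j y) = 0) :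
    IsFrame ε E B (D.consSnd Ψ q) e₁
      (Fin.cases (motive := fun i => Fin ((D.consSnd Ψ q).Ψ i).1 → V) f e₂) := by
  constructor
  · exact h.op₁
  · intro i
    induction i using Fin.cases with
    | zero => exact hf
    | succ i => exact h.op₂ i
  · exact h.gram₁
  · intro i
    induction i using Fin.cases with
    | zero => exact hg
    | succ i => exact h.gram₂ i
  · exact h.orth₁
  · intro i i' hi
    induction i using Fin.cases with
    | zero =>
      induction i' using Fin.cases with
      | zero => exact absurd rfl hi
      | succ i' => exact fun x y => ho₂ x i' y
    | succ i =>
      induction i' using Fin.cases with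
      | zero =>
        intro x y
        exact (hB.herm _ _).trans ((congrArg (fun t => ε * star t) (ho₂ y i x)).trans
          (by rw [star_zero, mul_zero]))
      | succ i' => exact h.orth₂ i i' fun h' => hi (by rw [h'])
  · intro i j
    induction j using Fin.cases with
    | zero =>
      intro x y
      exact (hB.herm _ _).trans ((congrArg (fun t => ε * star t) (ho₁ y i x)).trans
        (by rw [star_zero, mul_zero]))
    | succ j => exact h.orth i j

theorem IsFrame.map_subtype {W : Submodule F[T;T⁻¹] V} [IsScalarTower F F[T;T⁻¹] V]
    {f₁ : ∀ i, Fin (D.Φ i).1 ⊕ Fin (D.Φ i).1 → W} {f₂ : ∀ j, Fin (D.Ψ j).1 → W}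
    (h : IsFrame ε E (fun u v : W => B u v) D f₁ f₂) :
    IsFrame ε E B D (fun i x => f₁ i x) (fun j x => f₂ j x) := by
  refine ⟨fun i x => ?_, fun j x => ?_, h.gram₁, h.gram₂, h.orth₁, h.orth₂, h.orth⟩
  · simpa using congrArg (W.subtype.restrictScalars F) (h.op₁ i x)
  · simpa using congrArg (W.subtype.restrictScalars F) (h.op₂ j x)

omit [StarRing F] in
theorem SummandList.dim_consFst (D : SummandList F) (Φ : SqMat F) :
    (D.consFst Φ).dim = Φ.1 + Φ.1 + D.dim := by
  change ∑ i : Fin (D.k + 1), ((Fin.cons (α := fun _ => SqMat F) Φ D.Φ i).1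
    + (Fin.cons (α := fun _ => SqMat F) Φ D.Φ i).1) + ∑ j, (D.Ψ j).1 = _ + (∑ i, ((D.Φ i).1 + (D.Φ i).1) + ∑ j, (D.Ψ j).1)
  rw [Fin.sum_univ_succ]
  simp only [Fin.cons_zero, Fin.cons_succ]
  omega

omit [StarRing F] in
theorem SummandList.dim_consSnd (D : SummandList F) (Ψ : SqMat F) (q : F[T;T⁻¹]) :
    (D.consSnd Ψ q).dim = Ψ.1 + D.dim := by
  change ∑ i, ((D.Φ i).1 + (D.Φ i).1) + ∑ j : Fin (D.l + 1), (Fin.cons (α := fun _ => SqMat F) Ψ D.Ψ j).1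
    = _ + (∑ i, ((D.Φ i).1 + (D.Φ i).1) + ∑ j, (D.Ψ j).1)
  rw [Fin.sum_univ_succ (n := D.l)]
  simp only [Fin.cons_zero, Fin.cons_succ]
  omega

end

end Frames

/-! ### Building the two types of summands from generators. -/

section BlockFamilies

variable {F : Type u} [Field F] [StarRing F] {ε : F}
variable {V : Type v} [AddCommGroup V] [Module F V] [Module F[T;T⁻¹] V]
  [IsScalarTower F F[T;T⁻¹] V] {B : V → V → F}

/-- The vectors `hz.coord x • w` stand for the standard basis, and multiplying the argument of the
functional by q multiplies its Gram matrix by q(Φ). -/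
theorem IsoForm.gram_snd (hB : IsoForm ε B) {Φ : SqMat F} (hΦ : IsUnit Φ.2.det)
    {c : F[T;T⁻¹]} {z : Fin Φ.1 → F} (hz : IsCyclicVector Φ.2 c z)
    {M : Matrix (Fin Φ.1) (Fin Φ.1) F} (hM : IsEpsMatrix ε Φ M) {q : F[T;T⁻¹]} {w : V}
    (hw : ∀ f, B w (f • w) = gramFunctional M Φ.2 z (q * f)) (x y : Fin Φ.1) :
    B (hz.coord x • w) (hz.coord y • w) = (M * laurentValue q Φ.2 : Matrix _ _ F) x y := by
  rw [hB.adjoint, smul_smul, hw, mul_left_comm, gramFunctional_star_mul hΦ hM.2.2, map_mul,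
    ← Matrix.mulVec_mulVec, hz.coord_spec, hz.coord_spec, Matrix.mulVec_mulVec,
    laurentValue_eq ((Matrix.isUnit_iff_isUnit_det _).2 hΦ)]
  simp [dotProduct, Pi.single_apply, apply_ite]

/-- A hyperbolic pair of cyclic isotropic submodules gives a summand of type (i). -/
theorem IsoForm.exists_fst (hB : IsoForm ε B) [FiniteDimensional F V] {Φ : SqMat F}
    (hΦ : IsUnit Φ.2.det)
    {c : F[T;T⁻¹]} {z : Fin Φ.1 → F} (hz : IsCyclicVector Φ.2 c z) {u u' : V}
    (hu : c • u = 0) (hu' : star c • u' = 0) (h1 : ∀ f : F[T;T⁻¹], B u (f • u) = 0)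
    (h2 : ∀ f : F[T;T⁻¹], B u' (f • u') = 0)
    (h3 : ∀ h : F[T;T⁻¹], (∀ f, B u' ((h * f) • u) = 0) → c ∣ h) :
    ∃ f : Fin Φ.1 ⊕ Fin Φ.1 → V, IsOpFamily (dsum Φ.2 (invStar Φ)) f ∧
      (∀ x y, B (f x) (f y) = skewSum 1 (ε • 1) x y) ∧
      ∀ a, ∃ g g' : F[T;T⁻¹], f a = g • u + g' • u' := by
  set φ := hB.functional u' u with hφdef
  have hφ : ∀ f, φ f = B u' (f • u) := fun f => rfl
  have hφn : ∀ h, c ∣ h ↔ ∀ f, φ (h * f) = 0 := by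
    intro h
    refine ⟨?_, h3 h⟩
    rintro ⟨r, rfl⟩ f
    rw [hφ, show c * r * f = r * f * c by ring, mul_smul, hu, smul_zero, hB.zero_right]
  have hx : ∀ f : F[T;T⁻¹], f • u = 0 ↔ c ∣ f := by
    intro f
    constructor
    · intro hf
      rw [hφn]
      intro g
      rw [hφ, mul_comm, mul_smul, hf, smul_zero, hB.zero_right]
    · rintro ⟨r, rfl⟩
      rw [mul_comm, mul_smul, hu, smul_zero]
  -- The dual basis: φ is nondegenerate modulo c, so each coordinate functional on the module of u
  -- is pairing with a multiple of u'.
  have hex : ∀ b, ∃ g : F[T;T⁻¹], ∀ f : F[T;T⁻¹],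
      B (g • u') (f • u) = (unitEval Φ.2 f).mulVec z b := by
    intro b
    let ψ : F[T;T⁻¹] →ₗ[F] F :=
      { toFun := fun f => (unitEval Φ.2 f).mulVec z b
        map_add' := fun f g => by rw [map_add, Matrix.add_mulVec, Pi.add_apply]
        map_smul' := fun a f => by rw [map_smul, Matrix.smul_mulVec, Pi.smul_apply]; rfl }
    obtain ⟨g, hg⟩ := exists_functional_eq_mul hx φ ψ hφn (fun f => by
      change (unitEval Φ.2 (c * f)).mulVec z b = 0
      rw [(hz.ann _).2 (Dvd.intro f rfl), Pi.zero_apply])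
    refine ⟨star g, fun f => ?_⟩
    rw [hB.adjoint, star_star, smul_smul, ← hφ, ← hg]
    rfl
  choose g hg using hex
  -- Multiples of u separate multiples of u', so the action of T on the dual basis, given by Φ^{-*},
  -- can be verified by pairing with u.
  have hvan : ∀ d : F[T;T⁻¹], (∀ f : F[T;T⁻¹], B (d • u') (f • u) = 0) → d • u' = 0 := by
    intro d hd
    have : c ∣ star d := by
      refine h3 _ fun f => ?_
      rw [mul_smul, ← hB.adjoint]
      exact hd f
    obtain ⟨r, hr⟩ := star_dvd_star this
    rw [star_star] at hr
    rw [hr, mul_comm, mul_smul, hu', smul_zero]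
  have hPu := (Matrix.isUnit_iff_isUnit_det _).2 hΦ
  refine ⟨Sum.elim (fun a => hz.coord a • u) (fun b => g b • u'), ?_, ?_, ?_⟩
  · rintro (y | y)
    · simp only [Fintype.sum_sum_type, dsum, Matrix.fromBlocks_apply₁₁, Sum.elim_inl, Sum.elim_inr,
        Matrix.fromBlocks_apply₂₁, Matrix.zero_apply, zero_smul, Finset.sum_const_zero, add_zero]
      exact hz.isOpFamily hΦ hu y
    · simp only [Fintype.sum_sum_type, dsum, Matrix.fromBlocks_apply₁₂, Sum.elim_inl, Sum.elim_inr,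
        Matrix.fromBlocks_apply₂₂, Matrix.zero_apply, zero_smul, Finset.sum_const_zero, zero_add]
      have e1 : (T 1 : F[T;T⁻¹]) • g y • u' - ∑ x, invStar Φ x y • g x • u'
          = (T 1 * g y - ∑ x, invStar Φ x y • g x) • u' := by
        rw [sub_smul, mul_smul, Finset.sum_smul]
        simp only [smul_assoc]
      rw [← sub_eq_zero, e1]
      refine hvan _ fun f => ?_
      rw [← e1, hB.sub_left, hB.sum_left, hB.adjoint, smul_smul, hg, star_T, map_mul,
        ← Matrix.mulVec_mulVec, unitEval_T_neg_one hPu, ← Matrix.nonsing_inv_eq_ringInverse,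
        sub_eq_zero]
      simp only [hB.smul_left, hg, invStar, Matrix.conjTranspose_apply, star_star]
      rfl
  · have hgu : ∀ a b, B (g b • u') (hz.coord a • u) = (1 : Matrix (Fin Φ.1) (Fin Φ.1) F) b a := by
      intro a b
      rw [hg, hz.coord_spec, Pi.single_apply, Matrix.one_apply]
    rintro (x | x) (y | y)
    · simp only [Sum.elim_inl, skewSum, Matrix.fromBlocks_apply₁₁, Matrix.zero_apply]
      rw [hB.adjoint, smul_smul, h1]
    · simp only [Sum.elim_inl, Sum.elim_inr, skewSum, Matrix.fromBlocks_apply₁₂]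
      rw [hB.herm, hgu, Matrix.smul_apply, smul_eq_mul, ← Matrix.conjTranspose_apply,
        Matrix.conjTranspose_one]
    · simp only [Sum.elim_inl, Sum.elim_inr, skewSum, Matrix.fromBlocks_apply₂₁]
      exact hgu y x
    · simp only [Sum.elim_inr, skewSum, Matrix.fromBlocks_apply₂₂, Matrix.zero_apply]
      rw [hB.adjoint, smul_smul, h2]
  · rintro (a | b)
    · exact ⟨hz.coord a, 0, by simp⟩
    · exact ⟨0, g b, by simp⟩

end BlockFamilies

end IsometricPairs
namespace IsometricPairs

open Polynomial LaurentPolynomial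

universe u v

/-! ### Φ-symmetric representatives of symmetric residues. -/

section SymmetricRepresentatives

variable {F : Type u} [Field F] [StarRing F] {p : F[X]}

/-- The monic polynomial p divides p^∨, which is monic of the same degree. -/
theorem vee_eq_self (hm : p.Monic) (hp : Irreducible p) (h0 : p.coeff 0 ≠ 0)
    (hs : Associated (star (toLaurent p)) (toLaurent p)) : vee p = p := by
  have hd : p ∣ vee p := by
    have h1 : toLaurent p ∣ toLaurent (vee p) :=
      ((toLaurent_vee_associated h0).trans hs).symm.dvd
    rwa [← unitEval_root_eq_zero_iff hp h0,
      unitEval_toLaurent (isUnit_root_of_coeff_zero_ne_zero hp h0), AdjoinRoot.aeval_eq,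
      AdjoinRoot.mk_eq_zero] at h1
  have hn : (p.map (starRingEnd F)).natDegree = p.natDegree := natDegree_map _
  have hdeg : (vee p).natDegree ≤ p.natDegree := by
    rw [vee, ← hn]
    exact (natDegree_C_mul_le _ _).trans (reverse_natDegree_le _)
  have hcoeff : (vee p).coeff p.natDegree = 1 := by
    rw [vee, coeff_C_mul, ← hn, coeff_reverse, revAt_le le_rfl, Nat.sub_self, coeff_map]
    exact inv_mul_cancel₀ (star_ne_zero.2 h0)
  have hmv : (vee p).Monic := monic_of_natDegree_le_of_coeff_eq_one _ hdeg hcoeff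
  exact Polynomial.eq_of_monic_of_dvd_of_natDegree_le hm hmv hd hdeg

theorem star_toLaurent_of_vee (h0 : p.coeff 0 ≠ 0) (hv : vee p = p) :
    star (toLaurent p)
      = LaurentPolynomial.C (star (p.coeff 0)) * T (-(p.natDegree : ℤ)) * toLaurent p := by
  have h1 : toLaurent p = LaurentPolynomial.C (star (p.coeff 0))⁻¹ *
      (star (toLaurent p) * T (p.natDegree : ℤ)) := by
    conv_lhs => rw [← hv]
    rw [vee, map_mul, toLaurent_reverse, star_toLaurent, toLaurent_C, natDegree_map]
  have h2 : LaurentPolynomial.C (star (p.coeff 0)) * LaurentPolynomial.C (star (p.coeff 0))⁻¹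
      = 1 := by
    rw [← map_mul, mul_inv_cancel₀ (star_ne_zero.2 h0), map_one]
  have h3 : (T (p.natDegree : ℤ) : F[T;T⁻¹]) * T (-(p.natDegree : ℤ)) = 1 := by
    rw [← T_add]; simp
  conv_rhs => rw [h1]
  linear_combination (-star (toLaurent p)) * h3 -
    star (toLaurent p) * T (p.natDegree : ℤ) * T (-(p.natDegree : ℤ)) * h2

theorem coeff_zero_mul_star (hm : p.Monic) (h0 : p.coeff 0 ≠ 0) (hv : vee p = p) :
    p.coeff 0 * star (p.coeff 0) = 1 := by
  have h1 : p.coeff 0 = (star (p.coeff 0))⁻¹ := by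
    conv_lhs => rw [← hv]
    rw [vee, coeff_C_mul, coeff_zero_reverse, (hm.map _).leadingCoeff, mul_one]
  calc p.coeff 0 * star (p.coeff 0) = (star (p.coeff 0))⁻¹ * star (p.coeff 0) := by rw [← h1]
    _ = 1 := inv_mul_cancel₀ (star_ne_zero.2 h0)

omit [StarRing F] in
theorem coeff_mul_T (q : F[T;T⁻¹]) (r m : ℤ) : (q * T r).coeff m = q.coeff (m - r) := by
  induction q using LaurentPolynomial.induction_on' with
  | add p q hp hq =>
    rw [add_mul, AddMonoidAlgebra.coeff_add, AddMonoidAlgebra.coeff_add, Finsupp.add_apply,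
      Finsupp.add_apply, hp, hq]
  | C_mul_T n a =>
    rw [mul_T_assoc, ← single_eq_C_mul_T, ← single_eq_C_mul_T, AddMonoidAlgebra.coeff_single,
      AddMonoidAlgebra.coeff_single, Finsupp.single_apply, Finsupp.single_apply]
    congr 1
    exact propext ⟨fun h => by omega, fun h => by omega⟩

omit [StarRing F] in
theorem coeff_C_mul (a : F) (q : F[T;T⁻¹]) (m : ℤ) :
    (LaurentPolynomial.C a * q).coeff m = a * q.coeff m := by
  rw [← LaurentPolynomial.smul_eq_C_mul]
  rfl

omit [StarRing F] in
theorem coeff_toLaurent_natCast (f : F[X]) (n : ℕ) : (toLaurent f).coeff n = f.coeff n := by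
  induction f using Polynomial.induction_on' with
  | add p q hp hq =>
    rw [map_add, AddMonoidAlgebra.coeff_add, Finsupp.add_apply, hp, hq, Polynomial.coeff_add]
  | monomial k a =>
    rw [toLaurent_C_mul_T, ← single_eq_C_mul_T, AddMonoidAlgebra.coeff_single,
      Finsupp.single_apply, coeff_monomial]
    simp

omit [StarRing F] in
theorem coeff_toLaurent_of_neg (f : F[X]) {m : ℤ} (hm : m < 0) : (toLaurent f).coeff m = 0 := by
  induction f using Polynomial.induction_on' with
  | add p q hp hq => rw [map_add, AddMonoidAlgebra.coeff_add, Finsupp.add_apply, hp, hq, add_zero]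
  | monomial k a =>
    rw [toLaurent_C_mul_T, ← single_eq_C_mul_T, AddMonoidAlgebra.coeff_single,
      Finsupp.single_apply, if_neg (by omega)]

theorem IsSymmetricForm.star_eq {q : F[T;T⁻¹]} (h : IsSymmetricForm p q) : star q = q := by
  ext n
  rw [coeff_star, h.1, star_star]

/-- The polynomial x^r q has degree at most 2r, so if it is nonzero and divisible by p, then deg p =
2r and x^r q = c p. The extreme coefficients give a_r = c and c̄ = p(0) c, and each of the three
conditions on a_r then forces c = 0. Thus a nonzero symmetric q is a unit modulo p. -/
theorem IsSymmetricForm.eq_zero_of_dvd {q : F[T;T⁻¹]} (h : IsSymmetricForm p q) (hm : p.Monic)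
    (hp : Irreducible p) (h0 : p.coeff 0 ≠ 0) (h2 : (2 : F) ≠ 0) (hd : toLaurent p ∣ q) :
    q = 0 := by
  obtain ⟨hs, hr, hc⟩ := h
  set r := p.natDegree / 2 with hrdef
  set g : F[X] := ∑ i ∈ Finset.range (2 * r + 1), monomial i (q.coeff ((i : ℤ) - r)) with hg
  have hgc : ∀ i : ℕ, g.coeff i = q.coeff ((i : ℤ) - r) := by
    intro i
    rw [hg, finsetSum_coeff]
    simp only [coeff_monomial]
    rw [Finset.sum_ite_eq']
    split_ifs with hi
    · rfl
    · rw [Finset.mem_range] at hi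
      exact (hr _ (by omega)).symm
  have hgq : toLaurent g = q * T r := by
    ext m
    rw [coeff_mul_T]
    rcases lt_or_ge m 0 with hlt | hge
    · rw [coeff_toLaurent_of_neg _ hlt, hr _ (by omega)]
    · lift m to ℕ using hge
      rw [coeff_toLaurent_natCast, hgc]
  have hpg : p ∣ g := by
    have : toLaurent p ∣ toLaurent g := hgq ▸ hd.mul_right _
    rwa [← unitEval_root_eq_zero_iff hp h0,
      unitEval_toLaurent (isUnit_root_of_coeff_zero_ne_zero hp h0), AdjoinRoot.aeval_eq,
      AdjoinRoot.mk_eq_zero] at this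
  have hgdeg : g.natDegree ≤ 2 * r := by
    rw [hg]
    refine natDegree_sum_le_of_forall_le _ _ fun i hi => (natDegree_monomial_le _).trans ?_
    rw [Finset.mem_range] at hi
    omega
  have hg0 : g = 0 := by
    by_contra hne
    have h1 := natDegree_le_of_dvd hpg hne
    have hn : p.natDegree = 2 * r := by omega
    obtain ⟨h, hh⟩ := hpg
    have hh0 : h.natDegree = 0 := by
      have : g.natDegree = p.natDegree + h.natDegree := by
        rw [hh, hm.natDegree_mul' (by rintro rfl; exact hne (by rw [hh, mul_zero]))]
      omega
    obtain ⟨c, rfl⟩ : ∃ c, h = Polynomial.C c := ⟨_, eq_C_of_natDegree_eq_zero hh0⟩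
    have e1 : q.coeff (r : ℤ) = c := by
      have := hgc p.natDegree
      rw [hh, Polynomial.coeff_mul_C, hm.coeff_natDegree, one_mul, hn] at this
      rw [this]
      congr 1
      push_cast
      ring
    have e2 : star c = p.coeff 0 * c := by
      have := hgc 0
      rw [hh, Polynomial.coeff_mul_C] at this
      rw [this, ← e1, ← hs]
      congr 1
      push_cast
      ring
    have hc0 : c = 0 := by
      obtain ⟨c1, c2, c3⟩ := hc hn
      rw [e1] at c1 c2 c3
      rw [← coeff_zero_eq_eval_zero] at c2 c3
      by_cases hid : ∀ a : F, star a = a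
      · exact c1 hid
      · by_cases hp1 : p.coeff 0 = 1
        · have h4 := c3 hid hp1
          rw [hp1, one_mul] at e2
          rw [e2] at h4
          have : 2 * c = 0 := by linear_combination h4
          exact (mul_eq_zero.1 this).resolve_left h2
        · have h4 := c2 hid hp1
          rw [← h4] at e2
          have : (p.coeff 0 - 1) * c = 0 := by linear_combination -e2
          exact (mul_eq_zero.1 this).resolve_left (sub_ne_zero.2 hp1)
    rw [hc0, Polynomial.C_0, mul_zero] at hh
    exact hne hh
  rw [hg0, map_zero] at hgq
  exact (((isUnit_T (R := F) (r : ℤ)).mul_left_eq_zero).1 hgq.symm)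

/-- Reduce x^r h modulo p, shift back by x^(-r) and symmetrize: the exponents now lie between -r and
r. For deg p = 2r the leading coefficient can still be normalized by subtracting a symmetric
multiple c x^(-r) p. -/
theorem exists_isSymmetricForm (hm : p.Monic) (hp : Irreducible p) (h0 : p.coeff 0 ≠ 0)
    (h2 : (2 : F) ≠ 0) (hv : vee p = p) {h : F[T;T⁻¹]} (hh : star h = h) :
    ∃ q, IsSymmetricForm p q ∧ toLaurent p ∣ h - q := by
  have hsp := star_toLaurent_of_vee h0 hv
  have hpp := coeff_zero_mul_star hm h0 hv
  have hdstar : ∀ g, toLaurent p ∣ g → toLaurent p ∣ star g := by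
    intro g hg
    refine Dvd.dvd.trans ?_ (star_dvd_star hg)
    rw [hsp]
    exact dvd_mul_left _ _
  set r := p.natDegree / 2 with hrdef
  have hnpos : 0 < p.natDegree := hp.natDegree_pos
  obtain ⟨f, hf, hfd⟩ : ∃ f : F[X], f.natDegree < p.natDegree ∧
      toLaurent p ∣ h - toLaurent f * T (-(r : ℤ)) := by
    obtain ⟨f0, hf0⟩ := AdjoinRoot.mk_surjective (unitEval (AdjoinRoot.root p) (h * T r))
    refine ⟨f0 %ₘ p, natDegree_modByMonic_lt f0 hm (fun h1 => by simp [h1] at hnpos), ?_⟩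
    have h1 : toLaurent p ∣ h * T r - toLaurent (f0 %ₘ p) := by
      rw [← unitEval_root_eq_zero_iff hp h0, map_sub, sub_eq_zero, ← hf0,
        unitEval_toLaurent (isUnit_root_of_coeff_zero_ne_zero hp h0), AdjoinRoot.aeval_eq,
        AdjoinRoot.mk_eq_mk]
      exact dvd_sub_comm.1 (Polynomial.dvd_modByMonic_sub f0 p)
    refine ((isUnit_T (R := F) (r : ℤ)).dvd_mul_right).1 ?_
    rw [sub_mul, mul_T_assoc, neg_add_cancel, T_zero, mul_one]
    exact h1
  set q₁ := toLaurent f * T (-(r : ℤ)) with hq₁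
  have hq₁c : ∀ m : ℤ, (m < -r ∨ (p.natDegree : ℤ) - r ≤ m) → q₁.coeff m = 0 := by
    intro m hmr
    rw [hq₁, coeff_mul_T, sub_neg_eq_add]
    rcases lt_or_ge (m + r) 0 with hlt | hge
    · exact coeff_toLaurent_of_neg _ hlt
    · obtain ⟨i, hi⟩ := Int.eq_ofNat_of_zero_le hge
      rw [hi, coeff_toLaurent_natCast, coeff_eq_zero_of_natDegree_lt (by omega)]
  set q₀ := LaurentPolynomial.C (2⁻¹ : F) * (q₁ + star q₁) with hq₀
  have hhalf : LaurentPolynomial.C (2⁻¹ : F) * 2 = 1 := half_mul_two h2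
  have hstar_half : star (LaurentPolynomial.C (2⁻¹ : F)) = LaurentPolynomial.C (2⁻¹ : F) :=
    star_half
  have hq₀s : star q₀ = q₀ := by
    rw [hq₀, star_mul_comm, hstar_half, star_add, star_star, add_comm]
  have hq₀d : toLaurent p ∣ h - q₀ := by
    have h1 := hdstar _ hfd
    rw [star_sub, hh] at h1
    have : h - q₀ = LaurentPolynomial.C (2⁻¹ : F) * ((h - q₁) + (h - star q₁)) := by
      rw [hq₀]
      linear_combination (-h) * hhalf
    rw [this]
    exact Dvd.dvd.mul_left (dvd_add hfd h1) _
  have hq₀c : ∀ m : ℤ, r < m.natAbs → q₀.coeff m = 0 := by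
    intro m hmr
    rw [hq₀, coeff_C_mul, AddMonoidAlgebra.coeff_add, Finsupp.add_apply, coeff_star,
      hq₁c m (by omega), hq₁c (-m) (by omega), star_zero, add_zero, mul_zero]
  have hq₀n : ∀ n : ℤ, q₀.coeff (-n) = star (q₀.coeff n) := by
    intro n
    conv_lhs => rw [← hq₀s]
    rw [coeff_star, neg_neg]
  by_cases hn : p.natDegree = 2 * r
  swap
  · exact ⟨q₀, ⟨hq₀n, hq₀c, fun h1 => absurd h1 hn⟩, hq₀d⟩
  set a := q₀.coeff (r : ℤ) with ha
  -- The involution multiplies P by the conjugate of p(0), so c P is symmetric when c̄ times that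
  -- conjugate equals c.
  set P := toLaurent p * T (-(r : ℤ)) with hP
  have hPs : star P = LaurentPolynomial.C (star (p.coeff 0)) * P := by
    rw [hP, star_mul_comm, star_T, hsp, neg_neg, mul_assoc, mul_assoc, ← mul_assoc (T _) _ (T _),
      T_mul, mul_T_assoc, hn]
    congr 3
    push_cast
    ring
  have hPr : P.coeff (r : ℤ) = 1 := by
    rw [hP, coeff_mul_T]
    have : (r : ℤ) - -(r : ℤ) = (p.natDegree : ℕ) := by rw [hn]; push_cast; ring
    rw [this, coeff_toLaurent_natCast, hm.coeff_natDegree]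
  have hPc : ∀ m : ℤ, r < m.natAbs → P.coeff m = 0 := by
    intro m hmr
    rw [hP, coeff_mul_T, sub_neg_eq_add]
    rcases lt_or_ge (m + r) 0 with hlt | hge
    · exact coeff_toLaurent_of_neg _ hlt
    · obtain ⟨i, hi⟩ := Int.eq_ofNat_of_zero_le hge
      rw [hi, coeff_toLaurent_natCast, coeff_eq_zero_of_natDegree_lt (by omega)]
  obtain ⟨c, hc, hc1, hc2, hc3⟩ : ∃ c : F, star c * star (p.coeff 0) = c ∧
      ((∀ a : F, star a = a) → a - c = 0) ∧
      ((¬ ∀ a : F, star a = a) → p.coeff 0 ≠ 1 → a - c = star (a - c)) ∧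
      ((¬ ∀ a : F, star a = a) → p.coeff 0 = 1 → a - c = -star (a - c)) := by
    by_cases hid : ∀ a : F, star a = a
    · refine ⟨a, ?_, fun _ => sub_self a, fun h' => absurd hid h', fun h' => absurd hid h'⟩
      rw [hid, hid]
      rw [hid] at hpp
      have hp1 : p.coeff 0 = 1 := by
        rcases mul_self_eq_one_iff.1 hpp with h1 | h1
        · exact h1
        -- If p(0) = -1 and the involution is trivial, then p = p^∨ gives p(1) = -p(1), so 1 is a
        -- root of the irreducible p, whose degree would be 1 rather than 2r.
        · exfalso
          have hmap : p.map (starRingEnd F) = p := by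
            ext i; rw [coeff_map]; exact hid _
          have h3 : p.eval 1 = (-1) * p.eval 1 := by
            let _ : Invertible (1 : F) := invertibleOne
            conv_lhs => rw [← hv]
            have h4 := Polynomial.eval₂_reverse_mul_pow (RingHom.id F) 1 p
            rw [invOf_one, one_pow, mul_one] at h4
            rw [vee, hmap, hid, h1, inv_neg_one, eval_mul, eval_C]
            exact congrArg _ h4
          have h5 : p.IsRoot 1 := by
            have : 2 * p.eval 1 = 0 := by linear_combination h3
            exact (mul_eq_zero.1 this).resolve_left h2
          have h6 : p.natDegree = 1 := natDegree_eq_of_degree_eq_some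
            (Polynomial.degree_eq_one_of_irreducible_of_root hp h5)
          omega
      rw [hp1, mul_one]
    · by_cases hp1 : p.coeff 0 = 1
      -- Removing the self-conjugate part of a leaves its skew part.
      · refine ⟨2⁻¹ * (a + star a), ?_, fun h' => absurd h' hid, fun _ h' => absurd hp1 h',
          fun _ _ => ?_⟩
        · rw [hp1, star_one, mul_one, star_mul', star_add, star_star, star_inv₀, star_ofNat,
            add_comm]
        · rw [star_sub, star_mul', star_add, star_star, star_inv₀, star_ofNat]
          field_simp
          ring
      -- Symmetry of c P means c̄ = p(0) c; then a - c is self-conjugate exactly when c (1 - p(0)) =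
      -- a - ā, and this determines c.
      · have h3 : 1 - p.coeff 0 ≠ 0 := sub_ne_zero.2 (Ne.symm hp1)
        have h4 : star (1 - p.coeff 0) ≠ 0 := star_ne_zero.2 h3
        have h5 : star (p.coeff 0) * (1 - p.coeff 0) = - star (1 - p.coeff 0) := by
          rw [star_sub, star_one]
          linear_combination -hpp
        have hcc : star ((a - star a) * (1 - p.coeff 0)⁻¹) * star (p.coeff 0)
            = (a - star a) * (1 - p.coeff 0)⁻¹ := by
          rw [star_mul', star_inv₀, star_sub, star_star]
          field_simp
          linear_combination (star a - a) * h5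
        refine ⟨(a - star a) * (1 - p.coeff 0)⁻¹, hcc, fun h' => absurd h' hid, fun _ _ => ?_,
          fun _ h' => absurd h' hp1⟩
        set c := (a - star a) * (1 - p.coeff 0)⁻¹ with hcdef
        have h6 : c * (1 - p.coeff 0) = a - star a := by
          rw [hcdef, mul_assoc, inv_mul_cancel₀ h3, mul_one]
        have h7 : star c = c * p.coeff 0 := by
          linear_combination p.coeff 0 * hcc - star c * hpp
        rw [star_sub, h7]
        linear_combination -h6
  have hqc : ∀ m, (q₀ - LaurentPolynomial.C c * P).coeff m = q₀.coeff m - c * P.coeff m := by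
    intro m
    rw [AddMonoidAlgebra.coeff_sub, Finsupp.sub_apply, coeff_C_mul c P m]
  have hqr : (q₀ - LaurentPolynomial.C c * P).coeff (r : ℤ) = a - c := by
    rw [hqc, hPr, mul_one]
  refine ⟨q₀ - LaurentPolynomial.C c * P, ⟨?_, ?_, fun _ => ?_⟩, ?_⟩
  · have hs : star (q₀ - LaurentPolynomial.C c * P) = q₀ - LaurentPolynomial.C c * P := by
      rw [star_sub, hq₀s, star_mul_comm, star_C, hPs, ← mul_assoc, ← map_mul, hc]
    intro n
    conv_lhs => rw [← hs]
    rw [coeff_star, neg_neg]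
  · intro m hmr
    rw [hqc, hq₀c m hmr, hPc m hmr, mul_zero, sub_zero]
  · rw [hqr, ← coeff_zero_eq_eval_zero]
    exact ⟨hc1, hc2, hc3⟩
  · rw [sub_sub_eq_add_sub, add_sub_right_comm]
    refine dvd_add hq₀d ?_
    rw [hP]
    exact Dvd.dvd.mul_left (dvd_mul_right _ _) _

end SymmetricRepresentatives

/-! ### Lifting congruences of Hermitian matrices modulo powers of a prime. -/

section HermitianLifting

variable {F : Type u} [Field F] [StarRing F]
variable {I J : Type*} [Fintype I] [DecidableEq I] [Fintype J] [DecidableEq J]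

omit [DecidableEq I] in
/-- A congruence of Hermitian matrices modulo a prime lifts modulo each power of the prime. -/
theorem exists_congruence_lift (h2 : (2 : F) ≠ 0) {p : F[T;T⁻¹]} (hp : p ∣ star p) (k : ℕ)
    {Q : Matrix I I F[T;T⁻¹]} {Q' R : Matrix J J F[T;T⁻¹]} (hQ : Q.conjTranspose = Q)
    (hQ' : Q'.conjTranspose = Q') (hR : ∃ Z, Q' * R = 1 + p ^ (k + 1) • Z)
    {H₀ : Matrix I J F[T;T⁻¹]} (h₀ : ∃ Z, H₀.conjTranspose * Q * H₀ = Q' + p • Z) (j : ℕ)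
    (hj : j ≤ k) :
    ∃ (H : Matrix I J F[T;T⁻¹]) (Z : Matrix J J F[T;T⁻¹]),
      H.conjTranspose * Q * H = Q' + p ^ (j + 1) • Z := by
  induction j with
  | zero =>
    obtain ⟨Z, hZ⟩ := h₀
    exact ⟨H₀, Z, by rw [zero_add, pow_one, hZ]⟩
  | succ j ih =>
    obtain ⟨H, Z, hZ⟩ := ih (by omega)
    obtain ⟨Z', hZ'⟩ := hR
    obtain ⟨s, hs⟩ := hp
    set η : F[T;T⁻¹] := algebraMap F F[T;T⁻¹] 2⁻¹ with hη
    have hη2 : η * 2 = 1 := half_mul_two h2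
    have hηs : star η = η := star_half
    set X := H.conjTranspose * Q * H with hX
    have hXs : X.conjTranspose = X := by
      rw [hX, Matrix.conjTranspose_mul, Matrix.conjTranspose_mul, hQ,
        Matrix.conjTranspose_conjTranspose, Matrix.mul_assoc]
    have hΔs : (Q' - X).conjTranspose = Q' - X := by
      rw [Matrix.conjTranspose_sub, hQ', hXs]
    have hΔ : Q' - X = p ^ (j + 1) • (-Z) := by rw [hZ, smul_neg]; abel
    obtain ⟨i, rfl⟩ : ∃ i, k = j + 1 + i := ⟨k - (j + 1), by omega⟩
    -- Newton's step replaces H by H (1 + Y/2), where Y = R (Q' - X) and R inverts Q' modulo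
    -- p^(k+1). As X and Q' agree modulo p^(j+1), both X Y and Y* X equal the error Q' - X modulo
    -- p^(j+2), so their halves add up to the error; the quadratic term is divisible by p^(2j+2).
    have hXY : ∃ W, X * (R * (Q' - X)) = (Q' - X) + p ^ (j + 2) • W := by
      refine ⟨p ^ i • (Z' * (Q' - X)) - p ^ j • (Z * R * Z), ?_⟩
      have e1 : X * (R * (Q' - X)) = Q' * R * (Q' - X) - (Q' - X) * (R * (Q' - X)) := by
        rw [Matrix.mul_assoc Q', ← Matrix.sub_mul, sub_sub_cancel]
      rw [e1, hZ', Matrix.add_mul, Matrix.one_mul, smul_sub, smul_smul, smul_smul, ← pow_add, ← pow_add,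
        show (Q' - X) * (R * (Q' - X)) = p ^ (j + 2 + j) • (Z * R * Z) by
          rw [hΔ, Matrix.smul_mul, Matrix.mul_smul, Matrix.mul_smul, smul_smul, ← pow_add,
            Matrix.mul_neg, Matrix.neg_mul, Matrix.mul_neg, neg_neg, Matrix.mul_assoc,
            show j + 1 + (j + 1) = j + 2 + j by ring],
        Matrix.smul_mul, show j + 1 + i + 1 = j + 2 + i by ring]
      abel
    obtain ⟨W, hW⟩ := hXY
    have hYX : (R * (Q' - X)).conjTranspose * X
        = (Q' - X) + p ^ (j + 2) • (s ^ (j + 2) • W.conjTranspose) := by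
      have := congrArg Matrix.conjTranspose hW
      rw [Matrix.conjTranspose_mul, hXs, Matrix.conjTranspose_add, hΔs,
        Matrix.conjTranspose_smul, star_pow, hs, mul_pow, mul_smul] at this
      exact this
    set Y := R * (Q' - X) with hY
    have hYXY : Y.conjTranspose * (X * Y)
        = p ^ (j + 2) • (p ^ j • ((-Z) * R.conjTranspose * (X * (R * (-Z))))) := by
      have e1 : Y = p ^ (j + 1) • (R * (-Z)) := by rw [hY, hΔ, Matrix.mul_smul]
      have e2 : Y.conjTranspose = p ^ (j + 1) • ((-Z) * R.conjTranspose) := by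
        rw [hY, Matrix.conjTranspose_mul, hΔs, hΔ, Matrix.smul_mul]
      rw [e2]
      conv_lhs => rw [e1]
      rw [Matrix.mul_smul, Matrix.mul_smul, Matrix.smul_mul, smul_smul, smul_smul, ← pow_add,
        ← pow_add, show j + 1 + (j + 1) = j + 2 + j by ring]
    refine ⟨H * (1 + η • Y), η • W + η • s ^ (j + 2) • W.conjTranspose
      + (η * η) • (p ^ j • ((-Z) * R.conjTranspose * (X * (R * (-Z))))), ?_⟩
    have e3 : (H * (1 + η • Y)).conjTranspose * Q * (H * (1 + η • Y))
        = X + η • (X * Y) + η • (Y.conjTranspose * X)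
          + (η * η) • (Y.conjTranspose * (X * Y)) := by
      rw [Matrix.conjTranspose_mul, Matrix.conjTranspose_add, Matrix.conjTranspose_one,
        Matrix.conjTranspose_smul, hηs]
      have : (1 + η • Y.conjTranspose) * H.conjTranspose * Q * (H * (1 + η • Y))
          = (1 + η • Y.conjTranspose) * (X * (1 + η • Y)) := by
        rw [hX]
        simp only [Matrix.mul_assoc]
      rw [this, Matrix.mul_add, Matrix.mul_one, Matrix.add_mul, Matrix.one_mul, Matrix.mul_smul,
        Matrix.mul_add, Matrix.smul_mul, Matrix.smul_mul, Matrix.mul_smul, smul_smul]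
      abel
    rw [e3, hYXY, hW, hYX]
    have e4 : η • (Q' - X) + η • (Q' - X) = Q' - X := by
      rw [← add_smul, ← mul_two, hη2, one_smul]
    have e5 : X + η • (Q' - X) + η • (Q' - X) = Q' := by
      rw [add_assoc, e4, add_sub_cancel]
    rw [show j + 1 + 1 = j + 2 by ring]
    generalize (-Z) * R.conjTranspose * (X * (R * (-Z))) = U at *
    calc _ = (X + η • (Q' - X) + η • (Q' - X))
          + p ^ (j + 2) • (η • W + η • s ^ (j + 2) • W.conjTranspose + (η * η) • p ^ j • U) := by
            module
      _ = _ := by rw [e5]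

end HermitianLifting

end IsometricPairs
namespace IsometricPairs

open Polynomial LaurentPolynomial

universe u v

/-! ### Nondegeneracy of functionals modulo prime powers. -/

section Functionals

variable {F : Type u} [Field F]

/-- Modulo the largest ideal in the kernel of φ, the class of 1 is killed by p^(k+1) but not by p^k.
-/
theorem pow_dvd_iff_functional {p : F[T;T⁻¹]} (hp : Prime p) {k : ℕ} {φ : F[T;T⁻¹] →ₗ[F] F}
    (h1 : ∀ f, φ (p ^ (k + 1) * f) = 0) (h2 : ∃ f, φ (p ^ k * f) ≠ 0) (h : F[T;T⁻¹]) :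
    p ^ (k + 1) ∣ h ↔ ∀ f, φ (h * f) = 0 := by
  let J : Ideal F[T;T⁻¹] :=
    { carrier := {h | ∀ f, φ (h * f) = 0}
      add_mem' := fun {a b} ha hb f => by rw [add_mul, map_add, ha, hb, add_zero]
      zero_mem' := fun f => by rw [zero_mul, map_zero]
      smul_mem' := fun c a ha f => by
        rw [smul_eq_mul, show c * a * f = a * (c * f) by ring]; exact ha _ }
  have hJ : ∀ g : F[T;T⁻¹], g • (Ideal.Quotient.mk J 1) = 0 ↔ ∀ f, φ (g * f) = 0 := by
    intro g
    rw [← Ideal.Quotient.mk_eq_mk, ← Submodule.Quotient.mk_smul, Submodule.Quotient.mk_eq_zero,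
      smul_eq_mul, mul_one]
    rfl
  rw [← hJ, smul_eq_zero_iff_dvd hp ((hJ _).2 h1)]
  rw [Ne, hJ]
  push Not
  exact h2

variable [StarRing F]

theorem IsEpsFunctional.associated_star_of_pow {ε : F} {p : F[T;T⁻¹]} (hp : Prime p) {k : ℕ}
    {φ : F[T;T⁻¹] →ₗ[F] F} (h : IsEpsFunctional ε (p ^ (k + 1)) φ) : Associated p (star p) := by
  have h1 : p ∣ star p := by
    refine hp.dvd_of_dvd_pow (n := k + 1) ?_
    rw [← star_pow]
    exact (dvd_pow_self p k.succ_ne_zero).trans h.dvd_star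
  exact associated_of_dvd_dvd h1 (by simpa using star_dvd_star h1)

omit [StarRing F] in
theorem half_add_half (h2 : (2 : F) ≠ 0) (a : F) : 2⁻¹ * a + 2⁻¹ * a = a := by
  field_simp
  ring

end Functionals

/-! ### Splitting off one block. -/

section Blocks

variable {F : Type u} [Field F] [StarRing F] {ε : F}
variable {V : Type v} [AddCommGroup V] [Module F V] [Module F[T;T⁻¹] V]
  [IsScalarTower F F[T;T⁻¹] V] {B : V → V → F}

/-- Any u pairing nontrivially with p^k x can be replaced by its image under the adjoint of the
projection b s onto the p-primary part. This does not change the pairing with p^k x, and the new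
vector is killed by the conjugate of p^(k+1). -/
theorem IsoForm.exists_pairing [FiniteDimensional F V] [Nontrivial V] (hB : IsoForm ε B)
    (hε : ε * star ε = 1) :
    ∃ (p : F[T;T⁻¹]) (k : ℕ) (x y : V), Prime p ∧ p ^ (k + 1) • x = 0 ∧
      star (p ^ (k + 1)) • y = 0 ∧ B y (p ^ k • x) ≠ 0 := by
  obtain ⟨p, s, k, x, hp, hps, ⟨a, b, hab⟩, h1, h2⟩ := exists_primary_vector (F := F) V
  obtain ⟨u, hu⟩ := hB.exists_ne_zero hε h2
  have hbx : p ^ k • x = (b * s) • p ^ k • x := by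
    have h3 : (a * p ^ (k + 1)) • p ^ k • x = 0 := by
      rw [smul_smul, show a * p ^ (k + 1) * p ^ k = a * p ^ k * p ^ (k + 1) by ring, mul_smul, h1,
        smul_zero]
    rw [← zero_add ((b * s) • _), ← h3, ← add_smul, hab, one_smul]
  refine ⟨p, k, x, star (b * s) • u, hp, h1, ?_, ?_⟩
  · refine hB.nondeg _ fun v => ?_
    rw [hB.adjoint, star_star, hB.adjoint, star_star, smul_smul,
      show b * s * p ^ (k + 1) = b * (p ^ (k + 1) * s) by ring, mul_smul, hps, smul_zero,
      hB.zero_right]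
  · rwa [hB.adjoint, star_star, ← hbx]

theorem IsoForm.dvd_of_pairing (hB : IsoForm ε B) {p : F[T;T⁻¹]} (hp : Prime p) {k : ℕ}
    {x y : V} (h1 : p ^ (k + 1) • x = 0) (h2 : ∃ f, B y ((p ^ k * f) • x) ≠ 0) (h : F[T;T⁻¹]) :
    p ^ (k + 1) ∣ h ↔ ∀ f, hB.functional y x (h * f) = 0 := by
  refine pow_dvd_iff_functional hp (fun f => ?_) h2 h
  rw [functional_apply, mul_comm, mul_smul, h1, smul_zero, hB.zero_right]

omit [IsScalarTower F F[T;T⁻¹] V] in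
theorem IsoForm.smul_eq_zero_of_pairing (hB : IsoForm ε B) {p : F[T;T⁻¹]} (hp : Prime p) {k : ℕ}
    {x y : V} (h1 : p ^ (k + 1) • x = 0) (h2 : ∃ f, B y ((p ^ k * f) • x) ≠ 0) (f : F[T;T⁻¹]) :
    f • x = 0 ↔ p ^ (k + 1) ∣ f := by
  refine smul_eq_zero_iff_dvd hp h1 (fun h => ?_) f
  obtain ⟨f, hf⟩ := h2
  rw [mul_comm, mul_smul, h, smul_zero, hB.zero_right] at hf
  exact hf rfl

theorem IsoForm.self_herm (hB : IsoForm ε B) (u : V) (f : F[T;T⁻¹]) :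
    hB.functional u u f = ε * star (hB.functional u u (star f)) := by
  rw [functional_apply, functional_apply, hB.herm, hB.adjoint]

/-- The block that corresponds to a cyclic vector on which the form does not degenerate. -/
theorem IsoForm.exists_snd [FiniteDimensional F V] (hB : IsoForm ε B) (h2 : (2 : F) ≠ 0)
    {Φ : SqMat F} (hΦ : IsUnit Φ.2.det) (hi : Indecomposable Φ) {k : ℕ} {z : Fin Φ.1 → F}
    (hz : IsCyclicVector Φ.2 (toLaurent (irreducibleDivisor Φ) ^ (k + 1)) z)
    {M : Matrix (Fin Φ.1) (Fin Φ.1) F} (hM : IsEpsMatrix ε Φ M) {u : V}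
    (h1 : toLaurent (irreducibleDivisor Φ) ^ (k + 1) • u = 0)
    (hu : ∃ f : F[T;T⁻¹], B u ((toLaurent (irreducibleDivisor Φ) ^ k * f) • u) ≠ 0) :
    ∃ q, q ≠ 0 ∧ IsSymmetricForm (irreducibleDivisor Φ) q ∧ ∃ f : Fin Φ.1 → V,
      IsOpFamily Φ.2 f ∧ ∀ x y, B (f x) (f y) = (M * laurentValue q Φ.2 : Matrix _ _ F) x y := by
  obtain ⟨hm, hp, -⟩ := irreducibleDivisor_spec Φ hi.1
  have h0 := irreducibleDivisor_coeff_zero_ne_zero hi hΦ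
  have hP := prime_toLaurent hp h0
  set P := toLaurent (irreducibleDivisor Φ) with hPdef
  have hE := hz.isEpsFunctional hΦ hM
  set φ := gramFunctional M Φ.2 z with hφ
  have hPs := hE.associated_star_of_pow hP
  have hv := vee_eq_self hm hp h0 hPs.symm
  have hnd : ∀ h, P ^ (k + 1) ∣ h ↔ ∀ f, hB.functional u u (h * f) = 0 :=
    pow_dvd_iff_functional hP (fun f => by
      rw [functional_apply, mul_comm, mul_smul, h1, smul_zero, hB.zero_right]) hu
  have hx : ∀ f : F[T;T⁻¹], f • u = 0 ↔ P ^ (k + 1) ∣ f := hB.smul_eq_zero_of_pairing hP h1 hu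
  obtain ⟨h, hh⟩ := exists_functional_eq_mul hx φ (hB.functional u u) hE.nondeg
    fun f => (hnd _).1 dvd_rfl f
  have hh' : ∀ f, hB.functional u u f = φ (star h * f) := by
    intro f
    rw [hB.self_herm, hh, hE.herm, star_mul_comm, star_star, star_mul', star_star, ← mul_assoc]
    -- Applying the Hermitian symmetry of φ twice.
    have hε : ∀ r, (ε * star ε) * φ r = φ r := by
      intro r
      conv_rhs => rw [hE.herm, hE.herm]
      rw [star_star, star_mul', star_star, mul_assoc]
    rw [hε]
  -- Both h and its conjugate represent the functional of u, hence so does their symmetric mean.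
  set h' := algebraMap F F[T;T⁻¹] 2⁻¹ * (h + star h) with hh'def
  have hh's : star h' = h' := by
    rw [hh'def, star_mul_comm, star_half, star_add, star_star, add_comm]
  have hφh : ∀ f, hB.functional u u f = φ (h' * f) := by
    intro f
    rw [hh'def, ← half_add_half h2 (hB.functional u u f)]
    conv_lhs => enter [1]; rw [hh]
    rw [hh', ← mul_add, ← map_add, ← smul_eq_mul, ← map_smul, Algebra.smul_def, ← add_mul,
      mul_assoc]
  have hnh : ¬ P ∣ h' := by
    rintro ⟨r, hr⟩
    obtain ⟨f, hf⟩ := hu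
    apply hf
    rw [← functional_apply (h := hB), hφh, hr]
    exact (by ring : P ^ (k + 1) * (r * f) = P * r * (P ^ k * f)) ▸ (hE.nondeg _).1 dvd_rfl (r * f)
  obtain ⟨q, hq, hqd⟩ := exists_isSymmetricForm hm hp h0 h2 hv hh's
  have hnq : ¬ P ∣ q := fun hd => hnh (by simpa using dvd_add hqd hd)
  obtain ⟨a, b, hab⟩ := isCoprime_pow_of_not_dvd hP hnq (k + 1)
  obtain ⟨r, hr⟩ := hqd
  -- The lifting for matrices of size 1, starting from 1 since h' and q agree modulo P. The entry g
  -- of the result satisfies g* h' g ≡ q modulo P^(k+1), and g u is the new generator.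
  obtain ⟨H, Z, hHZ⟩ := exists_congruence_lift (I := Unit) (J := Unit) h2 hPs.dvd k
    (Q := Matrix.of fun _ _ => h') (Q' := Matrix.of fun _ _ => q) (R := Matrix.of fun _ _ => b)
    (by ext; simp [hh's]) (by ext; simp [hq.star_eq])
    ⟨Matrix.of fun _ _ => -a, by
      refine Matrix.ext fun _ _ => ?_
      simp only [Matrix.mul_apply, Matrix.of_apply, Finset.univ_unique, Finset.sum_const,
        Finset.card_singleton, one_smul, Matrix.add_apply, Matrix.one_apply_eq, Matrix.smul_apply,
        smul_eq_mul]
      linear_combination hab⟩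
    (H₀ := 1) ⟨Matrix.of fun _ _ => r, by
      refine Matrix.ext fun _ _ => ?_
      simp only [Matrix.conjTranspose_one, Matrix.one_mul, Matrix.mul_one, Matrix.of_apply,
        Matrix.add_apply, Matrix.smul_apply, smul_eq_mul]
      linear_combination hr⟩ k le_rfl
  have hH := congrFun (congrFun hHZ ()) ()
  simp only [Matrix.mul_apply, Matrix.of_apply, Finset.univ_unique, Finset.sum_singleton,
    PUnit.default_eq_unit, Matrix.add_apply, Matrix.smul_apply, smul_eq_mul,
    Matrix.conjTranspose_apply] at hH
  set g := H () ()
  refine ⟨q, ?_, hq, fun i => hz.coord i • g • u, hz.isOpFamily hΦ ?_, hB.gram_snd hΦ hz hM ?_⟩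
  · rintro rfl; exact hnq (dvd_zero _)
  · rw [smul_comm, h1, smul_zero]
  · intro f
    rw [hB.adjoint, smul_smul, smul_smul, ← functional_apply (h := hB), hφh]
    refine hE.apply_eq_of_dvd ⟨Z () () * f, ?_⟩
    linear_combination f * hH

theorem IsoForm.functional_add_smul (hB : IsoForm ε B) (u v : V) (g f : F[T;T⁻¹]) :
    hB.functional (u + g • v) (u + g • v) f = hB.functional u u f
      + (hB.functional v u (star g * f) + ε * star (hB.functional v u (star g * star f)))
      + hB.functional v v (star g * g * f) := by
  have e1 : B u (f • g • v) = ε * star (B v ((star g * star f) • u)) := by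
    rw [hB.herm, smul_smul, hB.adjoint, star_mul_comm, mul_comm (star f)]
  have e2 : B (g • v) (f • u) = B v ((star g * f) • u) := by rw [hB.adjoint, smul_smul]
  have e3 : B (g • v) (f • g • v) = B v ((star g * g * f) • v) := by
    rw [hB.adjoint, smul_smul, smul_smul, mul_assoc, mul_comm f, ← mul_assoc]
  simp only [functional_apply, smul_add, hB.add_right, hB.add_left, e1, e2, e3]
  ring

/-- Correcting `x` by a multiple of `y` removes the form on `x`, up to the form on `y`. -/
theorem IsoForm.exists_correction [FiniteDimensional F V] (hB : IsoForm ε B) (h2 : (2 : F) ≠ 0)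
    {p : F[T;T⁻¹]} (hp : Prime p) {k : ℕ} {x y : V} (h1 : p ^ (k + 1) • x = 0)
    (hxy : ∃ f, B y ((p ^ k * f) • x) ≠ 0) :
    ∃ g, (∀ f, hB.functional x x f = hB.functional y x (g * f)) ∧
      ∀ f, hB.functional (x + (algebraMap F F[T;T⁻¹] (-2⁻¹) * star g) • y)
          (x + (algebraMap F F[T;T⁻¹] (-2⁻¹) * star g) • y) f
        = hB.functional y y (algebraMap F F[T;T⁻¹] (2⁻¹ * 2⁻¹) * (g * star g) * f) := by
  have hnd := hB.dvd_of_pairing hp h1 hxy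
  have hx : ∀ f : F[T;T⁻¹], f • x = 0 ↔ p ^ (k + 1) ∣ f :=
    hB.smul_eq_zero_of_pairing hp h1 hxy
  obtain ⟨g, hg⟩ := exists_functional_eq_mul hx (hB.functional y x) (hB.functional x x) hnd
    fun f => by rw [functional_apply, mul_comm, mul_smul, h1, smul_zero, hB.zero_right]
  refine ⟨g, hg, fun f => ?_⟩
  have hs : star (algebraMap F F[T;T⁻¹] (-2⁻¹)) = algebraMap F F[T;T⁻¹] (-2⁻¹) := by
    rw [map_neg, star_neg, star_half]
  have hm : ∀ r, hB.functional y x (algebraMap F F[T;T⁻¹] (-2⁻¹) * r)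
      = -2⁻¹ * hB.functional y x r := fun r => by
    rw [← Algebra.smul_def, map_smul, smul_eq_mul]
  have hs2 : star (-2⁻¹ : F) = -2⁻¹ := by rw [star_neg, star_inv₀, star_ofNat]
  -- Each of the two cross terms equals -B(x, f x)/2, the second by Hermitian symmetry; together
  -- they cancel the form on x and leave the term quadratic in g.
  rw [hB.functional_add_smul, star_mul_comm, star_star, hs, mul_assoc, mul_assoc, hm, hm, ← hg,
    ← hg, star_mul', hs2, ← mul_assoc ε, mul_comm ε, mul_assoc, ← hB.self_herm]
  have e1 : algebraMap F F[T;T⁻¹] (-2⁻¹) * g * (algebraMap F F[T;T⁻¹] (-2⁻¹) * star g) * f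
      = algebraMap F F[T;T⁻¹] (2⁻¹ * 2⁻¹) * (g * star g) * f := by
    rw [map_mul, map_neg]; ring
  rw [← e1]
  have := half_add_half h2 (hB.functional x x f)
  linear_combination -this

/-- If the form degenerates on all cyclic submodules of maximal order, they occur in hyperbolic
pairs. -/
theorem IsoForm.exists_hyperbolic [FiniteDimensional F V] (hB : IsoForm ε B) (h2 : (2 : F) ≠ 0)
    {p : F[T;T⁻¹]} (hp : Prime p) (hps : Associated p (star p)) {k : ℕ} {x y : V}
    (hx : p ^ (k + 1) • x = 0) (hy : p ^ (k + 1) • y = 0) (hxy : ∃ f, B y ((p ^ k * f) • x) ≠ 0)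
    (hall : ∀ u : V, p ^ (k + 1) • u = 0 → ∀ f : F[T;T⁻¹], B u ((p ^ k * f) • u) = 0) :
    ∃ x' y' : V, p ^ (k + 1) • x' = 0 ∧ p ^ (k + 1) • y' = 0 ∧
      (∃ f, B y' ((p ^ k * f) • x') ≠ 0) ∧
      (∀ f : F[T;T⁻¹], B x' (f • x') = 0) ∧ (∀ f : F[T;T⁻¹], B y' (f • y') = 0) := by
  have hpow : ∀ {i h}, p ^ i ∣ h → p ^ i ∣ star h := fun {i h} hd =>
    (hps.pow_pow.dvd).trans (by rw [← star_pow]; exact star_dvd_star hd)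
  have hadd : ∀ u v : V, ∀ g : F[T;T⁻¹], p ^ (k + 1) • u = 0 → p ^ (k + 1) • v = 0 →
      p ^ (k + 1) • (u + g • v) = 0 := fun u v g hu hv => by
    rw [smul_add, hu, smul_comm, hv, smul_zero, add_zero]
  have hdvd : ∀ u : V, p ^ (k + 1) • u = 0 → ∀ f : F[T;T⁻¹], p ^ k ∣ f → B u (f • u) = 0 := by
    rintro u hu f ⟨r, rfl⟩
    exact hall u hu r
  -- Each correction lowers by one the power of p on which the form of x' is known to vanish. If it
  -- vanishes on multiples of p^(k+1-j), then p^j divides g; the corrected form at p^(k-j) f is the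
  -- form of y at a multiple of p^j p^(k-j) = p^k, where it vanishes by assumption.
  have hstep : ∀ j ≤ k + 1, ∃ x' : V, p ^ (k + 1) • x' = 0 ∧ (∃ f, B y ((p ^ k * f) • x') ≠ 0) ∧
      ∀ f : F[T;T⁻¹], B x' ((p ^ (k + 1 - j) * f) • x') = 0 := by
    intro j
    induction j with
    | zero =>
      exact fun _ => ⟨x, hx, hxy, fun f => by
        rw [Nat.sub_zero, mul_comm, mul_smul, hx, smul_zero, hB.zero_right]⟩
    | succ j ih =>
      intro hj
      obtain ⟨x', h3, h4, h5⟩ := ih (by omega)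
      obtain ⟨g, hg, hc⟩ := hB.exists_correction h2 hp h3 h4
      refine ⟨x' + (algebraMap F F[T;T⁻¹] (-2⁻¹) * star g) • y, hadd x' y _ h3 hy, ?_, fun f => ?_⟩
      · obtain ⟨f, hf⟩ := h4
        refine ⟨f, ?_⟩
        rwa [smul_add, hB.add_right, smul_smul, mul_assoc, hall y hy, add_zero]
      · rw [← functional_apply (h := hB), hc]
        refine hdvd y hy _ ?_
        have hgd : p ^ j ∣ g := by
          have : p ^ (k + 1) ∣ p ^ (k + 1 - j) * g := by
            rw [hB.dvd_of_pairing hp h3 h4]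
            intro f
            rw [mul_right_comm, mul_comm, ← hg]
            exact h5 f
          rw [show k + 1 = (k + 1 - j) + j by omega, pow_add,
            show k + 1 - j + j - j = k + 1 - j by omega] at this
          exact (mul_dvd_mul_iff_left (pow_ne_zero _ hp.ne_zero)).1 this
        have h6 : p ^ (j + (k + 1 - (j + 1))) ∣ g * p ^ (k + 1 - (j + 1)) := by
          rw [pow_add]; exact mul_dvd_mul_right hgd _
        rw [show j + (k + 1 - (j + 1)) = k by omega] at h6
        exact h6.trans ⟨algebraMap F F[T;T⁻¹] (2⁻¹ * 2⁻¹) * star g * f, by ring⟩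
  obtain ⟨x', h3, h4, h5⟩ := hstep (k + 1) le_rfl
  simp only [Nat.sub_self, pow_zero, one_mul] at h5
  have h4' : ∃ f, B x' ((p ^ k * f) • y) ≠ 0 := by
    obtain ⟨f, hf⟩ := h4
    obtain ⟨s, hs⟩ := hpow (i := k) (h := p ^ k) dvd_rfl
    refine ⟨s * star f, fun h6 => hf ?_⟩
    rw [hB.herm, hB.adjoint, star_mul_comm, hs, mul_assoc, h6, star_zero, mul_zero]
  -- With x' already isotropic, one correction of y suffices: what remains is the form on x'.
  obtain ⟨g, hg, hc⟩ := hB.exists_correction h2 hp hy h4'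
  refine ⟨x', y + (algebraMap F F[T;T⁻¹] (-2⁻¹) * star g) • x', h3, hadd y x' _ hy h3, ?_, h5, fun f => ?_⟩
  · obtain ⟨f, hf⟩ := h4
    refine ⟨f, ?_⟩
    rwa [hB.add_left, hB.adjoint, smul_smul, h5, add_zero]
  · rw [← functional_apply (h := hB), hc]
    exact h5 _

/-- If φ were ε-Hermitian and nondegenerate, some multiple y' of y would satisfy B(y', f x) = φ(f).
The vector u = x + y' would then have B(u, f u) = 2 φ(f), which is not zero on all multiples of p^k.
-/
theorem IsoForm.not_isEpsFunctional_of_hyperbolic [FiniteDimensional F V] (hB : IsoForm ε B)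
    (h2 : (2 : F) ≠ 0) {p : F[T;T⁻¹]} (hp : Prime p) {k : ℕ} {x y : V}
    (hx : p ^ (k + 1) • x = 0) (hy : p ^ (k + 1) • y = 0) (hxy : ∃ f, B y ((p ^ k * f) • x) ≠ 0)
    (h1 : ∀ f : F[T;T⁻¹], B x (f • x) = 0) (h1' : ∀ f : F[T;T⁻¹], B y (f • y) = 0)
    (hall : ∀ u : V, p ^ (k + 1) • u = 0 → ∀ f : F[T;T⁻¹], B u ((p ^ k * f) • u) = 0)
    (φ : F[T;T⁻¹] →ₗ[F] F) : ¬ IsEpsFunctional ε (p ^ (k + 1)) φ := by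
  intro hE
  have hxx : ∀ f : F[T;T⁻¹], f • x = 0 ↔ p ^ (k + 1) ∣ f :=
    hB.smul_eq_zero_of_pairing hp hx hxy
  obtain ⟨h, hh⟩ := exists_functional_eq_mul hxx φ (hB.functional y x) hE.nondeg
    fun f => (hB.dvd_of_pairing hp hx hxy _).1 dvd_rfl f
  have hnh : ¬ p ∣ h := by
    rintro ⟨r, rfl⟩
    obtain ⟨f, hf⟩ := hxy
    apply hf
    rw [← functional_apply (h := hB), hh]
    exact (by ring : p ^ (k + 1) * (r * f) = p * r * (p ^ k * f)) ▸ (hE.nondeg _).1 dvd_rfl (r * f)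
  obtain ⟨a, g, hag⟩ := isCoprime_pow_of_not_dvd hp hnh (k + 1)
  have hφ : ∀ f, hB.functional y x (g * f) = φ f := by
    intro f
    rw [hh]
    exact hE.apply_eq_of_dvd ⟨-a * f, by linear_combination f * hag⟩
  have key : ∀ f, hB.functional (x + star g • y) (x + star g • y) f = 2 * φ f := by
    intro f
    rw [hB.functional_add_smul, star_star, hφ, hφ, ← hE.herm, functional_apply, functional_apply,
      h1, h1']
    ring
  have : p ^ (k + 1) ∣ p ^ k := by
    rw [hE.nondeg]
    intro f
    have h3 := key (p ^ k * f)
    rw [functional_apply, hall _ (by rw [smul_add, hx, smul_comm, hy, smul_zero, add_zero])] at h3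
    exact (mul_eq_zero.1 h3.symm).resolve_left h2
  rw [pow_dvd_pow_iff hp.ne_zero hp.not_isUnit] at this
  omega

end Blocks

end IsometricPairs
namespace IsometricPairs

open Polynomial LaurentPolynomial

universe u v

/-! ### Existence of the decomposition. -/

section Existence

variable {F : Type u} [Field F] [StarRing F] {ε : F}

/-- The cases are: p is not associated with its conjugate; it is, and the form degenerates on every
vector killed by p^(k+1); it is, and some such vector u is nondegenerate. The functional of u itself
then proves that Φ_(ε) exists. -/
theorem IsoForm.exists_block {V : Type v} [AddCommGroup V] [Module F V] [Module F[T;T⁻¹] V]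
    [IsScalarTower F F[T;T⁻¹] V] [FiniteDimensional F V] [Nontrivial V] {B : V → V → F}
    (hB : IsoForm ε B) (hε : ε * star ε = 1) (h2 : (2 : F) ≠ 0) {O : Set (SqMat F)}
    (hO : IsCanonicalSet O) {E : ∀ Φ : SqMat F, Matrix (Fin Φ.1) (Fin Φ.1) F}
    (hE : ∀ Φ ∈ O, HasEpsMatrix ε Φ → IsEpsMatrix ε Φ (E Φ)) :
    (∃ Φ ∈ O, ¬ HasEpsMatrix ε Φ ∧ ∃ f : Fin Φ.1 ⊕ Fin Φ.1 → V,
      IsOpFamily (dsum Φ.2 (invStar Φ)) f ∧ ∀ x y, B (f x) (f y) = skewSum 1 (ε • 1) x y) ∨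
    (∃ Φ ∈ O, HasEpsMatrix ε Φ ∧ ∃ q, q ≠ 0 ∧ IsSymmetricForm (irreducibleDivisor Φ) q ∧
      ∃ f : Fin Φ.1 → V, IsOpFamily Φ.2 f ∧
        ∀ x y, B (f x) (f y) = (E Φ * laurentValue q Φ.2 : Matrix _ _ F) x y) := by
  obtain ⟨p, k, x, y, hp, hx, hy, hxy⟩ := hB.exists_pairing hε
  have hxy' : ∃ f, B y ((p ^ k * f) • x) ≠ 0 := ⟨1, by rwa [mul_one]⟩
  obtain ⟨Φ, hΦO, z, hz⟩ := hO.exists_isCyclicVector hp hx fun h => hxy (by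
    rw [h, hB.zero_right])
  obtain ⟨hΦ, hi⟩ := hO.1 Φ hΦO
  by_cases hps : Associated p (star p)
  · by_cases hall : ∀ u : V, p ^ (k + 1) • u = 0 → ∀ f : F[T;T⁻¹], B u ((p ^ k * f) • u) = 0
    · left
      have hy' : p ^ (k + 1) • y = 0 := by
        obtain ⟨r, hr⟩ := (hps.pow_pow (n := k + 1)).symm.dvd
        rw [hr, ← star_pow, mul_comm, mul_smul, hy, smul_zero]
      obtain ⟨x', y', h3, h4, h5, h6, h7⟩ := hB.exists_hyperbolic h2 hp hps hx hy' hxy' hall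
      refine ⟨Φ, hΦO, ?_, ?_⟩
      · rintro ⟨M, hM⟩
        exact hB.not_isEpsFunctional_of_hyperbolic h2 hp h3 h4 h5 h6 h7 hall _
          (hz.isEpsFunctional hΦ hM)
      · have h4' : star (p ^ (k + 1)) • y' = 0 := by
          obtain ⟨r, hr⟩ := (hps.pow_pow (n := k + 1)).dvd
          rw [star_pow, hr, mul_comm, mul_smul, h4, smul_zero]
        obtain ⟨f, hf, hg, -⟩ := hB.exists_fst hΦ hz h3 h4' h6 h7
          fun h => (hB.dvd_of_pairing hp h3 h5 h).2
        exact ⟨f, hf, hg⟩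
    · right
      push Not at hall
      obtain ⟨u, hu, f, hf⟩ := hall
      obtain ⟨k', z', hz'⟩ := hi.exists_isCyclicVector_irreducibleDivisor hΦ
      have hass : Associated (p ^ (k + 1)) (toLaurent (irreducibleDivisor Φ) ^ (k' + 1)) :=
        (hz.charpoly_associated hΦ).symm.trans (hz'.charpoly_associated hΦ)
      have hP := prime_toLaurent (irreducibleDivisor_spec Φ hi.1).2.1
        (irreducibleDivisor_coeff_zero_ne_zero hi hΦ)
      set P := toLaurent (irreducibleDivisor Φ)
      have hpP : Associated p P := hp.associated_of_dvd hP
        (hp.dvd_of_dvd_pow ((dvd_pow_self p k.succ_ne_zero).trans hass.dvd))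
      have hkk : k' = k := by
        have h3 := (hpP.pow_pow (n := k + 1)).symm.trans hass
        have h4 := (pow_dvd_pow_iff hP.ne_zero hP.not_isUnit).1 h3.dvd
        have h5 := (pow_dvd_pow_iff hP.ne_zero hP.not_isUnit).1 h3.symm.dvd
        omega
      subst hkk
      have hEps : HasEpsMatrix ε Φ := by
        refine IsEpsFunctional.hasEpsMatrix (c := p ^ (k' + 1)) hΦ hz
          (φ := hB.functional u u) ⟨hB.self_herm u, hB.dvd_of_pairing hp hu ⟨f, hf⟩⟩
      refine ⟨Φ, hΦO, hEps, hB.exists_snd (u := u) h2 hΦ hi hz' (hE Φ hΦO hEps) ?_ ?_⟩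
      · obtain ⟨r, hr⟩ := hass.dvd
        rw [hr, mul_comm, mul_smul, hu, smul_zero]
      · obtain ⟨r, hr⟩ := (hpP.pow_pow (n := k')).symm.dvd
        exact ⟨r * f, by rwa [← mul_assoc, ← hr]⟩
  · left
    have hcop : ∀ n, IsCoprime (p ^ n) (star (p ^ n)) := fun n => by
      refine isCoprime_pow_of_not_dvd hp (fun h => hps ?_) n
      rw [star_pow] at h
      have := hp.dvd_of_dvd_pow h
      exact associated_of_dvd_dvd this (by simpa using star_dvd_star this)
    -- From a c + b c* = 1 one gets f u = c* b f u, and moving c* to the other argument kills u.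
    have hiso : ∀ (c : F[T;T⁻¹]) (u : V), IsCoprime c (star c) → c • u = 0 →
        ∀ f : F[T;T⁻¹], B u (f • u) = 0 := by
      rintro c u ⟨a, b, hab⟩ hu f
      rw [← one_smul F[T;T⁻¹] (f • u), ← hab, add_smul, hB.add_right, smul_smul, smul_smul,
        show a * c * f = a * f * c by ring, mul_smul, hu, smul_zero, hB.zero_right, zero_add,
        show b * star c * f = star c * (b * f) by ring, mul_smul, hB.adjoint', star_star, hu,
        hB.zero_left]
    refine ⟨Φ, hΦO, ?_, ?_⟩
    · rintro ⟨M, hM⟩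
      exact hps ((hz.isEpsFunctional hΦ hM).associated_star_of_pow hp)
    · obtain ⟨f, hf, hg, -⟩ := hB.exists_fst hΦ hz hx hy (hiso _ _ (hcop _) hx)
        (hiso _ _ (by rw [star_star]; exact (hcop _).symm) hy)
        fun h => (hB.dvd_of_pairing hp hx hxy' h).2
      exact ⟨f, hf, hg⟩

/-- A nonzero symmetric q is prime to p_Φ, so a Bézout identity modulo the annihilator of Φ inverts
q(Φ). -/
theorem isUnit_det_gram_snd {O : Set (SqMat F)} (hO : IsCanonicalSet O) (h2 : (2 : F) ≠ 0)
    {Φ : SqMat F} (hΦ : Φ ∈ O) {M : Matrix (Fin Φ.1) (Fin Φ.1) F} (hM : IsEpsMatrix ε Φ M)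
    {q : F[T;T⁻¹]} (hq : IsSymmetricForm (irreducibleDivisor Φ) q) (hq0 : q ≠ 0) :
    IsUnit (M * laurentValue q Φ.2).det := by
  obtain ⟨hd, hi⟩ := hO.1 Φ hΦ
  obtain ⟨hm, hp, -⟩ := irreducibleDivisor_spec Φ hi.1
  have h0 := irreducibleDivisor_coeff_zero_ne_zero hi hd
  obtain ⟨k, z, hz⟩ := hi.exists_isCyclicVector_irreducibleDivisor hd
  have hnq := fun h => hq0 (hq.eq_zero_of_dvd hm hp h0 h2 h)
  obtain ⟨a, b, hab⟩ := isCoprime_pow_of_not_dvd (prime_toLaurent hp h0) hnq (k + 1)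
  have hc : unitEval Φ.2 (toLaurent (irreducibleDivisor Φ) ^ (k + 1)) = 0 := by
    refine Matrix.ext_of_mulVec_single fun i => ?_
    rw [← hz.coord_spec i, Matrix.mulVec_mulVec, ← map_mul, (hz.ann _).2 (dvd_mul_right _ _),
      Matrix.zero_mulVec]
  rw [Matrix.det_mul]
  refine hM.1.mul ?_
  rw [← Matrix.isUnit_iff_isUnit_det, laurentValue_eq ((Matrix.isUnit_iff_isUnit_det _).2 hd)]
  have h3 := congrArg (unitEval Φ.2) hab
  rw [map_add, map_mul, map_mul, hc, mul_zero, zero_add, map_one] at h3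
  exact IsUnit.of_mul_eq_one _ (by rw [← map_mul, mul_comm, map_mul, h3])

/-- Induction on the dimension: the Gram matrix of a block is invertible, so the form restricts well
to its orthogonal complement. -/
theorem IsoForm.exists_isFrame (hε : ε * star ε = 1) (h2 : (2 : F) ≠ 0) {O : Set (SqMat F)}
    (hO : IsCanonicalSet O) {E : ∀ Φ : SqMat F, Matrix (Fin Φ.1) (Fin Φ.1) F}
    (hE : ∀ Φ ∈ O, HasEpsMatrix ε Φ → IsEpsMatrix ε Φ (E Φ)) (n : ℕ)
    {V : Type v} [AddCommGroup V] [Module F V] [Module F[T;T⁻¹] V]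
    [IsScalarTower F F[T;T⁻¹] V] [FiniteDimensional F V] {B : V → V → F} (hB : IsoForm ε B)
    (hn : Module.finrank F V = n) :
    ∃ D : SummandList F, D.Admissible ε O ∧ D.dim = n ∧ ∃ e₁ e₂, IsFrame ε E B D e₁ e₂ := by
  induction n using Nat.strong_induction_on generalizing V with
  | _ n ih =>
  rcases subsingleton_or_nontrivial V with hV | hV
  · refine ⟨⟨0, Fin.elim0, 0, Fin.elim0, Fin.elim0⟩, ⟨fun i => i.elim0, fun i => i.elim0⟩, ?_,
      fun i => i.elim0, fun i => i.elim0, ?_⟩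
    · rw [← hn, Module.finrank_zero_of_subsingleton]
      rfl
    · exact ⟨fun i => i.elim0, fun i => i.elim0, fun i => i.elim0, fun i => i.elim0,
        fun i => i.elim0, fun i => i.elim0, fun i => i.elim0⟩
  · rcases hB.exists_block hε h2 hO hE with ⟨Φ, hΦ, hEps, f, hf, hg⟩ |
      ⟨Φ, hΦ, hEps, q, hq0, hq, f, hf, hg⟩
    · obtain ⟨hd, hi⟩ := hO.1 Φ hΦ
      obtain ⟨W, hW, hBW, hdim⟩ := hB.exists_orthogonal
        (by rw [dsum, Matrix.det_fromBlocks_zero₂₁]; exact hd.mul (isUnit_det_invStar hd))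
        (isUnit_det_skewSum hε Φ.1) hf hg
      have hfW : FiniteDimensional F W := FiniteDimensional.of_injective
        (W.subtype.restrictScalars F) (Submodule.injective_subtype _)
      rw [Fintype.card_sum, Fintype.card_fin] at hdim
      have := hi.1
      obtain ⟨D, hD, hDd, e₁, e₂, he⟩ := ih _ (by omega) hBW rfl
      refine ⟨D.consFst Φ, ⟨fun i => ?_, hD.2⟩, by rw [D.dim_consFst, hDd, ← hn, hdim], _, _,
        he.map_subtype.consFst hB hf hg (fun x i y => hW _ (e₁ i y).2 x)
          (fun x j y => hW _ (e₂ j y).2 x)⟩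
      induction i using Fin.cases with
      | zero => exact ⟨hΦ, hEps⟩
      | succ i => exact hD.1 i
    · obtain ⟨hd, hi⟩ := hO.1 Φ hΦ
      obtain ⟨W, hW, hBW, hdim⟩ := hB.exists_orthogonal hd
        (isUnit_det_gram_snd hO h2 hΦ (hE Φ hΦ hEps) hq hq0) hf hg
      have hfW : FiniteDimensional F W := FiniteDimensional.of_injective
        (W.subtype.restrictScalars F) (Submodule.injective_subtype _)
      rw [Fintype.card_fin] at hdim
      have := hi.1
      obtain ⟨D, hD, hDd, e₁, e₂, he⟩ := ih _ (by omega) hBW rfl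
      refine ⟨D.consSnd Φ q, ⟨hD.1, fun i => ?_⟩, by rw [D.dim_consSnd, hDd, ← hn, hdim], _, _,
        he.map_subtype.consSnd hB hf hg (fun x i y => hW _ (e₁ i y).2 x)
          (fun x j y => hW _ (e₂ j y).2 x)⟩
      induction i using Fin.cases with
      | zero => exact ⟨hΦ, hEps, hq0, hq⟩
      | succ i => exact hD.2 i

end Existence

end IsometricPairs
namespace IsometricPairs

open Polynomial LaurentPolynomial

universe u v

/-! ### From bases to generators of cyclic summands and back. -/

section CyclicFrames

variable {F : Type u} [Field F] [StarRing F] {ε : F}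

/-- The annihilator of a cyclic vector of `Φ`, if the exponent is `k Φ + 1`. -/
noncomputable def cyclicAnn {F : Type u} [Field F] (k : SqMat F → ℕ) (Φ : SqMat F) : F[T;T⁻¹] :=
  toLaurent (irreducibleDivisor Φ) ^ (k Φ + 1)

/-- The functional on Laurent polynomials given by the chosen form and cyclic vector of `Φ`. -/
noncomputable def cyclicFunctional (E : ∀ Φ : SqMat F, Matrix (Fin Φ.1) (Fin Φ.1) F)
    (z : ∀ Φ : SqMat F, Fin Φ.1 → F) (Φ : SqMat F) : F[T;T⁻¹] →ₗ[F] F :=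
  gramFunctional (E Φ) Φ.2 (z Φ)

omit [StarRing F] in
theorem IsCanonicalSet.exists_cyclicData {O : Set (SqMat F)} (hO : IsCanonicalSet O) :
    ∃ (k : SqMat F → ℕ) (z : ∀ Φ : SqMat F, Fin Φ.1 → F),
      ∀ Φ ∈ O, IsCyclicVector Φ.2 (cyclicAnn k Φ) (z Φ) := by
  classical
  have : ∀ Φ : SqMat F, ∃ (k : ℕ) (z : Fin Φ.1 → F), Φ ∈ O →
      IsCyclicVector Φ.2 (toLaurent (irreducibleDivisor Φ) ^ (k + 1)) z := by
    intro Φ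
    by_cases h : Φ ∈ O
    · obtain ⟨k, z, hz⟩ := (hO.1 Φ h).2.exists_isCyclicVector_irreducibleDivisor (hO.1 Φ h).1
      exact ⟨k, z, fun _ => hz⟩
    · exact ⟨0, 0, fun h' => absurd h' h⟩
  choose k z hz using this
  exact ⟨k, z, hz⟩

omit [StarRing F] in
theorem IsCanonicalSet.prime {O : Set (SqMat F)} (hO : IsCanonicalSet O) {Φ : SqMat F}
    (hΦ : Φ ∈ O) : Prime (toLaurent (irreducibleDivisor Φ)) :=
  prime_toLaurent (irreducibleDivisor_spec Φ (hO.1 Φ hΦ).2.1).2.1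
    (irreducibleDivisor_coeff_zero_ne_zero (hO.1 Φ hΦ).2 (hO.1 Φ hΦ).1)

namespace SummandList

/-- The indices of the indecomposable summands of the operator: two for each summand of type (i)
and one for each summand of type (ii). -/
abbrev CyclicIndex (D : SummandList F) : Type := (Fin D.k ⊕ Fin D.k) ⊕ Fin D.l

/-- The summand to which a summand of the operator is dual. -/
def mate (D : SummandList F) : D.CyclicIndex → D.CyclicIndex := Sum.map Sum.swap id

omit [StarRing F] in
@[simp]
theorem mate_mate (D : SummandList F) (s : D.CyclicIndex) : D.mate (D.mate s) = s := by
  rcases s with (s | s) | s <;> rfl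

/-- The annihilators of the indecomposable summands of the operator. -/
noncomputable def ann (k : SqMat F → ℕ) (D : SummandList F) : D.CyclicIndex → F[T;T⁻¹] :=
  Sum.elim (Sum.elim (fun i => cyclicAnn k (D.Φ i)) (fun i => star (cyclicAnn k (D.Φ i))))
    (fun j => cyclicAnn k (D.Ψ j))

end SummandList

variable {V : Type v} [AddCommGroup V] [Module F V] [Module F[T;T⁻¹] V] {B : V → V → F}

/-- Generators of the cyclic summands of a direct sum of pairs of types (i) and (ii). -/
structure IsCyclicFrame (E : ∀ Φ : SqMat F, Matrix (Fin Φ.1) (Fin Φ.1) F) (k : SqMat F → ℕ)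
    (z : ∀ Φ : SqMat F, Fin Φ.1 → F) (B : V → V → F) (D : SummandList F)
    (x : D.CyclicIndex → V) : Prop where
  ann : ∀ s, D.ann k s • x s = 0
  orth : ∀ s t, t ≠ D.mate s → ∀ f : F[T;T⁻¹], B (x t) (f • x s) = 0
  nondeg : ∀ s h, (∀ f : F[T;T⁻¹], B (x (D.mate (Sum.inl s))) ((h * f) • x (Sum.inl s)) = 0) →
    D.ann k (Sum.inl s) ∣ h
  gram : ∀ j (f : F[T;T⁻¹]),
    B (x (Sum.inr j)) (f • x (Sum.inr j)) = cyclicFunctional E z (D.Ψ j) (D.q j * f)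

variable {E : ∀ Φ : SqMat F, Matrix (Fin Φ.1) (Fin Φ.1) F} {k : SqMat F → ℕ}
  {z : ∀ Φ : SqMat F, Fin Φ.1 → F} {D : SummandList F} {O : Set (SqMat F)}

theorem dvd_of_dvd_symmetric_mul (hO : IsCanonicalSet O) (h2 : (2 : F) ≠ 0) {Φ : SqMat F}
    (hΦ : Φ ∈ O) {q : F[T;T⁻¹]} (hq : IsSymmetricForm (irreducibleDivisor Φ) q) (hq0 : q ≠ 0)
    {h : F[T;T⁻¹]} (hd : cyclicAnn k Φ ∣ q * h) : cyclicAnn k Φ ∣ h := by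
  obtain ⟨hd', hi⟩ := hO.1 Φ hΦ
  obtain ⟨hm, hp, -⟩ := irreducibleDivisor_spec Φ hi.1
  have h0 := irreducibleDivisor_coeff_zero_ne_zero hi hd'
  exact (isCoprime_pow_of_not_dvd (prime_toLaurent hp h0)
    (fun h => hq0 (hq.eq_zero_of_dvd hm hp h0 h2 h)) _).dvd_of_dvd_mul_left hd

theorem IsCyclicFrame.dvd [IsScalarTower F F[T;T⁻¹] V] (hO : IsCanonicalSet O) (h2 : (2 : F) ≠ 0)
    (hE : ∀ Φ ∈ O, HasEpsMatrix ε Φ → IsEpsMatrix ε Φ (E Φ))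
    (hz : ∀ Φ ∈ O, IsCyclicVector Φ.2 (cyclicAnn k Φ) (z Φ)) (hD : D.Admissible ε O)
    {x : D.CyclicIndex → V} (hx : IsCyclicFrame E k z B D x) (s : D.CyclicIndex)
    (h : F[T;T⁻¹]) (hh : ∀ f : F[T;T⁻¹], B (x (D.mate s)) ((h * f) • x s) = 0) :
    D.ann k s ∣ h := by
  rcases s with s | j
  · exact hx.nondeg s h hh
  · obtain ⟨hΨ, hEps, hq0, hq⟩ := hD.2 j
    have h3 := (hz _ hΨ).isEpsFunctional (hO.1 _ hΨ).1 (hE _ hΨ hEps)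
    refine dvd_of_dvd_symmetric_mul hO h2 hΨ hq hq0 ((h3.nondeg _).2 fun f => ?_)
    rw [mul_assoc]
    exact (hx.gram j _).symm.trans (hh f)

/-- Pairing the relation with the generator dual to s isolates the coefficient of s. -/
theorem IsCyclicFrame.dvd_of_sum_eq_zero [IsScalarTower F F[T;T⁻¹] V] (hO : IsCanonicalSet O)
    (h2 : (2 : F) ≠ 0) (hE : ∀ Φ ∈ O, HasEpsMatrix ε Φ → IsEpsMatrix ε Φ (E Φ))
    (hz : ∀ Φ ∈ O, IsCyclicVector Φ.2 (cyclicAnn k Φ) (z Φ)) (hD : D.Admissible ε O)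
    (hB : IsoForm ε B)
    {x : D.CyclicIndex → V} (hx : IsCyclicFrame E k z B D x) {g : D.CyclicIndex → F[T;T⁻¹]}
    (hg : ∑ s, g s • x s = 0) (s : D.CyclicIndex) : D.ann k s ∣ g s := by
  refine hx.dvd hO h2 hE hz hD s _ fun f => ?_
  have h1 := congrArg (fun v => B (x (D.mate s)) (f • v)) hg
  simp only [Finset.smul_sum, hB.sum_right, smul_zero, hB.zero_right, smul_smul] at h1
  rw [Finset.sum_eq_single s] at h1
  · rwa [mul_comm]
  · intro t _ hts
    refine hx.orth _ _ (fun h => hts ?_) _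
    rw [← D.mate_mate t, ← h, D.mate_mate]
  · intro h; exact absurd (Finset.mem_univ s) h

/-- The indecomposable summands of the operator. -/
noncomputable def SummandList.block (D : SummandList F) : D.CyclicIndex → SqMat F :=
  Sum.elim (Sum.elim D.Φ (fun i => ⟨(D.Φ i).1, invStar (D.Φ i)⟩)) D.Ψ

theorem SummandList.Admissible.isUnit_det_block (hO : IsCanonicalSet O) (hD : D.Admissible ε O)
    (s : D.CyclicIndex) : IsUnit (D.block s).2.det := by
  rcases s with (i | i) | j
  · exact (hO.1 _ (hD.1 i).1).1
  · exact isUnit_det_invStar (hO.1 _ (hD.1 i).1).1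
  · exact (hO.1 _ (hD.2 j).1).1

theorem SummandList.Admissible.exists_isCyclicVector (hO : IsCanonicalSet O)
    (hz : ∀ Φ ∈ O, IsCyclicVector Φ.2 (cyclicAnn k Φ) (z Φ)) (hD : D.Admissible ε O) :
    ∃ y : ∀ s : D.CyclicIndex, Fin (D.block s).1 → F,
      (∀ s, IsCyclicVector (D.block s).2 (D.ann k s) (y s)) ∧
      ∀ j, y (Sum.inr j) = z (D.Ψ j) := by
  have hy : ∀ i, ∃ y, IsCyclicVector (invStar (D.Φ i)) (star (cyclicAnn k (D.Φ i))) y :=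
    fun i => (hz _ (hD.1 i).1).exists_invStar (hO.1 _ (hD.1 i).1).2 (hO.1 _ (hD.1 i).1).1
  choose y hy using hy
  refine ⟨fun s => match s with
    | Sum.inl (Sum.inl i) => z (D.Φ i)
    | Sum.inl (Sum.inr i) => y i
    | Sum.inr j => z (D.Ψ j), ?_, fun j => rfl⟩
  rintro ((i | i) | j)
  · exact hz _ (hD.1 i).1
  · exact hy i
  · exact hz _ (hD.2 j).1

/-- The vectors of a frame, grouped by the indecomposable summands of the operator. -/
def SummandList.blockVectors (D : SummandList F) (e₁ : ∀ i, Fin (D.Φ i).1 ⊕ Fin (D.Φ i).1 → V)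
    (e₂ : ∀ j, Fin (D.Ψ j).1 → V) : ∀ s, Fin (D.block s).1 → V
  | Sum.inl (Sum.inl i) => fun a => e₁ i (Sum.inl a)
  | Sum.inl (Sum.inr i) => fun a => e₁ i (Sum.inr a)
  | Sum.inr j => e₂ j

section

variable {e₁ : ∀ i, Fin (D.Φ i).1 ⊕ Fin (D.Φ i).1 → V} {e₂ : ∀ j, Fin (D.Ψ j).1 → V}

theorem IsFrame.isOpFamily_block (h : IsFrame ε E B D e₁ e₂) (s : D.CyclicIndex) :
    IsOpFamily (D.block s).2 (D.blockVectors e₁ e₂ s) := by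
  rcases s with (i | i) | j
  · intro (a : Fin (D.Φ i).1)
    have := h.op₁ i (Sum.inl a)
    simp only [Fintype.sum_sum_type, dsum, Matrix.fromBlocks_apply₁₁, Matrix.fromBlocks_apply₂₁,
      Matrix.zero_apply, zero_smul, Finset.sum_const_zero, add_zero] at this
    exact this
  · intro (a : Fin (D.Φ i).1)
    have := h.op₁ i (Sum.inr a)
    simp only [Fintype.sum_sum_type, dsum, Matrix.fromBlocks_apply₁₂, Matrix.fromBlocks_apply₂₂,
      Matrix.zero_apply, zero_smul, Finset.sum_const_zero, zero_add] at this
    exact this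
  · exact h.op₂ j

theorem IsFrame.orth_block (h : IsFrame ε E B D e₁ e₂) (hB : IsoForm ε B) (s t : D.CyclicIndex)
    (hst : t ≠ D.mate s) (a b) : B (D.blockVectors e₁ e₂ t a) (D.blockVectors e₁ e₂ s b) = 0 := by
  have sw : ∀ {u v : V}, B u v = 0 → B v u = 0 := fun {u v} huv => by
    rw [hB.herm, huv, star_zero, mul_zero]
  rcases s with (i | i) | j <;> rcases t with (i' | i') | j'
  · by_cases hi : i' = i
    · subst hi
      exact (h.gram₁ i' _ _).trans rfl
    · exact h.orth₁ _ _ hi _ _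
  · exact h.orth₁ _ _ (fun hi => hst (by rw [hi]; rfl)) _ _
  · exact sw (h.orth _ _ _ _)
  · exact h.orth₁ _ _ (fun hi => hst (by rw [hi]; rfl)) _ _
  · by_cases hi : i' = i
    · subst hi
      exact (h.gram₁ i' _ _).trans rfl
    · exact h.orth₁ _ _ hi _ _
  · exact sw (h.orth _ _ _ _)
  · exact h.orth _ _ _ _
  · exact h.orth _ _ _ _
  · exact h.orth₂ _ _ (fun hi => hst (by rw [hi]; rfl)) _ _

/-- The generator of a block is the combination of its vectors whose coefficients are those of a
cyclic vector of its matrix. -/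
theorem IsFrame.exists_isCyclicFrame [IsScalarTower F F[T;T⁻¹] V] (hO : IsCanonicalSet O)
    (hε : ε * star ε = 1)
    (hz : ∀ Φ ∈ O, IsCyclicVector Φ.2 (cyclicAnn k Φ) (z Φ)) (hD : D.Admissible ε O)
    (hE : ∀ Φ ∈ O, HasEpsMatrix ε Φ → IsEpsMatrix ε Φ (E Φ))
    (hB : IsoForm ε B) (h : IsFrame ε E B D e₁ e₂) :
    ∃ x, IsCyclicFrame E k z B D x ∧ ∀ v ∈ Submodule.span F (Set.range (frameVectors D e₁ e₂)),
      ∃ g : D.CyclicIndex → F[T;T⁻¹], v = ∑ s, g s • x s := by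
  have hdet := hD.isUnit_det_block hO
  obtain ⟨y, hy, hyz⟩ := hD.exists_isCyclicVector hO hz
  have hop := h.isOpFamily_block
  set e := D.blockVectors e₁ e₂ with he
  set x : D.CyclicIndex → V := fun s => Fintype.linearCombination F (e s) (y s) with hx
  have hgx : ∀ s g, (g : F[T;T⁻¹]) • x s
      = ∑ a, (unitEval (D.block s).2 g).mulVec (y s) a • e s a := by
    intro s g
    rw [hx, laurent_smul_linearCombination (hdet s) (hop s)]; rfl
  have hex : ∀ s a, (hy s).coord a • x s = e s a := by
    intro s a
    rw [hgx, IsCyclicVector.coord_spec]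
    simp [Pi.single_apply]
  have horth : ∀ s t, t ≠ D.mate s → ∀ f g : F[T;T⁻¹], B (f • x t) (g • x s) = 0 := by
    intro s t hst f g
    rw [hgx, hgx, hB.sum_left]
    refine Finset.sum_eq_zero fun a _ => ?_
    rw [hB.smul_left, hB.sum_right, Finset.sum_eq_zero, mul_zero]
    intro b _
    rw [hB.smul_right, h.orth_block hB s t hst, mul_zero]
  have hp₁ : ∀ i (a b : Fin (D.Φ i).1),
      B (e₁ i (Sum.inr a)) (e₁ i (Sum.inl b)) = if a = b then 1 else 0 := fun i a b => by
    rw [h.gram₁, skewSum, Matrix.fromBlocks_apply₂₁, Matrix.one_apply]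
  have hp₂ : ∀ i (a b : Fin (D.Φ i).1),
      B (e₁ i (Sum.inl a)) (e₁ i (Sum.inr b)) = if a = b then ε else 0 := fun i a b => by
    rw [h.gram₁, skewSum, Matrix.fromBlocks_apply₁₂, Matrix.smul_apply, Matrix.one_apply,
      smul_eq_mul, mul_ite, mul_one, mul_zero]
  -- The two halves of a summand of type (i) are dual to each other up to the constant 1 or ε,
  -- depending on the order.
  have hpair : ∀ (s : Fin D.k ⊕ Fin D.k),
      ∃ τ : Fin (D.block (Sum.inl s)).1 → Fin (D.block (D.mate (Sum.inl s))).1, ∃ c : F, c ≠ 0 ∧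
        ∀ a b, B (e (D.mate (Sum.inl s)) (τ a)) (e (Sum.inl s) b) = if a = b then c else 0 := by
    rintro (i | i)
    · exact ⟨id, 1, one_ne_zero, hp₁ i⟩
    · exact ⟨id, ε, fun h0 => by simp [h0] at hε, hp₂ i⟩
  refine ⟨x, ⟨fun s => ?_, fun s t hst f => ?_, fun s g hg => ?_, fun j f => ?_⟩, fun v hv => ?_⟩
  · rw [hgx, ((hy s).ann _).2 dvd_rfl]
    simp
  · simpa using horth s t hst 1 f
  · rw [← (hy _).ann]
    obtain ⟨τ, c, hc, hτ⟩ := hpair s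
    ext a
    have h1 := hg (star ((hy (D.mate (Sum.inl s))).coord (τ a)))
    rw [mul_comm, mul_smul, ← hB.adjoint, hex, hgx, hB.sum_right] at h1
    simp only [hB.smul_right, hτ, mul_ite, mul_zero, Finset.sum_ite_eq, Finset.mem_univ,
      if_true] at h1
    exact (mul_eq_zero.1 h1).resolve_right hc
  · have hΨ := (hD.2 j).1
    have hM := hE _ hΨ (hD.2 j).2.1
    rw [cyclicFunctional, gramFunctional_apply, map_mul, hgx]
    rw [show B (x (Sum.inr j)) = B (∑ a, z (D.Ψ j) a • e₂ j a) by
      rw [hx]; simp only [hyz]; rfl]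
    simp only [hB.sum_left, hB.sum_right, hB.smul_left, hB.smul_right]
    rw [← Matrix.mulVec_mulVec, Matrix.mulVec_mulVec, ← laurentValue_eq
      ((Matrix.isUnit_iff_isUnit_det _).2 (hO.1 _ hΨ).1), dotProduct]
    refine Finset.sum_congr rfl fun a _ => ?_
    have hmv : ∀ (N : Matrix (Fin (D.Ψ j).1) (Fin (D.Ψ j).1) F) v,
      N.mulVec v a = ∑ b, N a b * v b := fun _ _ => rfl
    rw [Pi.star_apply, hmv (E _ * _), Finset.mul_sum]
    refine Finset.sum_congr rfl fun b _ => congrArg _ ?_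
    rw [mul_comm]
    congr 1
    · exact h.gram₂ j a b
    · rw [hyz]; rfl
  · induction hv using Submodule.span_induction with
    | mem v hv =>
      obtain ⟨i, rfl⟩ := hv
      have key : ∀ s a, ∃ g : D.CyclicIndex → F[T;T⁻¹], e s a = ∑ t, g t • x t := fun s a =>
        ⟨Pi.single s ((hy s).coord a), by
          rw [Finset.sum_eq_single s (fun t _ ht => by rw [Pi.single_eq_of_ne ht, zero_smul])
            (fun h => absurd (Finset.mem_univ s) h), Pi.single_eq_same, hex]⟩
      rcases i with ⟨i, a | a⟩ | ⟨j, a⟩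
      · exact key (Sum.inl (Sum.inl i)) a
      · exact key (Sum.inl (Sum.inr i)) a
      · exact key (Sum.inr j) a
    | zero => exact ⟨0, by simp⟩
    | add v w _ _ hv hw =>
      obtain ⟨g, rfl⟩ := hv
      obtain ⟨g', rfl⟩ := hw
      exact ⟨g + g', by simp [add_smul, Finset.sum_add_distrib]⟩
    | smul a v _ hv =>
      obtain ⟨g, rfl⟩ := hv
      exact ⟨a • g, by simp [Finset.smul_sum]⟩

end

theorem IsCyclicFrame.exists_isFrame [IsScalarTower F F[T;T⁻¹] V] [FiniteDimensional F V]
    (hO : IsCanonicalSet O) (hE : ∀ Φ ∈ O, HasEpsMatrix ε Φ → IsEpsMatrix ε Φ (E Φ))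
    (hz : ∀ Φ ∈ O, IsCyclicVector Φ.2 (cyclicAnn k Φ) (z Φ)) (hD : D.Admissible ε O)
    (hB : IsoForm ε B) {x : D.CyclicIndex → V} (hx : IsCyclicFrame E k z B D x) :
    ∃ e₁ e₂, IsFrame ε E B D e₁ e₂ := by
  have horth : ∀ s t, t ≠ D.mate s → ∀ f g : F[T;T⁻¹], B (f • x t) (g • x s) = 0 := by
    intro s t hst f g
    rw [hB.adjoint, smul_smul]
    exact hx.orth s t hst _
  have hfst : ∀ i, ∃ f : Fin (D.Φ i).1 ⊕ Fin (D.Φ i).1 → V,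
      (IsOpFamily (dsum (D.Φ i).2 (invStar (D.Φ i))) f ∧
        ∀ x y, B (f x) (f y) = skewSum 1 (ε • 1) x y) ∧
      ∀ a, ∃ g g' : F[T;T⁻¹], f a = g • x (Sum.inl (Sum.inl i)) + g' • x (Sum.inl (Sum.inr i)) := by
    intro i
    obtain ⟨f, hf, hg, hs⟩ := hB.exists_fst (hO.1 _ (hD.1 i).1).1 (hz _ (hD.1 i).1)
      (hx.ann (Sum.inl (Sum.inl i))) (hx.ann (Sum.inl (Sum.inr i)))
      (hx.orth _ _ (by simp [SummandList.mate])) (hx.orth _ _ (by simp [SummandList.mate]))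
      (hx.nondeg (Sum.inl i))
    exact ⟨f, ⟨hf, hg⟩, hs⟩
  choose e₁ he₁ g g' hgg using hfst
  refine ⟨e₁, fun j a => (hz _ (hD.2 j).1).coord a • x (Sum.inr j), fun i => (he₁ i).1,
    fun j => (hz _ (hD.2 j).1).isOpFamily (hO.1 _ (hD.2 j).1).1 (hx.ann (Sum.inr j)),
    fun i => (he₁ i).2, fun j => hB.gram_snd (hO.1 _ (hD.2 j).1).1 (hz _ (hD.2 j).1)
      (hE _ (hD.2 j).1 (hD.2 j).2.1) (hx.gram j), fun i i' hi a b => ?_,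
    fun j j' hj a b => horth _ _ (by simpa [SummandList.mate] using hj) _ _, fun i j a b => ?_⟩
  · rw [hgg, hgg, hB.add_left, hB.add_right, hB.add_right, horth, horth, horth, horth]
    · simp
    all_goals simp [SummandList.mate, hi]
  · rw [hgg, hB.add_left, horth, horth, add_zero]
    all_goals simp [SummandList.mate]

/-- A frame is linearly independent, so it is a basis as soon as it has the right number of vectors.
-/
theorem represents_iff [IsScalarTower F F[T;T⁻¹] V] [FiniteDimensional F V]
    (hO : IsCanonicalSet O) (h2 : (2 : F) ≠ 0) (hε : ε * star ε = 1)
    (hE : ∀ Φ ∈ O, HasEpsMatrix ε Φ → IsEpsMatrix ε Φ (E Φ)) (hD : D.Admissible ε O)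
    {A : V →ₗ[F] V} (hA : ∀ v, (T 1 : F[T;T⁻¹]) • v = A v) {B : V →ₗ⋆[F] V →ₗ[F] F}
    (hB : IsoForm ε (fun u v => B u v)) :
    D.Represents ε E A B ↔ D.dim = Module.finrank F V ∧
      ∃ e₁ e₂, IsFrame ε E (fun u v => B u v) D e₁ e₂ := by
  have hAT : opT F V = A := LinearMap.ext hA
  constructor
  · rintro ⟨e, h1, h3⟩
    refine ⟨?_, _, _, isFrame_of_index e ?_ h3⟩
    · rw [← card_index, Module.finrank_eq_card_basis e]
    · rw [isOpFamily_basis_iff, hAT, h1]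
  · rintro ⟨hdim, e₁, e₂, h⟩
    have hli := h.linearIndependent hB hε fun j => isUnit_det_gram_snd hO h2 (hD.2 j).1
      (hE _ (hD.2 j).1 (hD.2 j).2.1) (hD.2 j).2.2.2 (hD.2 j).2.2.1
    have hcard : Fintype.card D.Index = Module.finrank F V := by rw [card_index, hdim]
    have hspan := hli.span_eq_top_of_card_eq_finrank' hcard
    refine ⟨Module.Basis.mk hli hspan.ge, ?_, fun i j => ?_⟩
    · rw [← hAT, ← isOpFamily_basis_iff, Module.Basis.coe_mk]
      exact h.isOpFamily
    · rw [Module.Basis.mk_apply, Module.Basis.mk_apply]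
      exact h.gram hB i j

end CyclicFrames

end IsometricPairs
namespace IsometricPairs

open Polynomial LaurentPolynomial

universe u v

/-! ### Divisibility between powers of primes. -/

section PrimePowers

variable {F : Type u} [Field F]

/-- Multiples of powers of two primes that are not associated powers. -/
theorem dvd_or_dvd_of_not_associated {p q : F[T;T⁻¹]} (hp : Prime p) (hq : Prime q) {k m : ℕ}
    (h : ¬ Associated (q ^ (m + 1)) (p ^ (k + 1))) :
    (∀ a, p ^ (k + 1) ∣ q ^ (m + 1) * a → p ∣ a) ∨
      ((∀ a, q ^ (m + 1) ∣ p ^ (k + 1) * a → p ∣ a) ∧ k < m ∧ Associated q p) := by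
  by_cases hqp : Associated q p
  · have hpow : ∀ n, Associated (q ^ n) (p ^ n) := fun n => hqp.pow_pow
    rcases lt_trichotomy m k with hmk | hmk | hmk
    · left
      intro a ha
      have h1 : p ^ (k + 1) ∣ p ^ (m + 1) * a := ha.trans (mul_dvd_mul_right (hpow _).dvd a)
      obtain ⟨i, rfl⟩ : ∃ i, k = m + 1 + i := ⟨k - (m + 1), by omega⟩
      rw [add_assoc, pow_add] at h1
      exact (dvd_pow_self p (by omega)).trans
        ((mul_dvd_mul_iff_left (pow_ne_zero _ hp.ne_zero)).1 h1)
    · exact absurd (hmk ▸ hpow _) h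
    · right
      refine ⟨fun a ha => ?_, hmk, hqp⟩
      have h1 : p ^ (m + 1) ∣ p ^ (k + 1) * a := (hpow _).symm.dvd.trans ha
      obtain ⟨i, rfl⟩ : ∃ i, m = k + 1 + i := ⟨m - (k + 1), by omega⟩
      rw [add_assoc, pow_add] at h1
      exact (dvd_pow_self p (by omega)).trans
        ((mul_dvd_mul_iff_left (pow_ne_zero _ hp.ne_zero)).1 h1)
  · left
    intro a ha
    have h1 : ¬ p ∣ q ^ (m + 1) := fun h => hqp
      ((hp.associated_of_dvd hq (hp.dvd_of_dvd_pow h)).symm)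
    exact (hp.dvd_mul.1 ((dvd_pow_self p k.succ_ne_zero).trans ha)).resolve_left h1

/-- A lower power of p divides p^k; for a higher power, a and b are both divisible by p^(m-k), and
2(m-k) + k ≥ m + 1; for a different prime already b is divisible. This removes summands with other
annihilators when forms are compared. -/
theorem dvd_mul_pow_mul_of_not_associated {p q : F[T;T⁻¹]} (hp : Prime p) (hq : Prime q)
    {k m : ℕ} (h : ¬ Associated (q ^ (m + 1)) (p ^ (k + 1))) {a b : F[T;T⁻¹]}
    (ha : q ^ (m + 1) ∣ p ^ (k + 1) * a) (hb : q ^ (m + 1) ∣ p ^ (k + 1) * b) :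
    q ^ (m + 1) ∣ a * p ^ k * b := by
  by_cases hqp : Associated q p
  · have hpow : ∀ n, Associated (q ^ n) (p ^ n) := fun n => hqp.pow_pow
    rcases lt_trichotomy m k with hmk | hmk | hmk
    · exact ((hpow _).dvd.trans (pow_dvd_pow p (by omega : m + 1 ≤ k))).trans
        ((dvd_mul_left _ _).mul_right _)
    · exact absurd (hmk ▸ hpow _) h
    · obtain ⟨i, rfl⟩ : ∃ i, m = k + 1 + i := ⟨m - (k + 1), by omega⟩
      have key : ∀ {r}, q ^ (k + 1 + i + 1) ∣ p ^ (k + 1) * r → p ^ (i + 1) ∣ r := fun {r} hr => by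
        have h1 := (hpow _).symm.dvd.trans hr
        rw [add_assoc, pow_add] at h1
        exact (mul_dvd_mul_iff_left (pow_ne_zero _ hp.ne_zero)).1 h1
      refine (hpow _).dvd.trans ?_
      refine (pow_dvd_pow p (by omega : k + 1 + i + 1 ≤ (i + 1) + k + (i + 1))).trans ?_
      rw [pow_add, pow_add]
      exact mul_dvd_mul (mul_dvd_mul (key ha) dvd_rfl) (key hb)
  · have h1 : ¬ q ∣ p ^ (k + 1) := fun h => hqp
      (hq.associated_of_dvd hp (hq.dvd_of_dvd_pow h))
    exact ((isCoprime_pow_of_not_dvd hq h1 _).dvd_of_dvd_mul_left hb).mul_left _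

end PrimePowers

/-! ### Comparing two cyclic decompositions of a module. -/

section CyclicSystems

variable {F : Type u} [Field F] {V : Type v} [AddCommGroup V] [Module F[T;T⁻¹] V]
variable {S S' : Type*} [Fintype S] [Fintype S']

/-- `V` is the direct sum of the cyclic submodules generated by the `x s`, and `c s` generates the
annihilator of `x s`. -/
structure IsCyclicSystem (c : S → F[T;T⁻¹]) (x : S → V) : Prop where
  ann : ∀ s, c s • x s = 0
  gen : ∀ v, ∃ g : S → F[T;T⁻¹], v = ∑ s, g s • x s
  rel : ∀ g : S → F[T;T⁻¹], ∑ s, g s • x s = 0 → ∀ s, c s ∣ g s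

theorem IsCyclicSystem.dvd_of_eq_sum {c' : S' → F[T;T⁻¹]} {x' : S' → V}
    (h' : IsCyclicSystem c' x') {v : V} {g : S' → F[T;T⁻¹]} (hg : v = ∑ t, g t • x' t)
    {r : F[T;T⁻¹]} (hr : r • v = 0) (t : S') : c' t ∣ r * g t := by
  refine h'.rel (fun t => r * g t) ?_ t
  simp only [mul_smul]
  rw [← Finset.smul_sum, ← hg, hr]

/-- The transition coefficients between the parts of two systems that consist of the summands with
a given prime power annihilator. -/
theorem IsCyclicSystem.sum_transition [DecidableEq S] {c : S → F[T;T⁻¹]} {x : S → V}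
    (h : IsCyclicSystem c x) {c' : S' → F[T;T⁻¹]} {x' : S' → V} (h' : IsCyclicSystem c' x')
    (hc' : ∀ t, ∃ q m, Prime q ∧ Associated (q ^ (m + 1)) (c' t))
    {g : S → S' → F[T;T⁻¹]} (hg : ∀ s, x s = ∑ t, g s t • x' t)
    {g' : S' → S → F[T;T⁻¹]} (hg' : ∀ t, x' t = ∑ s, g' t s • x s)
    {p : F[T;T⁻¹]} (hp : Prime p) {k : ℕ} {J J' : Type*} [DecidableEq J] [Fintype J'] {ι : J → S}
    (hι : Function.Injective ι) (hιc : ∀ j, Associated (c (ι j)) (p ^ (k + 1))) {ι' : J' → S'}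
    (hι' : Function.Injective ι')
    (hιc' : ∀ t, Associated (c' t) (p ^ (k + 1)) → t ∈ Set.range ι') {K : Type*} [CommRing K]
    {π : F[T;T⁻¹] →+* K} (hπ : ∀ f, π f = 0 ↔ p ∣ f) (s r : J) :
    ∑ t, π (g (ι s) (ι' t)) * π (g' (ι' t) (ι r)) = (1 : Matrix J J K) s r := by
  have h1 : ∑ r, (∑ t, g (ι s) t * g' t r - (Pi.single (ι s) 1 : S → F[T;T⁻¹]) r) • x r = 0 := by
    simp only [sub_smul, Finset.sum_sub_distrib, Finset.sum_smul, mul_smul]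
    rw [Finset.sum_comm]
    simp only [← Finset.smul_sum, ← hg']
    rw [← hg, sub_eq_zero, Finset.sum_eq_single (ι s)
      (fun t _ ht => by rw [Pi.single_eq_of_ne ht, zero_smul])
      (fun h => absurd (Finset.mem_univ _) h), Pi.single_eq_same, one_smul]
  have h2 := (dvd_pow_self p k.succ_ne_zero).trans
    ((hιc r).symm.dvd.trans (h.rel _ h1 (ι r)))
  rw [← hπ, map_sub, sub_eq_zero, map_sum] at h2
  have h3 : π ((Pi.single (ι s) 1 : S → F[T;T⁻¹]) (ι r)) = (1 : Matrix J J K) s r := by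
    rw [Pi.single_apply, Matrix.one_apply]
    by_cases hrs : s = r
    · subst hrs; simp
    · rw [if_neg hrs, if_neg (fun h => hrs (hι h).symm), map_zero]
  rw [← h3, ← h2]
  refine Finset.sum_of_injOn ι' hι'.injOn (fun _ _ => Finset.mem_coe.2 (Finset.mem_univ _))
    (fun t _ ht => ?_) (fun t _ => (map_mul π _ _).symm)
  rw [hπ]
  obtain ⟨q, m, hq, hqm⟩ := hc' t
  have hna : ¬ Associated (q ^ (m + 1)) (p ^ (k + 1)) := fun ha => ht (by
    simpa using hιc' t (hqm.symm.trans ha))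
  -- For a summand with another annihilator, one of the two transition coefficients is divisible by
  -- p.
  rcases dvd_or_dvd_of_not_associated hp hq hna with h4 | ⟨h4, -, -⟩
  · refine Dvd.dvd.mul_left (h4 _ ?_) _
    exact (hιc r).symm.dvd.trans ((h.dvd_of_eq_sum (hg' t) (h'.ann t) (ι r)).trans
      (mul_dvd_mul_right hqm.symm.dvd _))
  · refine Dvd.dvd.mul_right (h4 _ ?_) _
    exact hqm.dvd.trans ((h'.dvd_of_eq_sum (hg (ι s)) (h.ann _) t).trans
      (mul_dvd_mul_right (hιc s).dvd _))

theorem exists_residue_ring {p : F[T;T⁻¹]} (hp : Prime p) :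
    ∃ (K : Type u) (_ : CommRing K) (_ : Nontrivial K) (π : F[T;T⁻¹] →+* K),
      ∀ f, π f = 0 ↔ p ∣ f :=
  ⟨F[T;T⁻¹] ⧸ Ideal.span {p}, inferInstance, Ideal.Quotient.nontrivial_iff.2 (by
    rw [Ne, Ideal.span_singleton_eq_top]; exact hp.not_isUnit), Ideal.Quotient.mk _, fun f => by
    rw [Ideal.Quotient.eq_zero_iff_mem, Ideal.mem_span_singleton]⟩

/-- The transition matrices modulo p are mutually inverse over a nonzero commutative ring, so they
are square. -/
theorem IsCyclicSystem.card_eq {c : S → F[T;T⁻¹]} {x : S → V}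
    (h : IsCyclicSystem c x) (hc : ∀ t, ∃ q m, Prime q ∧ Associated (q ^ (m + 1)) (c t))
    {c' : S' → F[T;T⁻¹]} {x' : S' → V} (h' : IsCyclicSystem c' x')
    (hc' : ∀ t, ∃ q m, Prime q ∧ Associated (q ^ (m + 1)) (c' t)) {p : F[T;T⁻¹]} (hp : Prime p)
    (k : ℕ) [DecidablePred fun s => Associated (c s) (p ^ (k + 1))]
    [DecidablePred fun s => Associated (c' s) (p ^ (k + 1))] :
    Fintype.card {s // Associated (c s) (p ^ (k + 1))}
      = Fintype.card {s // Associated (c' s) (p ^ (k + 1))} := by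
  classical
  choose g hg using fun s => h'.gen (x s)
  choose g' hg' using fun s => h.gen (x' s)
  obtain ⟨K, _, _, π, hπ⟩ := exists_residue_ring hp
  have h1 := h.sum_transition h' hc' hg hg' hp (k := k) Subtype.val_injective
    (fun s : {s // Associated (c s) (p ^ (k + 1))} => s.2) Subtype.val_injective
    (fun s hs => ⟨(⟨s, hs⟩ : {s // Associated (c' s) (p ^ (k + 1))}), rfl⟩) hπ
  have h2 := h'.sum_transition h hc hg' hg hp (k := k) Subtype.val_injective
    (fun s : {s // Associated (c' s) (p ^ (k + 1))} => s.2) Subtype.val_injective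
    (fun s hs => ⟨(⟨s, hs⟩ : {s // Associated (c s) (p ^ (k + 1))}), rfl⟩) hπ
  refine card_eq_of_linearEquiv K (Matrix.toLin'OfInv
    (M := Matrix.of fun t s => π (g' t.1 s.1)) (M' := Matrix.of fun s t => π (g s.1 t.1))
    (Matrix.ext h2) (Matrix.ext h1)).symm

end CyclicSystems

end IsometricPairs
namespace IsometricPairs

open Polynomial LaurentPolynomial

universe u v

/-! ### Hermitian forms over the residue field F(κ). -/

section ResidueForms

variable {F : Type u} [Field F] [StarRing F] {p : F[X]}

/-- As p divides its conjugate, the involution of the Laurent ring descends to F(κ), where it is ∘.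
-/
theorem circ_unitEval (hp : Irreducible p) (h0 : p.coeff 0 ≠ 0) (hv : vee p = p) (a : F[T;T⁻¹]) :
    circ p (unitEval (AdjoinRoot.root p) a) = unitEval (AdjoinRoot.root p) (star a) := by
  have hu := isUnit_root_of_coeff_zero_ne_zero hp h0
  have hinv : ∀ f : F[X], unitEval (AdjoinRoot.root p) (invert (toLaurent f))
      = aeval (Ring.inverse (AdjoinRoot.root p)) f := by
    intro f
    have : ((unitEval (AdjoinRoot.root p)).comp (invert (R := F)).toAlgHom).comp
        (toLaurentAlg (R := F)) = aeval (Ring.inverse (AdjoinRoot.root p)) := by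
      ext
      simp [unitEval_T_neg_one hu]
    rw [← this]
    simp
  obtain ⟨f, hf⟩ := AdjoinRoot.mk_surjective (unitEval (AdjoinRoot.root p) a)
  have hd : toLaurent p ∣ a - toLaurent f := by
    rw [← unitEval_root_eq_zero_iff hp h0, map_sub, ← hf, unitEval_toLaurent hu,
      AdjoinRoot.aeval_eq, sub_self]
  have hd' : toLaurent p ∣ star a - star (toLaurent f) := by
    rw [← star_sub]
    refine Dvd.dvd.trans ?_ (star_dvd_star hd)
    rw [star_toLaurent_of_vee h0 hv]
    exact dvd_mul_left _ _
  rw [← unitEval_root_eq_zero_iff hp h0, map_sub, sub_eq_zero] at hd'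
  rw [← hf, circ_mk p hp hv, hd', star_toLaurent, hinv]

variable {I J : Type*} [Fintype I] [Fintype J]

theorem diagForm_unitEval (hp : Irreducible p) (h0 : p.coeff 0 ≠ 0) (hv : vee p = p)
    (q a b : I → F[T;T⁻¹]) :
    diagForm p q (fun i => unitEval (AdjoinRoot.root p) (a i))
        (fun i => unitEval (AdjoinRoot.root p) (b i))
      = unitEval (AdjoinRoot.root p) (∑ i, star (a i) * q i * b i) := by
  rw [diagForm, map_sum]
  refine Finset.sum_congr rfl fun i _ => ?_
  rw [circ_unitEval hp h0 hv, laurentValue_eq (isUnit_root_of_coeff_zero_ne_zero hp h0), map_mul,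
    map_mul]
  ring

theorem diagForm_eq_of_congruence [DecidableEq I] (hp : Irreducible p) (h0 : p.coeff 0 ≠ 0)
    (hv : vee p = p) {q : I → F[T;T⁻¹]} {q' : J → F[T;T⁻¹]} {g : I → J → F[T;T⁻¹]}
    (hg : ∀ i j, toLaurent p ∣ ∑ t, star (g i t) * q' t * g j t - if i = j then q i else 0)
    (x y : I → AdjoinRoot p) :
    diagForm p q' (fun t => ∑ i, unitEval (AdjoinRoot.root p) (g i t) * x i)
        (fun t => ∑ i, unitEval (AdjoinRoot.root p) (g i t) * y i) = diagForm p q x y := by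
  choose a ha using fun i => unitEval_root_surjective hp h0 (x i)
  choose b hb using fun i => unitEval_root_surjective hp h0 (y i)
  obtain rfl : (fun i => unitEval (AdjoinRoot.root p) (a i)) = x := funext ha
  obtain rfl : (fun i => unitEval (AdjoinRoot.root p) (b i)) = y := funext hb
  simp only [← map_mul, ← map_sum]
  rw [diagForm_unitEval hp h0 hv, diagForm_unitEval hp h0 hv, ← sub_eq_zero, ← map_sub,
    unitEval_root_eq_zero_iff hp h0]
  have h1 : ∑ t, star (∑ i, g i t * a i) * q' t * ∑ i, g i t * b i
      = ∑ i, ∑ j, star (a i) * b j * ∑ t, star (g i t) * q' t * g j t := by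
    simp only [star_sum, star_mul_comm, Finset.sum_mul, Finset.mul_sum]
    rw [Finset.sum_comm]
    rw [Finset.sum_congr rfl fun j _ => Finset.sum_comm, Finset.sum_comm]
    refine Finset.sum_congr rfl fun i _ => Finset.sum_congr rfl fun j _ =>
      Finset.sum_congr rfl fun t _ => by ring
  have h2 : ∑ i, star (a i) * q i * b i
      = ∑ i, ∑ j, star (a i) * b j * (if i = j then q i else 0) := by
    refine Finset.sum_congr rfl fun i _ => ?_
    simp only [mul_ite, mul_zero, Finset.sum_ite_eq, Finset.mem_univ, if_true]
    ring
  rw [h1, h2, ← Finset.sum_sub_distrib]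
  refine Finset.dvd_sum fun i _ => ?_
  rw [← Finset.sum_sub_distrib]
  refine Finset.dvd_sum fun j _ => ?_
  rw [← mul_sub]
  exact (hg i j).mul_left _

/-- The coefficients lift the images of the standard basis under the inverse of the equivalence. -/
theorem FormsEquivalent.exists_congruence [DecidableEq J] (hp : Irreducible p)
    (h0 : p.coeff 0 ≠ 0) (hv : vee p = p) {q : I → F[T;T⁻¹]} {q' : J → F[T;T⁻¹]}
    (h : FormsEquivalent p q q') : ∃ g : I → J → F[T;T⁻¹],
      ∀ s t, toLaurent p ∣ ∑ i, star (g i s) * q i * g i t - if s = t then q' s else 0 := by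
  obtain ⟨e, he⟩ := h
  choose g hg using fun i t =>
    unitEval_root_surjective hp h0 (e.symm (Pi.single t (1 : AdjoinRoot p)) i)
  refine ⟨g, fun s t => ?_⟩
  rw [← unitEval_root_eq_zero_iff hp h0, map_sub, sub_eq_zero, ← diagForm_unitEval hp h0 hv]
  have h1 : ∀ t, (fun i => unitEval (AdjoinRoot.root p) (g i t))
      = e.symm (Pi.single t (1 : AdjoinRoot p)) := fun t => funext fun i => hg i t
  have h2 : ∀ t, (Pi.single t (1 : AdjoinRoot p) : J → AdjoinRoot p)
      = fun i => unitEval (AdjoinRoot.root p) ((Pi.single t 1 : J → F[T;T⁻¹]) i) := by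
    intro t
    ext i
    rw [Pi.single_apply, Pi.single_apply]
    split_ifs
    · rw [map_one]
    · rw [map_zero]
  rw [h1, h1, ← he, e.apply_symm_apply, e.apply_symm_apply, h2, h2, diagForm_unitEval hp h0 hv]
  congr 1
  rw [Finset.sum_eq_single s]
  · rw [Pi.single_eq_same, star_one, one_mul, Pi.single_apply, mul_ite, mul_one, mul_zero]
  · intro i _ hi
    rw [Pi.single_eq_of_ne hi, star_zero, zero_mul, zero_mul]
  · intro h; exact absurd (Finset.mem_univ s) h

theorem formsEquivalent_of_isEmpty [IsEmpty I] [IsEmpty J] (q : I → F[T;T⁻¹])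
    (q' : J → F[T;T⁻¹]) : FormsEquivalent p q q' :=
  ⟨LinearEquiv.ofSubsingleton _ _, fun x y => by simp [diagForm]⟩

end ResidueForms

/-! ### The residue forms as invariants. -/

section Invariants

variable {F : Type u} [Field F] [StarRing F] {ε : F} {O : Set (SqMat F)} {k : SqMat F → ℕ}
  {z : ∀ Φ : SqMat F, Fin Φ.1 → F}

theorem cyclicAnn_eq_of_associated {F : Type u} [Field F] {O : Set (SqMat F)} {k : SqMat F → ℕ}
    {z : ∀ Φ : SqMat F, Fin Φ.1 → F} (hO : IsCanonicalSet O)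
    (hz : ∀ Φ ∈ O, IsCyclicVector Φ.2 (cyclicAnn k Φ) (z Φ)) {Φ Ψ : SqMat F} (hΦ : Φ ∈ O)
    (hΨ : Ψ ∈ O) (h : Associated (cyclicAnn k Φ) (cyclicAnn k Ψ)) : Φ = Ψ :=
  hO.eq_of_isCyclicVector hΦ hΨ (hz Φ hΦ) (hz Ψ hΨ) h

theorem HasEpsMatrix.associated_star (hO : IsCanonicalSet O)
    (hz : ∀ Φ ∈ O, IsCyclicVector Φ.2 (cyclicAnn k Φ) (z Φ)) {Φ : SqMat F} (hΦ : Φ ∈ O)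
    (h : HasEpsMatrix ε Φ) : Associated (star (cyclicAnn k Φ)) (cyclicAnn k Φ) := by
  obtain ⟨M, hM⟩ := h
  exact ((hz Φ hΦ).isEpsFunctional (hO.1 Φ hΦ).1 hM).associated_star.symm

theorem similar_invStar_iff_associated (hO : IsCanonicalSet O)
    (hz : ∀ Φ ∈ O, IsCyclicVector Φ.2 (cyclicAnn k Φ) (z Φ)) {Φ Ψ : SqMat F} (hΦ : Φ ∈ O)
    (hΨ : Ψ ∈ O) :
    Similar Ψ.2 (invStar Φ) ↔ Associated (cyclicAnn k Ψ) (star (cyclicAnn k Φ)) := by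
  obtain ⟨hd, hi⟩ := hO.1 Φ hΦ
  obtain ⟨hd', hi'⟩ := hO.1 Ψ hΨ
  obtain ⟨y, hy⟩ := (hz Φ hΦ).exists_invStar hi hd
  have h1 := (hz Ψ hΨ).charpoly_associated hd'
  have h2 := hy.charpoly_associated (isUnit_det_invStar hd)
  constructor
  · rintro h
    rw [similar_invStar_iff_charpoly hO hΦ hΨ, ← charpoly_invStar hd] at h
    rw [h] at h1
    exact h1.symm.trans h2
  · intro h
    exact ((hz Ψ hΨ).of_associated h).similar hd' (isUnit_det_invStar hd) hy

theorem prime_star {p : F[T;T⁻¹]} (hp : Prime p) : Prime (star p) :=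
  (MulEquiv.prime_iff (starRingAut : F[T;T⁻¹] ≃+* F[T;T⁻¹])).2 hp

theorem Associated.star_laurent {a b : F[T;T⁻¹]} (h : Associated a b) :
    Associated (star a) (star b) :=
  associated_of_dvd_dvd (star_dvd_star h.dvd) (star_dvd_star h.symm.dvd)

variable {D : SummandList F}

theorem SummandList.Admissible.exists_prime_pow (hO : IsCanonicalSet O) (hD : D.Admissible ε O)
    (s : D.CyclicIndex) : ∃ q m, Prime q ∧ Associated (q ^ (m + 1)) (D.ann k s) := by
  rcases s with (i | i) | j
  · exact ⟨_, _, hO.prime (hD.1 i).1, Associated.refl _⟩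
  · refine ⟨_, k (D.Φ i), prime_star (hO.prime (hD.1 i).1), ?_⟩
    rw [← star_pow]
    rfl
  · exact ⟨_, _, hO.prime (hD.2 j).1, Associated.refl _⟩

theorem SummandList.Admissible.associated_star_mate (hO : IsCanonicalSet O)
    (hz : ∀ Φ ∈ O, IsCyclicVector Φ.2 (cyclicAnn k Φ) (z Φ)) (hD : D.Admissible ε O)
    (s : D.CyclicIndex) : Associated (star (D.ann k (D.mate s))) (D.ann k s) := by
  rcases s with (i | i) | j
  · change Associated (star (star (cyclicAnn k (D.Φ i)))) _
    rw [star_star]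
    rfl
  · rfl
  · exact (hD.2 j).2.1.associated_star hO hz (hD.2 j).1

/-- When Φ_(ε) exists, the annihilator of Φ is associated with its conjugate; so either half of a
summand of type (i) with this annihilator would come from Φ itself, which type (i) excludes. -/
theorem SummandList.Admissible.mem_range_of_associated (hO : IsCanonicalSet O)
    (hz : ∀ Φ ∈ O, IsCyclicVector Φ.2 (cyclicAnn k Φ) (z Φ)) (hD : D.Admissible ε O)
    {Φ : SqMat F} (hΦ : Φ ∈ O) (hEps : HasEpsMatrix ε Φ) (s : D.CyclicIndex)
    (h : Associated (D.ann k s) (cyclicAnn k Φ)) :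
    s ∈ Set.range (fun j : {j // D.Ψ j = Φ} => (Sum.inr j.1 : D.CyclicIndex)) := by
  rcases s with (i | i) | j
  · have := cyclicAnn_eq_of_associated hO hz (hD.1 i).1 hΦ h
    exact absurd (this ▸ hEps) (hD.1 i).2
  · have h1 : Associated (star (cyclicAnn k (D.Φ i))) (cyclicAnn k Φ) := h
    have h2 := (Associated.star_laurent h1).trans (hEps.associated_star hO hz hΦ)
    rw [star_star] at h2
    have := cyclicAnn_eq_of_associated hO hz (hD.1 i).1 hΦ h2
    exact absurd (this ▸ hEps) (hD.1 i).2
  · exact ⟨⟨j, cyclicAnn_eq_of_associated hO hz (hD.2 j).1 hΦ h⟩, rfl⟩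

variable {V : Type v} [AddCommGroup V] [Module F V] [Module F[T;T⁻¹] V]
  [IsScalarTower F F[T;T⁻¹] V] {B : V → V → F}
  {E : ∀ Φ : SqMat F, Matrix (Fin Φ.1) (Fin Φ.1) F}

theorem IsCyclicFrame.form_sum (hB : IsoForm ε B) {x : D.CyclicIndex → V}
    (hx : IsCyclicFrame E k z B D x) (a b : D.CyclicIndex → F[T;T⁻¹]) (r : F[T;T⁻¹]) :
    B (∑ t, a t • x t) (r • ∑ t, b t • x t)
      = ∑ t, B (x (D.mate t)) ((star (a (D.mate t)) * r * b t) • x t) := by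
  rw [Finset.smul_sum, hB.sum_right]
  refine Finset.sum_congr rfl fun t _ => ?_
  rw [hB.sum_left, Finset.sum_eq_single (D.mate t)]
  · rw [hB.adjoint, smul_smul, smul_smul, mul_assoc]
  · intro s _ hs
    rw [hB.adjoint, smul_smul, smul_smul]
    exact hx.orth _ _ hs _
  · intro h; exact absurd (Finset.mem_univ _) h

variable {D' : SummandList F}

/-- Expand B(x_i, p^k f x_j) in the second system. Summands with other annihilators contribute zero,
and φ is nondegenerate modulo p^(k+1), so the factor p^k leaves a congruence modulo p. -/
theorem IsCyclicFrame.congruence_snd [DecidableEq (SqMat F)] (hO : IsCanonicalSet O)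
    (hE : ∀ Φ ∈ O, HasEpsMatrix ε Φ → IsEpsMatrix ε Φ (E Φ))
    (hz : ∀ Φ ∈ O, IsCyclicVector Φ.2 (cyclicAnn k Φ) (z Φ)) (hB : IsoForm ε B)
    {x : D.CyclicIndex → V} (hx : IsCyclicFrame E k z B D x)
    (hD' : D'.Admissible ε O) {x' : D'.CyclicIndex → V} (hx' : IsCyclicFrame E k z B D' x')
    (hs' : IsCyclicSystem (D'.ann k) x')
    {g : D.CyclicIndex → D'.CyclicIndex → F[T;T⁻¹]} (hg : ∀ s, x s = ∑ t, g s t • x' t)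
    {Φ : SqMat F} (hΦ : Φ ∈ O) (hEps : HasEpsMatrix ε Φ) (i j : {j // D.Ψ j = Φ}) :
    toLaurent (irreducibleDivisor Φ) ∣
      ∑ t : {j // D'.Ψ j = Φ}, star (g (Sum.inr i) (Sum.inr t)) * D'.q t * g (Sum.inr j) (Sum.inr t)
        - if i = j then D.q i else 0 := by
  have hP := hO.prime hΦ
  have hφ := (hz Φ hΦ).isEpsFunctional (hO.1 Φ hΦ).1 (hE Φ hΦ hEps)
  set P := toLaurent (irreducibleDivisor Φ) with hPdef
  rw [← mul_dvd_mul_iff_left (pow_ne_zero (k Φ) hP.ne_zero), ← pow_succ]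
  change cyclicAnn k Φ ∣ _
  rw [hφ.nondeg]
  intro f
  have hann : ∀ i : {j // D.Ψ j = Φ}, cyclicAnn k Φ • x (Sum.inr i) = 0 := by
    intro i
    have h1 : cyclicAnn k (D.Ψ i) • x (Sum.inr i) = 0 := hx.ann (Sum.inr i)
    rwa [i.2] at h1
  have hgd : ∀ (i : {j // D.Ψ j = Φ}) t, D'.ann k t ∣ cyclicAnn k Φ * g (Sum.inr i) t :=
    fun i t => hs'.dvd_of_eq_sum (hg _) (hann i) t
  have hgd' : ∀ (i : {j // D.Ψ j = Φ}) t,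
      D'.ann k t ∣ cyclicAnn k Φ * star (g (Sum.inr i) (D'.mate t)) := by
    intro i t
    have h1 := star_dvd_star (hgd i (D'.mate t))
    rw [star_mul_comm] at h1
    exact (hD'.associated_star_mate hO hz t).symm.dvd.trans
      (h1.trans (mul_dvd_mul_right (hEps.associated_star hO hz hΦ).dvd _))
  have h1 : B (x (Sum.inr i)) ((P ^ k Φ * f) • x (Sum.inr j))
      = cyclicFunctional E z Φ ((if i = j then D.q i else 0) * (P ^ k Φ * f)) := by
    by_cases hij : i = j
    · subst hij
      rw [if_pos rfl, hx.gram, i.2]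
    · rw [if_neg hij, zero_mul, map_zero]
      refine hx.orth _ _ (fun h => hij ?_) _
      exact Subtype.ext (Sum.inr_injective h)
  have h3 : B (x (Sum.inr i)) ((P ^ k Φ * f) • x (Sum.inr j))
      = ∑ t : {j // D'.Ψ j = Φ}, cyclicFunctional E z Φ (D'.q t *
        (star (g (Sum.inr i) (Sum.inr t)) * (P ^ k Φ * f) * g (Sum.inr j) (Sum.inr t))) := by
    rw [hg (Sum.inr i), hg (Sum.inr j), hx'.form_sum hB]
    symm
    refine Finset.sum_of_injOn (fun t => Sum.inr t.1)
      (fun s _ t _ hst => Subtype.ext (Sum.inr_injective hst))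
      (fun _ _ => Finset.mem_coe.2 (Finset.mem_univ _)) (fun t _ ht => ?_) (fun t _ => ?_)
    · obtain ⟨q, m, hq, hqm⟩ := hD'.exists_prime_pow (k := k) hO t
      have hna : ¬ Associated (q ^ (m + 1)) (P ^ (k Φ + 1)) := fun ha => ht (by
        simpa using hD'.mem_range_of_associated hO hz hΦ hEps t (hqm.symm.trans ha))
      have h4 := dvd_mul_pow_mul_of_not_associated hP hq hna
        (hqm.dvd.trans (hgd' i t)) (hqm.dvd.trans (hgd j t))
      obtain ⟨r, hr⟩ := hqm.symm.dvd.trans h4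
      rw [show star (g (Sum.inr i) (D'.mate t)) * (P ^ k Φ * f) * g (Sum.inr j) t
        = f * r * D'.ann k t by linear_combination f * hr, mul_smul, hx'.ann, smul_zero,
        hB.zero_right]
    · change _ = B (x' (Sum.inr t.1)) _
      rw [hx'.gram, t.2]
      rfl
  rw [h1, ← map_sum, ← sub_eq_zero, ← map_sub] at h3
  rw [← neg_eq_zero, ← map_neg, ← h3]
  change cyclicFunctional E z Φ _ = _
  congr 1
  simp only [mul_sub, sub_mul, Finset.mul_sum, Finset.sum_mul]
  rw [neg_sub]
  congr 1
  · ring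
  · exact Finset.sum_congr rfl fun t _ => by ring

end Invariants

end IsometricPairs
namespace IsometricPairs

open Polynomial LaurentPolynomial

universe u v

/-! ### Necessity of the conditions. -/

section Uniqueness

variable {F : Type u} [Field F] [StarRing F] {ε : F} {O : Set (SqMat F)} {k : SqMat F → ℕ}
  {z : ∀ Φ : SqMat F, Fin Φ.1 → F} {D D' : SummandList F}
variable {V : Type v} [AddCommGroup V] [Module F V] [Module F[T;T⁻¹] V]
  [IsScalarTower F F[T;T⁻¹] V] {B : V → V → F}
  {E : ∀ Φ : SqMat F, Matrix (Fin Φ.1) (Fin Φ.1) F}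

/-- The transition matrices modulo p are mutually inverse by `IsCyclicSystem.sum_transition` and
respect the forms by `IsCyclicFrame.congruence_snd`. -/
theorem IsCyclicFrame.forms_equivalent [DecidableEq (SqMat F)] (hO : IsCanonicalSet O)
    (hE : ∀ Φ ∈ O, HasEpsMatrix ε Φ → IsEpsMatrix ε Φ (E Φ))
    (hz : ∀ Φ ∈ O, IsCyclicVector Φ.2 (cyclicAnn k Φ) (z Φ)) (hB : IsoForm ε B)
    (hD : D.Admissible ε O) {x : D.CyclicIndex → V} (hx : IsCyclicFrame E k z B D x)
    (hs : IsCyclicSystem (D.ann k) x)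
    (hD' : D'.Admissible ε O) {x' : D'.CyclicIndex → V} (hx' : IsCyclicFrame E k z B D' x')
    (hs' : IsCyclicSystem (D'.ann k) x')
    {Φ : SqMat F} (hΦ : Φ ∈ O) (hEps : HasEpsMatrix ε Φ) :
    Fintype.card {j : Fin D.l // D.Ψ j = Φ} = Fintype.card {j : Fin D'.l // D'.Ψ j = Φ} ∧
    FormsEquivalent (irreducibleDivisor Φ)
      (fun j : {j : Fin D.l // D.Ψ j = Φ} => D.q j)
      (fun j : {j : Fin D'.l // D'.Ψ j = Φ} => D'.q j) := by
  obtain ⟨hd, hi⟩ := hO.1 Φ hΦ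
  obtain ⟨hm, hp, -⟩ := irreducibleDivisor_spec Φ hi.1
  have h0 := irreducibleDivisor_coeff_zero_ne_zero hi hd
  have hP := hO.prime hΦ
  have hPs := ((hz Φ hΦ).isEpsFunctional hd (hE Φ hΦ hEps)).associated_star_of_pow hP
  have hv := vee_eq_self hm hp h0 hPs.symm
  choose g hg using fun s => hs'.gen (x s)
  choose g' hg' using fun s => hs.gen (x' s)
  set π : F[T;T⁻¹] →ₐ[F] AdjoinRoot (irreducibleDivisor Φ) := unitEval (AdjoinRoot.root _)
  have hπ := unitEval_root_eq_zero_iff hp h0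
  have hι : Function.Injective fun j : {j // D.Ψ j = Φ} => (Sum.inr j.1 : D.CyclicIndex) :=
    fun s t hst => Subtype.ext (Sum.inr_injective hst)
  have hι' : Function.Injective fun j : {j // D'.Ψ j = Φ} => (Sum.inr j.1 : D'.CyclicIndex) :=
    fun s t hst => Subtype.ext (Sum.inr_injective hst)
  have hc : ∀ j : {j // D.Ψ j = Φ}, Associated (D.ann k (Sum.inr j.1)) (cyclicAnn k Φ) := by
    intro j
    change Associated (cyclicAnn k (D.Ψ j)) _
    rw [j.2]
  have hc' : ∀ j : {j // D'.Ψ j = Φ}, Associated (D'.ann k (Sum.inr j.1)) (cyclicAnn k Φ) := by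
    intro j
    change Associated (cyclicAnn k (D'.Ψ j)) _
    rw [j.2]
  have h1 := hs.sum_transition hs' (hD'.exists_prime_pow hO) hg hg' hP hι hc hι'
    (hD'.mem_range_of_associated hO hz hΦ hEps) (π := π.toRingHom) hπ
  have h2 := hs'.sum_transition hs (hD.exists_prime_pow hO) hg' hg hP hι' hc' hι
    (hD.mem_range_of_associated hO hz hΦ hEps) (π := π.toRingHom) hπ
  let e : ({j // D.Ψ j = Φ} → AdjoinRoot (irreducibleDivisor Φ))
      ≃ₗ[AdjoinRoot (irreducibleDivisor Φ)]
        ({j // D'.Ψ j = Φ} → AdjoinRoot (irreducibleDivisor Φ)) :=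
    Matrix.toLin'OfInv
      (M := Matrix.of fun (r : {j // D.Ψ j = Φ}) (t : {j // D'.Ψ j = Φ}) =>
        π (g' (Sum.inr t) (Sum.inr r)))
      (M' := Matrix.of fun (t : {j // D'.Ψ j = Φ}) (r : {j // D.Ψ j = Φ}) =>
        π (g (Sum.inr r) (Sum.inr t)))
      (by
        ext r s
        rw [← Matrix.transpose_one, Matrix.transpose_apply, ← h1, Matrix.mul_apply]
        exact Finset.sum_congr rfl fun t _ => mul_comm _ _)
      (by
        ext r s
        rw [← Matrix.transpose_one, Matrix.transpose_apply, ← h2, Matrix.mul_apply]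
        exact Finset.sum_congr rfl fun t _ => mul_comm _ _)
  have : Fact (Irreducible (irreducibleDivisor Φ)) := ⟨hp⟩
  refine ⟨card_eq_of_linearEquiv _ e, e, fun a b => ?_⟩
  exact diagForm_eq_of_congruence hp h0 hv
    (g := fun (i : {j // D.Ψ j = Φ}) (t : {j // D'.Ψ j = Φ}) => g (Sum.inr i) (Sum.inr t))
    (hx.congruence_snd hO hE hz hB hD' hx' hs' hg hΦ hEps) a b

open Classical in
-- A summand of type (i) contributes the two annihilators of Φ_i and Φ_i^{-*}; a matching summand is
-- counted twice if the annihilator of Φ is associated with its conjugate, and once otherwise.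
theorem SummandList.Admissible.card_fst (hO : IsCanonicalSet O)
    (hz : ∀ Φ ∈ O, IsCyclicVector Φ.2 (cyclicAnn k Φ) (z Φ)) (hD : D.Admissible ε O)
    {Φ : SqMat F} (hΦ : Φ ∈ O) (hEps : ¬ HasEpsMatrix ε Φ) :
    Fintype.card {s // Associated (D.ann k s) (cyclicAnn k Φ)}
      = (if Associated (cyclicAnn k Φ) (star (cyclicAnn k Φ)) then 2 else 1) *
        Fintype.card {i // Associated (cyclicAnn k (D.Φ i)) (cyclicAnn k Φ) ∨
          Associated (cyclicAnn k (D.Φ i)) (star (cyclicAnn k Φ))} := by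
  have hst : ∀ i, Associated (star (cyclicAnn k (D.Φ i))) (cyclicAnn k Φ) ↔
      Associated (cyclicAnn k (D.Φ i)) (star (cyclicAnn k Φ)) := fun i =>
    ⟨fun h => by simpa using Associated.star_laurent h,
      fun h => by simpa using Associated.star_laurent h⟩
  have hno : ∀ j, ¬ Associated (cyclicAnn k (D.Ψ j)) (cyclicAnn k Φ) := fun j h =>
    hEps (cyclicAnn_eq_of_associated hO hz (hD.2 j).1 hΦ h ▸ (hD.2 j).2.1)
  rw [Fintype.card_subtype, Fintype.card_subtype, Finset.card_filter, Finset.card_filter,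
    Fintype.sum_sum_type, Fintype.sum_sum_type]
  simp only [SummandList.ann, Sum.elim_inl, Sum.elim_inr, hst, hno, if_false,
    Finset.sum_const_zero, add_zero]
  rw [← Finset.sum_add_distrib, Finset.mul_sum]
  refine Finset.sum_congr rfl fun i _ => ?_
  by_cases h : Associated (cyclicAnn k Φ) (star (cyclicAnn k Φ))
  · have : Associated (cyclicAnn k (D.Φ i)) (star (cyclicAnn k Φ)) ↔
        Associated (cyclicAnn k (D.Φ i)) (cyclicAnn k Φ) :=
      ⟨fun h' => h'.trans h.symm, fun h' => h'.trans h⟩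
    rw [if_pos h]
    simp only [this, or_self]
    by_cases h1 : Associated (cyclicAnn k (D.Φ i)) (cyclicAnn k Φ) <;> simp [h1]
  · rw [if_neg h, one_mul]
    by_cases h1 : Associated (cyclicAnn k (D.Φ i)) (cyclicAnn k Φ)
    · have h3 : ¬ Associated (cyclicAnn k (D.Φ i)) (star (cyclicAnn k Φ)) := fun h' =>
        h (h1.symm.trans h')
      simp [h1, h3]
    · simp [h1]

open Classical in
theorem equivalent_of_isCyclicFrame (hO : IsCanonicalSet O)
    (hE : ∀ Φ ∈ O, HasEpsMatrix ε Φ → IsEpsMatrix ε Φ (E Φ))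
    (hz : ∀ Φ ∈ O, IsCyclicVector Φ.2 (cyclicAnn k Φ) (z Φ)) (hB : IsoForm ε B)
    (hD : D.Admissible ε O) {x : D.CyclicIndex → V} (hx : IsCyclicFrame E k z B D x)
    (hs : IsCyclicSystem (D.ann k) x)
    (hD' : D'.Admissible ε O) {x' : D'.CyclicIndex → V} (hx' : IsCyclicFrame E k z B D' x')
    (hs' : IsCyclicSystem (D'.ann k) x') : D.Equivalent D' := by
  constructor
  -- The class of Φ up to exchange with Φ^{-*}. Fibres over each class have equal size in D and D',
  -- and bijections between them glue to σ.
  · let cl : SqMat F → Set F[T;T⁻¹] := fun Φ =>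
      {f | Associated f (cyclicAnn k Φ) ∨ Associated f (star (cyclicAnn k Φ))}
    have hcl : ∀ Φ Ψ : SqMat F, cl Φ = cl Ψ ↔ Associated (cyclicAnn k Φ) (cyclicAnn k Ψ) ∨
        Associated (cyclicAnn k Φ) (star (cyclicAnn k Ψ)) := by
      intro Φ Ψ
      constructor
      · intro h
        have : cyclicAnn k Φ ∈ cl Φ := Or.inl (Associated.refl _)
        rwa [h] at this
      · rintro (h | h)
        · have h' := Associated.star_laurent h
          ext f
          exact or_congr ⟨fun hf => hf.trans h, fun hf => hf.trans h.symm⟩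
            ⟨fun hf => hf.trans h', fun hf => hf.trans h'.symm⟩
        · have h' := Associated.star_laurent h
          rw [star_star] at h'
          ext f
          exact (or_congr ⟨fun hf => hf.trans h, fun hf => hf.trans h.symm⟩
            ⟨fun hf => hf.trans h', fun hf => hf.trans h'.symm⟩).trans or_comm
    have hcard : ∀ Φ ∈ O, ¬ HasEpsMatrix ε Φ →
        Fintype.card {i // cl (D.Φ i) = cl Φ} = Fintype.card {i // cl (D'.Φ i) = cl Φ} := by
      intro Φ hΦ hEps
      have h1 := hs.card_eq (hD.exists_prime_pow hO) hs' (hD'.exists_prime_pow hO) (hO.prime hΦ)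
        (k Φ)
      have h2 := hD.card_fst hO hz hΦ hEps
      have h3 := hD'.card_fst hO hz hΦ hEps
      simp only [hcl]
      have hpos : 0 < if Associated (cyclicAnn k Φ) (star (cyclicAnn k Φ)) then 2 else 1 := by
        split_ifs <;> norm_num
      exact Nat.eq_of_mul_eq_mul_left hpos (h2.symm.trans (h1.trans h3))
    have hfib : ∀ X, Nonempty ({i // cl (D.Φ i) = X} ≃ {i // cl (D'.Φ i) = X}) := by
      intro X
      by_cases h : ∃ Φ ∈ O, ¬ HasEpsMatrix ε Φ ∧ cl Φ = X
      · obtain ⟨Φ, hΦ, hEps, rfl⟩ := h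
        exact ⟨Fintype.equivOfCardEq (hcard Φ hΦ hEps)⟩
      · have h1 : IsEmpty {i // cl (D.Φ i) = X} :=
          ⟨fun i => h ⟨_, (hD.1 i).1, (hD.1 i).2, i.2⟩⟩
        have h2 : IsEmpty {i // cl (D'.Φ i) = X} :=
          ⟨fun i => h ⟨_, (hD'.1 i).1, (hD'.1 i).2, i.2⟩⟩
        exact ⟨Equiv.equivOfIsEmpty _ _⟩
    refine ⟨Equiv.ofFiberEquiv (f := fun i => cl (D.Φ i)) (g := fun i => cl (D'.Φ i))
      fun X => (hfib X).some, fun i => ?_⟩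
    have h1 := Equiv.ofFiberEquiv_map (f := fun i => cl (D.Φ i)) (g := fun i => cl (D'.Φ i))
      (fun X => (hfib X).some) i
    rw [hcl] at h1
    rcases h1 with h1 | h1
    · exact Or.inl (cyclicAnn_eq_of_associated hO hz (hD'.1 _).1 (hD.1 i).1 h1)
    · exact Or.inr ((similar_invStar_iff_associated hO hz (hD.1 i).1 (hD'.1 _).1).2 h1)
  · intro Φ
    by_cases h : Φ ∈ O ∧ HasEpsMatrix ε Φ
    · exact hx.forms_equivalent hO hE hz hB hD hs hD' hx' hs' h.1 h.2
    · have h1 : IsEmpty {j : Fin D.l // D.Ψ j = Φ} :=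
        ⟨fun j => h (j.2 ▸ ⟨(hD.2 j).1, (hD.2 j).2.1⟩)⟩
      have h2 : IsEmpty {j : Fin D'.l // D'.Ψ j = Φ} :=
        ⟨fun j => h (j.2 ▸ ⟨(hD'.2 j).1, (hD'.2 j).2.1⟩)⟩
      exact ⟨by rw [Fintype.card_eq_zero, Fintype.card_eq_zero], formsEquivalent_of_isEmpty _ _⟩

end Uniqueness

end IsometricPairs
namespace IsometricPairs

open Polynomial LaurentPolynomial

universe u v

/-! ### Sufficiency of the conditions. -/

section Sufficiency

variable {F : Type u} [Field F] [StarRing F] {ε : F} {O : Set (SqMat F)} {k : SqMat F → ℕ}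
  {z : ∀ Φ : SqMat F, Fin Φ.1 → F} {D D' : SummandList F}

theorem card_eq_of_similar {F : Type u} [Field F] {m n : Type*} [Fintype m] [Fintype n]
    [DecidableEq m] [DecidableEq n] {P : Matrix m m F} {Q : Matrix n n F} (h : Similar P Q) :
    Fintype.card m = Fintype.card n := by
  obtain ⟨S, R, h1, h2, -⟩ := h
  exact card_eq_of_linearEquiv F (Matrix.toLin'OfInv h1 h2)

theorem SummandList.Equivalent.dim_eq (h : D.Equivalent D') : D'.dim = D.dim := by
  classical
  obtain ⟨⟨σ, hσ⟩, h⟩ := h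
  rw [SummandList.dim, SummandList.dim]
  congr 1
  · refine (Fintype.sum_equiv σ _ _ fun i => ?_).symm
    have h1 : (D'.Φ (σ i)).1 = (D.Φ i).1 := by
      rcases hσ i with h2 | h2
      · rw [h2]
      · simpa using card_eq_of_similar h2
    rw [h1]
  · have hc : ∀ Φ, Fintype.card {j // D.Ψ j = Φ} = Fintype.card {j // D'.Ψ j = Φ} := fun Φ => by
      convert (h Φ).1
    let τ := Equiv.ofFiberEquiv (f := D.Ψ) (g := D'.Ψ) fun Φ => Fintype.equivOfCardEq (hc Φ)
    refine (Fintype.sum_equiv τ _ _ fun j => ?_).symm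
    exact congrArg Sigma.fst (Equiv.ofFiberEquiv_map (f := D.Ψ) (g := D'.Ψ) _ j).symm

/-- An equivalence over F(κ) is a congruence of diagonal matrices modulo p; `exists_congruence_lift`
applies because each q' is invertible modulo powers of p. -/
theorem FormsEquivalent.exists_lift (hO : IsCanonicalSet O) (h2 : (2 : F) ≠ 0) {Φ : SqMat F}
    (hΦ : Φ ∈ O) (hz : ∀ Φ ∈ O, IsCyclicVector Φ.2 (cyclicAnn k Φ) (z Φ))
    (hEps : HasEpsMatrix ε Φ) {I J : Type*} [Fintype I] [Fintype J] [DecidableEq J]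
    {q : I → F[T;T⁻¹]} {q' : J → F[T;T⁻¹]}
    (hq : ∀ i, IsSymmetricForm (irreducibleDivisor Φ) (q i))
    (hq' : ∀ t, IsSymmetricForm (irreducibleDivisor Φ) (q' t)) (hq0 : ∀ t, q' t ≠ 0)
    (h : FormsEquivalent (irreducibleDivisor Φ) q q') : ∃ H : I → J → F[T;T⁻¹],
      ∀ s t, cyclicAnn k Φ ∣ ∑ i, star (H i s) * q i * H i t - if s = t then q' s else 0 := by
  classical
  obtain ⟨hd, hi⟩ := hO.1 Φ hΦ
  obtain ⟨hm, hp, -⟩ := irreducibleDivisor_spec Φ hi.1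
  have h0 := irreducibleDivisor_coeff_zero_ne_zero hi hd
  have hP := hO.prime hΦ
  have hPs : Associated (toLaurent (irreducibleDivisor Φ)) 
      (star (toLaurent (irreducibleDivisor Φ))) := by
    obtain ⟨M, hM⟩ := hEps
    exact ((hz Φ hΦ).isEpsFunctional hd hM).associated_star_of_pow hP
  have hv := vee_eq_self hm hp h0 hPs.symm
  obtain ⟨g, hg⟩ := h.exists_congruence hp h0 hv
  choose Z hZ using hg
  have hab : ∀ t, IsCoprime (toLaurent (irreducibleDivisor Φ) ^ (k Φ + 1)) (q' t) := fun t =>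
    isCoprime_pow_of_not_dvd hP (fun hd => hq0 t ((hq' t).eq_zero_of_dvd hm hp h0 h2 hd)) _
  choose a b hab using hab
  have happ : ∀ (G : Matrix I J F[T;T⁻¹]) s t,
      (G.conjTranspose * Matrix.diagonal q * G) s t = ∑ i, star (G i s) * q i * G i t := by
    intro G s t
    rw [Matrix.mul_apply]
    simp only [Matrix.mul_diagonal, Matrix.conjTranspose_apply]
  obtain ⟨H, Y, hY⟩ := exists_congruence_lift h2 hPs.dvd (k Φ) (Q := Matrix.diagonal q)
    (Q' := Matrix.diagonal q') (R := Matrix.diagonal b)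
    (by rw [Matrix.diagonal_conjTranspose]; congr 1; exact funext fun i => (hq i).star_eq)
    (by rw [Matrix.diagonal_conjTranspose]; congr 1; exact funext fun i => (hq' i).star_eq)
    ⟨Matrix.diagonal fun t => -a t, by
      rw [Matrix.diagonal_mul_diagonal, ← Matrix.diagonal_one, ← Matrix.diagonal_smul,
        Matrix.diagonal_add]
      congr 1
      refine funext fun t => ?_
      rw [Pi.smul_apply, smul_eq_mul]
      linear_combination hab t⟩
    (H₀ := Matrix.of g) ⟨Matrix.of Z, by
      ext1 s t
      rw [happ, Matrix.add_apply, Matrix.diagonal_apply, Matrix.smul_apply, Matrix.of_apply,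
        smul_eq_mul, ← hZ]
      simp⟩ (k Φ) le_rfl
  refine ⟨H, fun s t => ⟨Y s t, ?_⟩⟩
  have h3 := congrFun (congrFun hY s) t
  rw [happ, Matrix.add_apply, Matrix.diagonal_apply, Matrix.smul_apply, smul_eq_mul] at h3
  rw [h3, add_sub_cancel_left]
  rfl

variable {V : Type v} [AddCommGroup V] [Module F V] [Module F[T;T⁻¹] V]
  [IsScalarTower F F[T;T⁻¹] V] {B : V → V → F}
  {E : ∀ Φ : SqMat F, Matrix (Fin Φ.1) (Fin Φ.1) F}

theorem IsCyclicFrame.exists_of_equivalent (hO : IsCanonicalSet O) (h2 : (2 : F) ≠ 0)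
    (hE : ∀ Φ ∈ O, HasEpsMatrix ε Φ → IsEpsMatrix ε Φ (E Φ))
    (hz : ∀ Φ ∈ O, IsCyclicVector Φ.2 (cyclicAnn k Φ) (z Φ)) (hB : IsoForm ε B)
    (hD : D.Admissible ε O) {x : D.CyclicIndex → V} (hx : IsCyclicFrame E k z B D x)
    (hD' : D'.Admissible ε O) (h : D.Equivalent D') : ∃ x', IsCyclicFrame E k z B D' x' := by
  classical
  obtain ⟨⟨σ, hσ⟩, h⟩ := h
  -- On generators of type (i) summands, τ follows σ⁻¹ and interchanges the two halves of a summand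
  -- where Φ has been replaced.
  obtain ⟨τ, hτs, hτi, hτ⟩ : ∃ τ : Fin D'.k ⊕ Fin D'.k → Fin D.k ⊕ Fin D.k,
      (∀ s, τ s.swap = (τ s).swap) ∧ Function.Injective τ ∧
        ∀ s, Associated (D.ann k (Sum.inl (τ s))) (D'.ann k (Sum.inl s)) := by
    have hσ' : ∀ i, D'.Φ i = D.Φ (σ.symm i) ∨
        Similar (D'.Φ i).2 (invStar (D.Φ (σ.symm i))) := fun i => by
      have h1 := hσ (σ.symm i)
      rwa [σ.apply_symm_apply] at h1
    refine ⟨Sum.elim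
      (fun i => if D'.Φ i = D.Φ (σ.symm i) then Sum.inl (σ.symm i) else Sum.inr (σ.symm i))
      (fun i => if D'.Φ i = D.Φ (σ.symm i) then Sum.inr (σ.symm i) else Sum.inl (σ.symm i)),
      ?_, ?_, ?_⟩
    · rintro (i | i) <;> simp only [Sum.swap_inl, Sum.swap_inr, Sum.elim_inl, Sum.elim_inr] <;>
        split_ifs <;> rfl
    · have key : ∀ {i j : Fin D'.k} {a b : Fin D.k ⊕ Fin D.k},
          (a = Sum.inl (σ.symm i) ∨ a = Sum.inr (σ.symm i)) →
          (b = Sum.inl (σ.symm j) ∨ b = Sum.inr (σ.symm j)) → a = b → i = j := by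
        rintro i j a b (rfl | rfl) (rfl | rfl) hab <;> simp at hab <;> exact hab
      rintro (i | i) (j | j) hij
      all_goals
        simp only [Sum.elim_inl, Sum.elim_inr] at hij
        obtain rfl : i = j := key (by split_ifs <;> simp) (by split_ifs <;> simp) hij
      · rfl
      · split_ifs at hij
      · split_ifs at hij
      · rfl
    · rintro (i | i)
      · simp only [Sum.elim_inl]
        split_ifs with hi
        · simp [SummandList.ann, hi]
        · have h3 := (similar_invStar_iff_associated hO hz (hD.1 _).1 (hD'.1 i).1).1
            ((hσ' i).resolve_left hi)
          exact h3.symm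
      · simp only [Sum.elim_inr]
        split_ifs with hi
        · simp [SummandList.ann, hi]
        · have h3 := (similar_invStar_iff_associated hO hz (hD.1 _).1 (hD'.1 i).1).1
            ((hσ' i).resolve_left hi)
          have h4 := Associated.star_laurent h3
          rw [star_star] at h4
          exact h4.symm
  have hex : ∀ Φ : SqMat F, ∃ H : {j // D.Ψ j = Φ} → {j // D'.Ψ j = Φ} → F[T;T⁻¹],
      ∀ s t, cyclicAnn k Φ ∣
        ∑ i, star (H i s) * D.q i * H i t - if s = t then D'.q s else 0 := by
    intro Φ
    by_cases hΦ : Nonempty {j // D'.Ψ j = Φ}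
    · obtain ⟨j, rfl⟩ := hΦ
      have hf : FormsEquivalent (irreducibleDivisor (D'.Ψ j))
          (fun i : {i : Fin D.l // D.Ψ i = D'.Ψ j} => D.q i)
          (fun i : {i : Fin D'.l // D'.Ψ i = D'.Ψ j} => D'.q i) := by
        convert (h (D'.Ψ j)).2
      exact hf.exists_lift hO h2 (hD'.2 j).1 hz (hD'.2 j).2.1
        (fun i => by have h1 := (hD.2 i).2.2.2; rwa [i.2] at h1)
        (fun i => by have h1 := (hD'.2 i).2.2.2; rwa [i.2] at h1)
        (fun i => (hD'.2 i).2.2.1)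
    · exact ⟨fun _ _ => 0, fun s => absurd ⟨s⟩ hΦ⟩
  choose H hH using hex
  -- The lifted congruences for the various Φ are glued into one matrix, with zeros between
  -- different Φ; its columns give the new generators w.
  obtain ⟨G, hGH, hG0⟩ : ∃ G : Fin D.l → Fin D'.l → F[T;T⁻¹],
      (∀ Φ (i : {j // D.Ψ j = Φ}) (t : {j // D'.Ψ j = Φ}), G i t = H Φ i t) ∧
      ∀ i t, D.Ψ i ≠ D'.Ψ t → G i t = 0 := by
    refine ⟨fun i t => if hi : D.Ψ i = D'.Ψ t then H (D'.Ψ t) ⟨i, hi⟩ ⟨t, rfl⟩ else 0, ?_,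
      fun i t hi => dif_neg hi⟩
    rintro Φ ⟨i, hi⟩ ⟨t, rfl⟩
    exact dif_pos hi
  set w : Fin D'.l → V := fun t => ∑ i, G i t • x (Sum.inr i) with hw
  have hww : ∀ s t (f : F[T;T⁻¹]), B (w s) (f • w t)
      = if s = t then cyclicFunctional E z (D'.Ψ t) (D'.q t * f) else 0 := by
    intro s t f
    have h3 : B (w s) (f • w t)
        = ∑ i, cyclicFunctional E z (D.Ψ i) (D.q i * (star (G i s) * f * G i t)) := by
      rw [hw, Finset.smul_sum, hB.sum_right]
      refine Finset.sum_congr rfl fun i _ => ?_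
      rw [hB.sum_left, Finset.sum_eq_single i]
      · rw [hB.adjoint, smul_smul, smul_smul, hx.gram]
      · intro j _ hj
        rw [hB.adjoint, smul_smul, smul_smul]
        exact hx.orth _ _ (fun h => hj (Sum.inr_injective h)) _
      · intro h; exact absurd (Finset.mem_univ _) h
    by_cases hst : D'.Ψ s = D'.Ψ t
    · have hφ := (hz _ (hD'.2 t).1).isEpsFunctional (hO.1 _ (hD'.2 t).1).1
        (hE _ (hD'.2 t).1 (hD'.2 t).2.1)
      have h4 : B (w s) (f • w t) = ∑ i : {j // D.Ψ j = D'.Ψ t},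
          cyclicFunctional E z (D'.Ψ t) (D.q i * (star (G i s) * f * G i t)) := by
        rw [h3]
        symm
        refine Finset.sum_of_injOn (fun i => i.1) (fun i _ j _ hij => Subtype.ext hij)
          (fun _ _ => Finset.mem_coe.2 (Finset.mem_univ _)) (fun i _ hi => ?_) (fun i _ => ?_)
        · rw [hG0 i t (by simpa using hi), mul_zero, mul_zero, map_zero]
        · rw [i.2]
      have h5 : (if s = t then cyclicFunctional E z (D'.Ψ t) (D'.q t * f) else 0)
          = cyclicFunctional E z (D'.Ψ t) ((if (⟨s, hst⟩ : {j // D'.Ψ j = D'.Ψ t}) = ⟨t, rfl⟩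
            then D'.q s else 0) * f) := by
        by_cases hs : s = t
        · subst hs; simp
        · rw [if_neg hs, if_neg (fun h => hs (congrArg Subtype.val h)), zero_mul, map_zero]
      rw [h4, h5, ← map_sum]
      refine hφ.apply_eq_of_dvd ?_
      obtain ⟨r, hr⟩ := hH (D'.Ψ t) ⟨s, hst⟩ ⟨t, rfl⟩
      refine ⟨r * f, ?_⟩
      rw [← mul_assoc, ← hr, sub_mul, Finset.sum_mul]
      congr 1
      refine Finset.sum_congr rfl fun i _ => ?_
      rw [← hGH _ i ⟨s, hst⟩, ← hGH _ i ⟨t, rfl⟩]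
      ring
    · rw [h3, if_neg (fun h => hst (by rw [h]))]
      refine Finset.sum_eq_zero fun i _ => ?_
      by_cases hi : D.Ψ i = D'.Ψ s
      · rw [hG0 i t (fun h => hst (hi ▸ h)), mul_zero, mul_zero, map_zero]
      · rw [hG0 i s hi, star_zero, zero_mul, zero_mul, mul_zero, map_zero]
  have hlr : ∀ s t (f : F[T;T⁻¹]), B (x (Sum.inl s)) (f • w t) = 0 := by
    intro s t f
    rw [hw, Finset.smul_sum, hB.sum_right]
    refine Finset.sum_eq_zero fun i _ => ?_
    rw [smul_smul]
    exact hx.orth _ _ (by simp [SummandList.mate]) _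
  refine ⟨Sum.elim (fun s => x (Sum.inl (τ s))) w, ?_, ?_, ?_, ?_⟩
  · rintro (s | t)
    · obtain ⟨r, hr⟩ := (hτ s).dvd
      rw [hr, mul_comm, mul_smul]
      exact (congrArg _ (hx.ann _)).trans (smul_zero _)
    · change cyclicAnn k (D'.Ψ t) • w t = 0
      rw [hw, Finset.smul_sum]
      refine Finset.sum_eq_zero fun i _ => ?_
      by_cases hi : D.Ψ i = D'.Ψ t
      · rw [smul_comm, ← hi]
        exact (congrArg _ (hx.ann (Sum.inr i))).trans (smul_zero _)
      · rw [hG0 i t hi, zero_smul, smul_zero]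
  · rintro (s | s) (t | t) hst f
    · refine hx.orth _ _ (fun h => hst ?_) f
      have h3 : τ t = (τ s).swap := Sum.inl_injective h
      rw [← hτs] at h3
      exact congrArg Sum.inl (hτi h3)
    · change B (w t) (f • x (Sum.inl (τ s))) = 0
      rw [hB.herm, hB.adjoint, hlr, star_zero, mul_zero]
    · exact hlr _ _ _
    · exact (hww t s f).trans (if_neg fun h => hst (by rw [h]; rfl))
  · intro s g hg
    refine (hτ s).symm.dvd.trans (hx.nondeg (τ s) g fun f => ?_)
    have := hg f
    simp only [SummandList.mate, Sum.map_inl, Sum.elim_inl, hτs] at this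
    exact this
  · intro j f
    exact (hww j j f).trans (if_pos rfl)

end Sufficiency

/-! ### The classification for a given module. -/

section Classification

variable {F : Type u} [Field F] [StarRing F] {ε : F} {O : Set (SqMat F)} {D D' : SummandList F}
  {E : ∀ Φ : SqMat F, Matrix (Fin Φ.1) (Fin Φ.1) F}
variable {V : Type v} [AddCommGroup V] [Module F V]

theorem IsFrame.exists_isCyclicSystem [Module F[T;T⁻¹] V] [IsScalarTower F F[T;T⁻¹] V]
    [FiniteDimensional F V] {B : V → V → F} {k : SqMat F → ℕ} {z : ∀ Φ : SqMat F, Fin Φ.1 → F}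
    (hO : IsCanonicalSet O) (h2 : (2 : F) ≠ 0) (hε : ε * star ε = 1)
    (hE : ∀ Φ ∈ O, HasEpsMatrix ε Φ → IsEpsMatrix ε Φ (E Φ))
    (hz : ∀ Φ ∈ O, IsCyclicVector Φ.2 (cyclicAnn k Φ) (z Φ)) (hB : IsoForm ε B)
    (hD : D.Admissible ε O) {e₁ e₂} (h : IsFrame ε E B D e₁ e₂)
    (hdim : D.dim = Module.finrank F V) :
    ∃ x, IsCyclicFrame E k z B D x ∧ IsCyclicSystem (D.ann k) x := by
  obtain ⟨x, hx, hgen⟩ := h.exists_isCyclicFrame hO hε hz hD hE hB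
  have hli := h.linearIndependent hB hε fun j => isUnit_det_gram_snd hO h2 (hD.2 j).1
    (hE _ (hD.2 j).1 (hD.2 j).2.1) (hD.2 j).2.2.2 (hD.2 j).2.2.1
  have hspan := hli.span_eq_top_of_card_eq_finrank' (by rw [card_index, hdim])
  exact ⟨x, hx, hx.ann, fun v => hgen v (by rw [hspan]; exact Submodule.mem_top),
    fun g hg => hx.dvd_of_sum_eq_zero hO h2 hE hz hD hB hg⟩

theorem represents_iff_equivalent [Module F[T;T⁻¹] V] [IsScalarTower F F[T;T⁻¹] V]
    [FiniteDimensional F V] (hO : IsCanonicalSet O) (h2 : (2 : F) ≠ 0) (hε : ε * star ε = 1)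
    (hE : ∀ Φ ∈ O, HasEpsMatrix ε Φ → IsEpsMatrix ε Φ (E Φ)) (hD : D.Admissible ε O)
    (hD' : D'.Admissible ε O) {A : V →ₗ[F] V} (hA : ∀ v, (T 1 : F[T;T⁻¹]) • v = A v)
    {B : V →ₗ⋆[F] V →ₗ[F] F} (hB : IsoForm ε (fun u v => B u v))
    (h : D.Represents ε E A B) : D'.Represents ε E A B ↔ D.Equivalent D' := by
  obtain ⟨k, z, hz⟩ := hO.exists_cyclicData
  rw [represents_iff hO h2 hε hE hD hA hB] at h
  obtain ⟨hdim, e₁, e₂, he⟩ := h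
  obtain ⟨x, hx, hs⟩ := he.exists_isCyclicSystem hO h2 hε hE hz hB hD hdim
  rw [represents_iff hO h2 hε hE hD' hA hB]
  constructor
  · rintro ⟨hdim', e₁', e₂', he'⟩
    obtain ⟨x', hx', hs'⟩ := he'.exists_isCyclicSystem hO h2 hε hE hz hB hD' hdim'
    exact equivalent_of_isCyclicFrame hO hE hz hB hD hx hs hD' hx' hs'
  · intro hDD
    obtain ⟨x', hx'⟩ := hx.exists_of_equivalent hO h2 hE hz hB hD hD' hDD
    exact ⟨hDD.dim_eq.trans hdim, hx'.exists_isFrame hO hE hz hD' hB⟩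

/-- An invertible operator makes a vector space a module over Laurent polynomials. -/
noncomputable abbrev operatorModule (A : V →ₗ[F] V) : Module F[T;T⁻¹] V :=
  Module.compHom V (unitEval (F := F) (A : Module.End F V)).toRingHom

end Classification

end IsometricPairs

/-! ### The theorem for an isometric operator. -/

theorem theorem2p2 {F : Type*} [Field F] [StarRing F] (h2 : (2 : F) ≠ 0)
    (ε : F) (hε : ε * star ε = 1)
    {V : Type*} [AddCommGroup V] [Module F V] [FiniteDimensional F V]
    (B : V →ₗ⋆[F] V →ₗ[F] F) (hBnd : B.Nondegenerate)
    (hBε : ∀ u v, B u v = ε * star (B v u))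
    (A : V →ₗ[F] V) (hA : ∀ u v, B (A u) (A v) = B u v)
    (O : Set (IsometricPairs.SqMat F)) (hO : IsometricPairs.IsCanonicalSet O)
    (E : ∀ Φ : IsometricPairs.SqMat F, Matrix (Fin Φ.1) (Fin Φ.1) F)
    (hE : ∀ Φ ∈ O, IsometricPairs.HasEpsMatrix ε Φ → IsometricPairs.IsEpsMatrix ε Φ (E Φ)) :
    (∃ D : IsometricPairs.SummandList F, D.Admissible ε O ∧ D.Represents ε E A B) ∧
    (∀ D D' : IsometricPairs.SummandList F, D.Admissible ε O → D'.Admissible ε O →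
      D.Represents ε E A B → (D'.Represents ε E A B ↔ D.Equivalent D')) ∧
    (∀ Φ ∈ O, ∀ Ψ ∈ O, IsometricPairs.Similar Ψ.2 (IsometricPairs.invStar Φ) ↔
      Ψ.2.charpoly = IsometricPairs.vee Φ.2.charpoly) := by

  have hinj : Function.Injective A := by
    rw [injective_iff_map_eq_zero]
    intro u hu
    refine hBnd.1 u fun v => ?_
    rw [← hA, hu, map_zero, LinearMap.zero_apply]
  have hu : IsUnit (A : Module.End F V) := by
    rw [Module.End.isUnit_iff]
    exact ⟨hinj, LinearMap.injective_iff_surjective.1 hinj⟩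
  let _ : Module (LaurentPolynomial F) V := IsometricPairs.operatorModule A
  have hsmul : ∀ (f : LaurentPolynomial F) (v : V),
      f • v = IsometricPairs.unitEval (A : Module.End F V) f v := fun _ _ => rfl
  have _ : IsScalarTower F (LaurentPolynomial F) V :=
    ⟨fun a f v => by rw [hsmul, hsmul, map_smul, LinearMap.smul_apply]⟩
  have hT : ∀ v, (LaurentPolynomial.T 1 : LaurentPolynomial F) • v = A v := fun v => by
    rw [hsmul, IsometricPairs.unitEval_T_one hu]
  have hB : IsometricPairs.IsoForm ε (fun u v => B u v) :=
    ⟨fun u v w => map_add _ _ _, fun a u v => by rw [map_smul, smul_eq_mul], hBε,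
      fun u v => by rw [hT, hT, hA], hBnd.1⟩
  refine ⟨?_, fun D D' hD hD' h =>
    IsometricPairs.represents_iff_equivalent hO h2 hε hE hD hD' hT hB h,
    fun Φ hΦ Ψ hΨ => IsometricPairs.similar_invStar_iff_charpoly hO hΦ hΨ⟩
  obtain ⟨D, hD, hdim, he⟩ := IsometricPairs.IsoForm.exists_isFrame hε h2 hO hE _ hB rfl
  exact ⟨D, hD, (IsometricPairs.represents_iff hO h2 hε hE hD hT hB).2 ⟨hdim, he⟩⟩
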